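/- **Setting.** Let $d\ge 1$, $r>0$, let $D\subseteq[0,r]^d$ be compact and convex, let $t_n=nh$ ($h>0$) be sampling times, and let $f(x;t)=V(x;t)+U(x)$. * $V$ is known; at all sampling times $t_n$, $n\ge1$, $-V(\cdot;t_n)$ is convex on $D$ and differentiable with $L$-Lipschitz gradient over $D$; $D_g:=\sup_{n\ge 1,\,y\in D}\|\nabla V(y;t_n)\|_\infty<\infty$; and $\Delta_n:=\max_{x\in D}|V(x;t_n)-V(x;t_{n-1})|\le\Delta<\infty$ for all $n\ge2$. * $U$ is a sample path of a Gaussian process on $\mathbb R^d$ with mean zero and covariance $k$, differentiable at the points of $D$, with $k(x,x)\le1$ on $D$; for constants $a,b>0$, $\Pr\{\sup_{x\in D}|\partial U/\partial x_j|>M\}\le a\,e^{-(M/b)^2}$ for all $M>0$ and $j=1,\dots,d$. The kernel is non-degenerate: its integral operator on $L^2(D)$ is injective, so that its eigenfunctions are complete in $L^2(D)$. * Feedback is $y_n=U(x_n)+\varepsilon_n$, where the $\varepsilon_n\sim N(0,\sigma^2)$, $\sigma>0$, are i.i.d. and independent of $U$. For $n\ge 0$ put $k_n(x)=[k(x_1,x),\dots,k(x_n,x)]^{\mathsf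 T}$, $K_n=[k(x_i,x_j)]_{i,j\le n}$, $\mu_n(x)=k_n(x)^{\mathsf T}(K_n+\sigma^2I)^{-1}[y_1,\dots,y_n]^{\mathsf T}$ and $\sigma_n^2(x)=k(x,x)-k_n(x)^{\mathsf T}(K_n+\sigma^2I)^{-1}k_n(x)$ (so $\mu_0=0$, $\sigma_0^2(x)=k(x,x)$). Fix $\delta\in(0,1)$ with $\delta<2da$ and set $$\beta_n=2\log\frac{2n^2\pi^2}{3\delta}+2d\log\Big(d\,n^2\,b\,r\sqrt{\log(4da/\delta)}\Big),\qquad \varphi_n(x)=V(x;t_n)+\hat U_n(x),\quad \hat U_n=\mu_{n-1}+\sqrt{\beta_n}\,\sigma_{n-1}.$$ **Algorithm.** From $x_0\in D$, one projected gradient step is performed at every time, and feedback is received at every time: for $n\ge1$, $$x_n=\Pi_D\big[x_{n-1}+\alpha\big(\nabla V(x_{n-1};t_n)+\nabla\hat U_n(x_{n-1})\big)\big],$$ where $\Pi_D$ is the Euclidean projection onto $D$. **Proximal PL condition.** Let $\Theta,\kappa>0$, $0<\alpha\le1/\Theta$, $\alpha\kappa\le1$, and $\varphi_n^*=\max_D\varphi_n$.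 Say that $\mathrm{PL}_n$ holds if $-\varphi_n$ is differentiable at the points of $D$ with $\Theta$-Lipschitz gradient over $D$ and, for all $x\in D$, $$\tfrac12\mathcal D_n(x,1/\alpha)\ge\kappa(\varphi_n^*-\varphi_n(x)),\qquad \mathcal D_n(x,c):=-2c\min_{y\in D}\Big\{-\nabla\varphi_n(x)^{\mathsf T}(y-x)+\tfrac c2\|y-x\|^2\Big\}.$$ Put $\eta=1-\alpha\kappa\in[0,1)$, $R_T=\sum_{n=1}^T\big(\max_{x\in D}f(x;t_n)-f(x_n;t_n)\big)$, and let $\gamma_T$ be the supremum of $\frac12\log\det(I+\sigma^{-2}K_A)$ over all choices $A$ of $T$ points of $D$ (with kernel matrix $K_A$). Let $$C_1=\frac{8}{\log(1+\sigma^{-2})},\quad C_2=\frac{2D_g}{b\sqrt{\log(2da/\delta)}}+\frac{2L}{2db^2\log(2da/\delta)}+2,\quad G_T=2\sum_{n=1}^T\sum_{z=1}^{n-1}\eta^z\Delta_{n-z+1}.$$ **Claim.** 1. Whenever $\mathrm{PL}_n$ holds, $\varphi_n^*-\varphi_n(x_n)\le(1-\alpha\kappa)(\varphi_n^*-\varphi_n(x_{n-1}))$.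 2. There are $C,p$ not depending on $T$ such that for every $T\ge1$, with probability at least $1-\delta$: if $\mathrm{PL}_n$ holds for $n=1,\dots,T$, then $R_T\le C(1+\log T)^p\sqrt{dT\gamma_T}+CT$. 3. There are $C,p$ not depending on $T$ such that for every $T\ge1$, with probability at least $1-\delta$: if $\mathrm{PL}_n$ holds for $n=1,\dots,T$, then $$R_T\le\sqrt{C_1T\beta_T\gamma_T}+C_2+C(1+\log T)^p+G_T .$$ 4. For every $T\ge1$, $G_T\le 2\Delta\eta T/(1-\eta)$. -/

import Mathlib

open MeasureTheory ProbabilityTheory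

noncomputable section

namespace AGPUCB

/-- Decision vectors: `ℝ^d` with the Euclidean norm. -/
abbrev Vec (d : ℕ) : Type := EuclideanSpace ℝ (Fin d)

/-! ### Gaussian-process regression -/

/-- Kernel matrix `[k(x_i, x_j)]` of a list of `m` points. -/
def gram {d m : ℕ} (k : Vec d → Vec d → ℝ) (xs : Fin m → Vec d) : Matrix (Fin m) (Fin m) ℝ :=
  Matrix.of fun i j => k (xs i) (xs j)

/-- The vector `[k(x_1, x), …, k(x_m, x)]`. -/
def kvec {d m : ℕ} (k : Vec d → Vec d → ℝ) (xs : Fin m → Vec d) (x : Vec d) : Fin m → ℝ :=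
  fun i => k (xs i) x

/-- Posterior mean `k_m(x)ᵀ (K_m + σ² I)⁻¹ y`. For `m = 0` it is `0`. -/
def postMean {d m : ℕ} (k : Vec d → Vec d → ℝ) (σ : ℝ) (xs : Fin m → Vec d) (ys : Fin m → ℝ)
    (x : Vec d) : ℝ :=
  kvec k xs x ⬝ᵥ Matrix.mulVec (gram k xs + σ ^ 2 • (1 : Matrix (Fin m) (Fin m) ℝ))⁻¹ ys

/-- Posterior covariance `k(x,x') - k_m(x)ᵀ (K_m + σ² I)⁻¹ k_m(x')`. -/
def postCov {d m : ℕ} (k : Vec d → Vec d → ℝ) (σ : ℝ) (xs : Fin m → Vec d) (x x' : Vec d) : ℝ :=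
  k x x' - kvec k xs x ⬝ᵥ
    Matrix.mulVec (gram k xs + σ ^ 2 • (1 : Matrix (Fin m) (Fin m) ℝ))⁻¹ (kvec k xs x')

/-- Posterior standard deviation. -/
def postStd {d m : ℕ} (k : Vec d → Vec d → ℝ) (σ : ℝ) (xs : Fin m → Vec d) (x : Vec d) : ℝ :=
  Real.sqrt (postCov k σ xs x x)

/-- Maximum information gain after `T` noisy evaluations in `D` (supremum over all choices of
`T` evaluation points of `D`). -/
def infoGain {d : ℕ} (k : Vec d → Vec d → ℝ) (σ : ℝ) (D : Set (Vec d)) (T : ℕ) : ℝ :=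
  sSup {s : ℝ | ∃ xs : Fin T → Vec d, (∀ i, xs i ∈ D) ∧
    s = 1 / 2 * Real.log (1 + (σ ^ 2)⁻¹ • gram k xs).det}

/-- The kernel is non-degenerate on `D`: its integral operator on `L²(D)` (Lebesgue measure) has
trivial null space, that is, its eigenfunctions with non-zero eigenvalue are complete in `L²(D)`,
so that every function in `L²(D)` has a generalized Fourier series in them. -/
def NonDegenerate {d : ℕ} (k : Vec d → Vec d → ℝ) (D : Set (Vec d)) : Prop :=
  ∀ g : Vec d → ℝ, MemLp g 2 (volume.restrict D) →
    (∀ᵐ x ∂(volume.restrict D), ∫ y in D, k x y * g y = 0) → g =ᵐ[volume.restrict D] 0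

/-- `U` is a centred Gaussian process with covariance function `k`. -/
structure IsCentredGP {d : ℕ} {Ω : Type*} [MeasurableSpace Ω] (P : Measure Ω)
    (U : Vec d → Ω → ℝ) (k : Vec d → Vec d → ℝ) : Prop where
  measurable : ∀ x, Measurable (U x)
  gaussian : IsGaussianProcess U P
  mean : ∀ x, ∫ ω, U x ω ∂P = 0
  cov : ∀ x x', covariance (U x) (U x') P = k x x'

/-- `ε` is a sequence of i.i.d. `N(0, σ²)` variables, independent of the process `U`. -/
structure IsNoise {d : ℕ} {Ω : Type*} [MeasurableSpace Ω] (P : Measure Ω)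
    (U : Vec d → Ω → ℝ) (ε : ℕ → Ω → ℝ) (σ : ℝ) : Prop where
  measurable : ∀ i, Measurable (ε i)
  law : ∀ i, P.map (ε i) = gaussianReal 0 (Real.toNNReal (σ ^ 2))
  indep : iIndepFun ε P
  indep_process : IndepFun (fun ω => fun x => U x ω) (fun ω => fun i => ε i ω) P

/-! ### The algorithm -/

/-- The confidence parameter `β_n`. -/
def beta (d : ℕ) (a b r δ : ℝ) (n : ℕ) : ℝ :=
  2 * Real.log (2 * (n : ℝ) ^ 2 * Real.pi ^ 2 / (3 * δ)) +
    2 * d * Real.log (d * (n : ℝ) ^ 2 * b * r * Real.sqrt (Real.log (4 * d * a / δ)))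

/-- The upper confidence bound `μ_{n-1} + √β_n σ_{n-1}` computed from the decisions
`x 1, …, x (n-1)` and the feedback `y 1, …, y (n-1)`. -/
def ucb {d : ℕ} (k : Vec d → Vec d → ℝ) (σ : ℝ) (β : ℕ → ℝ) (x : ℕ → Vec d) (y : ℕ → ℝ) (n : ℕ)
    (z : Vec d) : ℝ :=
  postMean k σ (fun i : Fin (n - 1) => x (i + 1)) (fun i : Fin (n - 1) => y (i + 1)) z +
    Real.sqrt (β n) * postStd k σ (fun i : Fin (n - 1) => x (i + 1)) z

/-- The surrogate objective `φ_n = V(·; t_n) + μ_{n-1} + √β_n σ_{n-1}`. -/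
def surrogate {d : ℕ} (V : Vec d → ℝ → ℝ) (t : ℕ → ℝ) (k : Vec d → Vec d → ℝ) (σ : ℝ) (β : ℕ → ℝ)
    (x : ℕ → Vec d) (y : ℕ → ℝ) (n : ℕ) (z : Vec d) : ℝ :=
  V z (t n) + ucb k σ β x y n z

/-- `p` is the Euclidean projection of `y` onto `D`. -/
def IsProjection {d : ℕ} (D : Set (Vec d)) (y p : Vec d) : Prop :=
  p ∈ D ∧ ∀ z ∈ D, ‖y - p‖ ≤ ‖y - z‖

/-- The sequence `x` of decisions is produced from `x 0 = x₀` and the feedback `y` by one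
projected gradient step of stepsize `α` on `φ_n` at every time `n ≥ 1`. -/
def IsRun {d : ℕ} (D : Set (Vec d)) (V : Vec d → ℝ → ℝ) (t : ℕ → ℝ) (k : Vec d → Vec d → ℝ)
    (σ : ℝ) (β : ℕ → ℝ) (α : ℝ) (x₀ : Vec d) (x : ℕ → Vec d) (y : ℕ → ℝ) : Prop :=
  x 0 = x₀ ∧ ∀ n, 1 ≤ n → IsProjection D
    (x (n - 1) + α • (gradient (fun z => V z (t n)) (x (n - 1)) +
      gradient (ucb k σ β x y n) (x (n - 1)))) (x n)

/-- The noisy feedback `y_i = U(x_i) + ε_i`. -/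
def feedback {d : ℕ} {Ω : Type*} (U : Vec d → Ω → ℝ) (ε : ℕ → Ω → ℝ) (X : ℕ → Ω → Vec d)
    (i : ℕ) (ω : Ω) : ℝ :=
  U (X i ω) ω + ε i ω

/-- The information available when `x_n` is computed: the σ-algebra generated by
`y_1, …, y_{n-1}`. -/
abbrev pastFeedback {d : ℕ} {Ω : Type*} (U : Vec d → Ω → ℝ) (ε : ℕ → Ω → ℝ) (X : ℕ → Ω → Vec d)
    (n : ℕ) : MeasurableSpace Ω :=
  ⨆ i ∈ Finset.Icc 1 (n - 1), MeasurableSpace.comap (feedback U ε X i) inferInstance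

/-! ### Smoothness and the proximal Polyak-Lojasiewicz condition -/

/-- `g` is differentiable at the points of `D`, with `Θ`-Lipschitz gradient over `D`. -/
def SmoothOn {d : ℕ} (D : Set (Vec d)) (g : Vec d → ℝ) (Θ : ℝ) : Prop :=
  (∀ x ∈ D, DifferentiableAt ℝ g x) ∧
    ∀ x ∈ D, ∀ y ∈ D, ‖gradient g x - gradient g y‖ ≤ Θ * ‖x - y‖

/-- Maximum over `D`. -/
def maxOver {d : ℕ} (D : Set (Vec d)) (g : Vec d → ℝ) : ℝ := sSup (g '' D)

/-- `𝒟(x, c) = -2c min_{y ∈ D} { -∇φ(x)ᵀ(y - x) + (c/2) ‖y - x‖² }`. -/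
def proxGap {d : ℕ} (D : Set (Vec d)) (φ : Vec d → ℝ) (x : Vec d) (c : ℝ) : ℝ :=
  -2 * c * sInf ((fun y : Vec d =>
    inner ℝ (-gradient φ x) (y - x) + c / 2 * ‖y - x‖ ^ 2) '' D)

/-- `-φ` has `Θ`-Lipschitz gradient over `D` and satisfies the proximal PL inequality with
constants `κ` and `c`. -/
def ProxPL {d : ℕ} (D : Set (Vec d)) (φ : Vec d → ℝ) (Θ κ c : ℝ) : Prop :=
  SmoothOn D (fun x => -φ x) Θ ∧
    ∀ x ∈ D, κ * (maxOver D φ - φ x) ≤ 1 / 2 * proxGap D φ x c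

/-! ### Regret and the terms of its bound -/

/-- The drift `Δ_n = max_{x ∈ D} |V(x; t_n) - V(x; t_{n-1})|`. -/
def drift {d : ℕ} (D : Set (Vec d)) (V : Vec d → ℝ → ℝ) (t : ℕ → ℝ) (n : ℕ) : ℝ :=
  maxOver D fun x => |V x (t n) - V x (t (n - 1))|

/-- Cumulative regret `R_T = ∑_{n=1}^T (f_n^* - f(x_n; t_n))`, `f(·; t) = V(·; t) + u`. -/
def regret {d : ℕ} (D : Set (Vec d)) (V : Vec d → ℝ → ℝ) (t : ℕ → ℝ) (u : Vec d → ℝ)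
    (x : ℕ → Vec d) (T : ℕ) : ℝ :=
  ∑ n ∈ Finset.Icc 1 T, (maxOver D (fun z => V z (t n) + u z) - (V (x n) (t n) + u (x n)))

/-- `G_T = 2 ∑_{n=1}^T ∑_{z=1}^{n-1} η^z Δ_{n-z+1}`. -/
def driftTerm (η : ℝ) (Δ : ℕ → ℝ) (T : ℕ) : ℝ :=
  2 * ∑ n ∈ Finset.Icc 1 T, ∑ z ∈ Finset.Icc 1 (n - 1), η ^ z * Δ (n - z + 1)

/-- `C₁ = 8 / log(1 + σ⁻²)`. -/
def C₁ (σ : ℝ) : ℝ := 8 / Real.log (1 + (σ ^ 2)⁻¹)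

/-- `C₂ = 2 D_g / (b √log(2da/δ)) + 2L / (2 d b² log(2da/δ)) + 2`. -/
def C₂ (d : ℕ) (a b δ L Dg : ℝ) : ℝ :=
  2 * Dg / (b * Real.sqrt (Real.log (2 * d * a / δ))) +
    2 * L / (2 * d * b ^ 2 * Real.log (2 * d * a / δ)) + 2

end AGPUCB

end

/-!
The bound rests on an event of probability at least `1 - δ` on which everything else is
deterministic.

On that event `U` is Lipschitz on `D` (the tail bounds on its partial derivatives), the noise
`ε_n` is `O(√log n)`, and from some fixed time `N` on the posterior confidence intervals
`|U - μ_{n-1}| ≤ √β_n (σ_{n-1} + 1/n)` hold at the decision `x_n` and on a net of `D` of mesh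
`√d / n` (`exists_isGoodRun`). Since the terms in `C` are free, the steps before `N` cost only a
constant; hence `β_n` has only to be summable against nets of size `O(n^d)`, and its numerical
constants do not matter. The difficulty is that the decisions depend on the feedback, so that the
posterior formulas are not conditional laws of `U` at fixed points. Integrating out the noise one
observation at a time turns an expectation over the adaptive feedback into one over independent
`U` and feedback, weighted by the likelihood (`IsAdaptiveFeedback.exists_lintegral_eq`). At fixed
points and feedback the Cameron–Martin formula then evaluates the exponential moment of
`U - μ_{n-1}` under this weight (`lintegral_exp_posterior`), and Chernoff's bound gives the
confidence intervals (`IsAdaptiveFeedback.measure_error_le`).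

On the event, optimism bounds the regret at time `n` by
`(φ_n^* - φ_n(x_n)) + 2 √β_n σ_{n-1}(x_n) + O(log n / n)` (`IsGoodRun.regret_step_le`). The
projected gradient step contracts `φ_n^* - φ_n` by `η = 1 - α κ` (`ProxPL.maxOver_sub_le`: it
minimises the quadratic in the proximal gap, and `φ_n` lies above that quadratic model by the
descent lemma). Summing this contraction, the changes of `φ_n^*` telescope, so the posterior enters
only through its values at the ends, which are `O(log T)` (`IsGoodRun.abs_ucb_le`), through
the drift of `V`, which gives `G_T` (`sum_drift_le_driftTerm`), and through the changes of the upper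
confidence bound at the decisions, which are `O(√β_n σ_{n-1}(x_n)²)`, because an observation at
`x_n` moves the posterior there in proportion to its variance (`IsGoodRun.ucb_sub_succ_le`).

This quadratic term is absorbed without loss in the leading constant. By Cauchy–Schwarz it
suffices to compare `2 s + K s²` with `2 √(log (1 + s² / σ²) / log (1 + σ⁻²))`; as `s → 0` the
latter is `2 s / (σ √log (1 + σ⁻²))`, whose slope exceeds `2` strictly (`exists_slack`). And
`σ_{n-1}(x_n)` exceeds a given level boundedly often, since observations in a small cell predict
each other (`exists_card_runStd_gt_le`).

The bound of order `√(d T γ_T)` up to `O(T)` follows on the same event from the Lipschitz bounds on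
`V` and `U` alone, whose oscillation over `D` is already a bound for each term of the regret.
-/

noncomputable section

namespace AGPUCB

/-! ### The posterior as a regularized linear system -/

section

open Matrix

/-- All kernel matrices of `k` are positive semidefinite. -/
def IsPosSemidefKernel {d : ℕ} (k : Vec d → Vec d → ℝ) : Prop :=
  ∀ (m : ℕ) (xs : Fin m → Vec d), (gram k xs).PosSemidef

/-- The regularized kernel matrix `K + σ² I`. -/
abbrev regGram {d m : ℕ} (k : Vec d → Vec d → ℝ) (σ : ℝ) (xs : Fin m → Vec d) :
    Matrix (Fin m) (Fin m) ℝ :=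
  gram k xs + σ ^ 2 • (1 : Matrix (Fin m) (Fin m) ℝ)

theorem IsPosSemidefKernel.symm {d : ℕ} {k : Vec d → Vec d → ℝ} (hk : IsPosSemidefKernel k)
    (x y : Vec d) : k x y = k y x := by
  have h := (hk 2 ![x, y]).isHermitian.apply 1 0
  simpa [gram] using h

theorem IsPosSemidefKernel.quad_nonneg {d m : ℕ} {k : Vec d → Vec d → ℝ}
    (hk : IsPosSemidefKernel k) (xs : Fin m → Vec d) (w : Fin m → ℝ) :
    0 ≤ w ⬝ᵥ gram k xs *ᵥ w := by
  simpa using (hk m xs).dotProduct_mulVec_nonneg w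

theorem regGram_quad {d m : ℕ} (k : Vec d → Vec d → ℝ) (σ : ℝ) (xs : Fin m → Vec d)
    (w : Fin m → ℝ) :
    w ⬝ᵥ regGram k σ xs *ᵥ w = w ⬝ᵥ gram k xs *ᵥ w + σ ^ 2 * (w ⬝ᵥ w) := by
  rw [add_mulVec, dotProduct_add, smul_mulVec, one_mulVec, dotProduct_smul, smul_eq_mul]

theorem regGram_posDef {d m : ℕ} {k : Vec d → Vec d → ℝ} (hk : IsPosSemidefKernel k)
    {σ : ℝ} (hσ : 0 < σ) (xs : Fin m → Vec d) : (regGram k σ xs).PosDef :=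
  PosDef.posSemidef_add (hk m xs) (PosDef.one.smul (by positivity))

theorem regGram_isUnit_det {d m : ℕ} {k : Vec d → Vec d → ℝ} (hk : IsPosSemidefKernel k)
    {σ : ℝ} (hσ : 0 < σ) (xs : Fin m → Vec d) : IsUnit (regGram k σ xs).det :=
  (regGram_posDef hk hσ xs).det_pos.ne'.isUnit

theorem regGram_mulVec_inv {d m : ℕ} {k : Vec d → Vec d → ℝ} (hk : IsPosSemidefKernel k)
    {σ : ℝ} (hσ : 0 < σ) (xs : Fin m → Vec d) (v : Fin m → ℝ) :
    regGram k σ xs *ᵥ ((regGram k σ xs)⁻¹ *ᵥ v) = v := by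
  rw [mulVec_mulVec, mul_nonsing_inv _ (regGram_isUnit_det hk hσ xs), one_mulVec]

theorem regGram_inv_mulVec {d m : ℕ} {k : Vec d → Vec d → ℝ} (hk : IsPosSemidefKernel k)
    {σ : ℝ} (hσ : 0 < σ) (xs : Fin m → Vec d) (v : Fin m → ℝ) :
    (regGram k σ xs)⁻¹ *ᵥ (regGram k σ xs *ᵥ v) = v := by
  rw [mulVec_mulVec, nonsing_inv_mul _ (regGram_isUnit_det hk hσ xs), one_mulVec]

theorem regGram_dotProduct_comm {d m : ℕ} {k : Vec d → Vec d → ℝ} (hk : IsPosSemidefKernel k)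
    {σ : ℝ} (hσ : 0 < σ) (xs : Fin m → Vec d) (u v : Fin m → ℝ) :
    u ⬝ᵥ regGram k σ xs *ᵥ v = v ⬝ᵥ regGram k σ xs *ᵥ u := by
  have h := (regGram_posDef hk hσ xs).isHermitian
  rw [dotProduct_mulVec, dotProduct_comm, ← mulVec_transpose]
  congr 2

theorem regGram_inv_dotProduct_comm {d m : ℕ} {k : Vec d → Vec d → ℝ}
    (hk : IsPosSemidefKernel k) {σ : ℝ} (hσ : 0 < σ) (xs : Fin m → Vec d) (u v : Fin m → ℝ) :
    u ⬝ᵥ (regGram k σ xs)⁻¹ *ᵥ v = v ⬝ᵥ (regGram k σ xs)⁻¹ *ᵥ u := by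
  set A := regGram k σ xs
  calc u ⬝ᵥ A⁻¹ *ᵥ v = (A *ᵥ (A⁻¹ *ᵥ u)) ⬝ᵥ A⁻¹ *ᵥ v := by
        rw [regGram_mulVec_inv hk hσ]
    _ = (A⁻¹ *ᵥ u) ⬝ᵥ (A *ᵥ (A⁻¹ *ᵥ v)) := by
        rw [dotProduct_comm, regGram_dotProduct_comm hk hσ]
    _ = v ⬝ᵥ A⁻¹ *ᵥ u := by rw [regGram_mulVec_inv hk hσ, dotProduct_comm]

/-- Since `K + σ² I ≥ σ² I`, its inverse is bounded by `σ⁻²`. -/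
theorem abs_dotProduct_regGram_inv_le {d m : ℕ} {k : Vec d → Vec d → ℝ}
    (hk : IsPosSemidefKernel k) {σ : ℝ} (hσ : 0 < σ) (xs : Fin m → Vec d) {u v : Fin m → ℝ}
    {p q : ℝ} (hp : 0 ≤ p) (hq : 0 ≤ q) (hu : ∀ i, |u i| ≤ p) (hv : ∀ i, |v i| ≤ q) :
    |u ⬝ᵥ (regGram k σ xs)⁻¹ *ᵥ v| ≤ m * p * q / σ ^ 2 := by
  set w := (regGram k σ xs)⁻¹ *ᵥ v with hw
  have cs : ∀ f g : Fin m → ℝ, (f ⬝ᵥ g) ^ 2 ≤ (f ⬝ᵥ f) * (g ⬝ᵥ g) := fun f g => by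
    simpa [dotProduct, sq] using Finset.sum_mul_sq_le_sq_mul_sq Finset.univ f g
  have nn : ∀ f : Fin m → ℝ, 0 ≤ f ⬝ᵥ f := fun f => by
    simpa [dotProduct] using Finset.sum_nonneg fun i _ => mul_self_nonneg (f i)
  have bd : ∀ (f : Fin m → ℝ) (c : ℝ), 0 ≤ c → (∀ i, |f i| ≤ c) → f ⬝ᵥ f ≤ m * c ^ 2 := by
    intro f c _ hf
    calc f ⬝ᵥ f ≤ ∑ _i : Fin m, c ^ 2 := Finset.sum_le_sum fun i _ => by
          rw [← sq, ← sq_abs]; exact pow_le_pow_left₀ (abs_nonneg _) (hf i) 2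
      _ = m * c ^ 2 := by simp
  have h1 : σ ^ 2 * (w ⬝ᵥ w) ≤ w ⬝ᵥ v := by
    have := regGram_quad k σ xs w
    rw [hw, regGram_mulVec_inv hk hσ, ← hw] at this
    linarith [hk.quad_nonneg xs w]
  have h2 : σ ^ 4 * (w ⬝ᵥ w) ≤ v ⬝ᵥ v := by
    by_cases h0 : w ⬝ᵥ w = 0
    · rw [h0]; simpa using nn v
    · have hpos : 0 < w ⬝ᵥ w := lt_of_le_of_ne (nn w) (Ne.symm h0)
      have h3 := cs w v
      have h4 : (σ ^ 2 * (w ⬝ᵥ w)) ^ 2 ≤ (w ⬝ᵥ v) ^ 2 :=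
        pow_le_pow_left₀ (by positivity) h1 2
      have : (w ⬝ᵥ w) * (σ ^ 4 * (w ⬝ᵥ w)) ≤ (w ⬝ᵥ w) * (v ⬝ᵥ v) := by nlinarith
      exact le_of_mul_le_mul_left this hpos
  have h5 : (u ⬝ᵥ w) ^ 2 ≤ (m * p * q / σ ^ 2) ^ 2 := by
    have h6 : w ⬝ᵥ w ≤ m * q ^ 2 / σ ^ 4 := by
      rw [le_div_iff₀ (by positivity)]
      linarith [bd v q hq hv]
    calc (u ⬝ᵥ w) ^ 2 ≤ (u ⬝ᵥ u) * (w ⬝ᵥ w) := cs u w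
      _ ≤ (m * p ^ 2) * (m * q ^ 2 / σ ^ 4) :=
          mul_le_mul (bd u p hp hu) h6 (nn w) (by positivity)
      _ = _ := by field_simp
  exact abs_le_of_sq_le_sq h5 (by positivity)

/-- The quadratic error of a linear predictor exceeds the posterior variance by a square. -/
theorem predictor_error_eq {d m : ℕ} {k : Vec d → Vec d → ℝ} (hk : IsPosSemidefKernel k)
    {σ : ℝ} (hσ : 0 < σ) (xs : Fin m → Vec d) (x : Vec d) (w : Fin m → ℝ) :
    k x x - 2 * (w ⬝ᵥ kvec k xs x) + w ⬝ᵥ regGram k σ xs *ᵥ w =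
      postCov k σ xs x x +
        (w - (regGram k σ xs)⁻¹ *ᵥ kvec k xs x) ⬝ᵥ regGram k σ xs *ᵥ
          (w - (regGram k σ xs)⁻¹ *ᵥ kvec k xs x) := by
  set κ := kvec k xs x
  have e : postCov k σ xs x x = k x x - κ ⬝ᵥ (regGram k σ xs)⁻¹ *ᵥ κ := rfl
  rw [mulVec_sub, regGram_mulVec_inv hk hσ, sub_dotProduct, dotProduct_sub, dotProduct_sub,
    regGram_dotProduct_comm hk hσ xs ((regGram k σ xs)⁻¹ *ᵥ κ) w, regGram_mulVec_inv hk hσ, e,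
    dotProduct_comm w κ, dotProduct_comm ((regGram k σ xs)⁻¹ *ᵥ κ) κ]
  ring

theorem postCov_le_predictor_error {d m : ℕ} {k : Vec d → Vec d → ℝ}
    (hk : IsPosSemidefKernel k) {σ : ℝ} (hσ : 0 < σ) (xs : Fin m → Vec d) (x : Vec d)
    (w : Fin m → ℝ) :
    postCov k σ xs x x ≤
      k x x - 2 * (w ⬝ᵥ kvec k xs x) + w ⬝ᵥ gram k xs *ᵥ w + σ ^ 2 * (w ⬝ᵥ w) := by
  have h1 := predictor_error_eq hk hσ xs x w
  rw [regGram_quad] at h1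
  have := (regGram_posDef hk hσ xs).posSemidef.dotProduct_mulVec_nonneg
    (w - (regGram k σ xs)⁻¹ *ᵥ kvec k xs x)
  simp only [star_trivial] at this
  linarith

theorem postCov_le {d m : ℕ} {k : Vec d → Vec d → ℝ} (hk : IsPosSemidefKernel k)
    {σ : ℝ} (hσ : 0 < σ) (xs : Fin m → Vec d) (x : Vec d) :
    postCov k σ xs x x ≤ k x x := by
  simpa using postCov_le_predictor_error hk hσ xs x 0

/-- The posterior variance is the quadratic form of the kernel matrix of `xs` and `x` at the error of
the optimal predictor, plus the noise that the predictor collects. -/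
theorem postCov_nonneg {d m : ℕ} {k : Vec d → Vec d → ℝ} (hk : IsPosSemidefKernel k)
    {σ : ℝ} (hσ : 0 < σ) (xs : Fin m → Vec d) (x : Vec d) :
    0 ≤ postCov k σ xs x x := by
  set w := (regGram k σ xs)⁻¹ *ᵥ kvec k xs x with hw
  have h1 := predictor_error_eq hk hσ xs x w
  rw [← hw, sub_self, zero_dotProduct, add_zero, regGram_quad] at h1
  have h2 := hk.quad_nonneg (Fin.snoc xs x : Fin (m + 1) → Vec d)
    (Fin.snoc (-w) 1 : Fin (m + 1) → ℝ)
  have h3 : (Fin.snoc (-w) 1 : Fin (m + 1) → ℝ) ⬝ᵥ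
      gram k (Fin.snoc xs x : Fin (m + 1) → Vec d) *ᵥ (Fin.snoc (-w) 1 : Fin (m + 1) → ℝ) =
      k x x - 2 * (w ⬝ᵥ kvec k xs x) + w ⬝ᵥ gram k xs *ᵥ w := by
    simp only [dotProduct, mulVec, Fin.sum_univ_castSucc, gram, kvec, of_apply, Fin.snoc_castSucc,
      Fin.snoc_last, Pi.neg_apply, hk.symm x (xs _)]
    simp only [mul_neg, mul_one, neg_mul, one_mul, Finset.sum_neg_distrib, mul_add,
      Finset.sum_add_distrib, neg_neg]
    have : ∑ i, k (xs i) x * w i = ∑ i, w i * k (xs i) x :=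
      Finset.sum_congr rfl fun i _ => mul_comm _ _
    rw [this]
    ring
  have h4 : 0 ≤ w ⬝ᵥ w := by
    simpa [dotProduct] using Finset.sum_nonneg fun i _ => mul_self_nonneg (w i)
  have : 0 ≤ σ ^ 2 * (w ⬝ᵥ w) := by positivity
  linarith

/-- Block inversion of the regularized kernel matrix: the effect of one further point on the
bilinear form of its inverse. -/
theorem dotProduct_regGram_inv_succ {d m : ℕ} {k : Vec d → Vec d → ℝ}
    (hk : IsPosSemidefKernel k) {σ : ℝ} (hσ : 0 < σ) (xs : Fin (m + 1) → Vec d)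
    (u v : Fin (m + 1) → ℝ) :
    u ⬝ᵥ (regGram k σ xs)⁻¹ *ᵥ v =
      (fun i : Fin m => u i.castSucc) ⬝ᵥ
          (regGram k σ fun i : Fin m => xs i.castSucc)⁻¹ *ᵥ (fun i : Fin m => v i.castSucc) +
        (u (Fin.last m) - (fun i : Fin m => u i.castSucc) ⬝ᵥ
          (regGram k σ fun i : Fin m => xs i.castSucc)⁻¹ *ᵥ
            kvec k (fun i : Fin m => xs i.castSucc) (xs (Fin.last m))) *
        (v (Fin.last m) - kvec k (fun i : Fin m => xs i.castSucc) (xs (Fin.last m)) ⬝ᵥ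
          (regGram k σ fun i : Fin m => xs i.castSucc)⁻¹ *ᵥ (fun i : Fin m => v i.castSucc)) /
        (σ ^ 2 + postCov k σ (fun i : Fin m => xs i.castSucc) (xs (Fin.last m))
          (xs (Fin.last m))) := by
  set xs' := fun i : Fin m => xs i.castSucc with hxs'
  set l := xs (Fin.last m) with hl
  set κ := kvec k xs' l with hκ
  set u' := fun i : Fin m => u i.castSucc with hu'
  set v' := fun i : Fin m => v i.castSucc with hv'
  have hs : 0 < σ ^ 2 + postCov k σ xs' l l := by
    have := postCov_nonneg hk hσ xs' l
    positivity
  have hpc : postCov k σ xs' l l = k l l - κ ⬝ᵥ (regGram k σ xs')⁻¹ *ᵥ κ := rfl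
  set s := σ ^ 2 + postCov k σ xs' l l with hsdef
  set c := (v (Fin.last m) - κ ⬝ᵥ (regGram k σ xs')⁻¹ *ᵥ v') / s with hc
  set w' := (regGram k σ xs')⁻¹ *ᵥ v' - c • ((regGram k σ xs')⁻¹ *ᵥ κ) with hw'
  have hAw : regGram k σ xs *ᵥ (Fin.snoc w' c : Fin (m + 1) → ℝ) = v := by
    have e1 : regGram k σ xs' *ᵥ w' = v' - c • κ := by
      rw [hw', mulVec_sub, mulVec_smul, regGram_mulVec_inv hk hσ, regGram_mulVec_inv hk hσ]
    have e2 : κ ⬝ᵥ w' = κ ⬝ᵥ (regGram k σ xs')⁻¹ *ᵥ v' -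
        c * (κ ⬝ᵥ (regGram k σ xs')⁻¹ *ᵥ κ) := by
      rw [hw', dotProduct_sub, dotProduct_smul, smul_eq_mul]
    funext i
    refine Fin.lastCases ?_ (fun i => ?_) i
    · have : (regGram k σ xs *ᵥ (Fin.snoc w' c : Fin (m + 1) → ℝ)) (Fin.last m) =
          κ ⬝ᵥ w' + (k l l + σ ^ 2) * c := by
        simp only [mulVec, dotProduct, Fin.sum_univ_castSucc, Fin.snoc_castSucc, Fin.snoc_last,
          regGram, Matrix.add_apply, gram, of_apply, Matrix.smul_apply, smul_eq_mul,
          Matrix.one_apply_eq, hκ, kvec, mul_one]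
        congr 1
        refine Finset.sum_congr rfl fun j _ => ?_
        rw [one_apply_ne (Fin.castSucc_lt_last j).ne', mul_zero, add_zero, hk.symm]
      rw [this, e2]
      have : c * s = v (Fin.last m) - κ ⬝ᵥ (regGram k σ xs')⁻¹ *ᵥ v' := by
        rw [hc]; field_simp
      rw [hsdef, hpc] at this
      linarith
    · have : (regGram k σ xs *ᵥ (Fin.snoc w' c : Fin (m + 1) → ℝ)) i.castSucc =
          (regGram k σ xs' *ᵥ w') i + κ i * c := by
        simp only [mulVec, dotProduct, Fin.sum_univ_castSucc, Fin.snoc_castSucc, Fin.snoc_last,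
          regGram, Matrix.add_apply, gram, of_apply, Matrix.smul_apply, smul_eq_mul, hκ, kvec]
        congr 1
        · refine Finset.sum_congr rfl fun j _ => ?_
          simp [one_apply, hxs', Fin.ext_iff]
        · rw [one_apply_ne (Fin.castSucc_lt_last i).ne, mul_zero, add_zero]
      rw [this, e1]
      simp [hv']
      ring
  have hinv : (regGram k σ xs)⁻¹ *ᵥ v = (Fin.snoc w' c : Fin (m + 1) → ℝ) := by
    rw [← hAw, regGram_inv_mulVec hk hσ]
  have hd : u ⬝ᵥ (Fin.snoc w' c : Fin (m + 1) → ℝ) = u' ⬝ᵥ w' + u (Fin.last m) * c := by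
    simp [dotProduct, Fin.sum_univ_castSucc, hu']
  rw [hinv, hd, hw', dotProduct_sub, dotProduct_smul, smul_eq_mul, mul_div_assoc]
  ring

/-- Update of the posterior mean by one further observation. -/
theorem postMean_succ {d m : ℕ} {k : Vec d → Vec d → ℝ} (hk : IsPosSemidefKernel k)
    {σ : ℝ} (hσ : 0 < σ) (xs : Fin (m + 1) → Vec d) (ys : Fin (m + 1) → ℝ) (x : Vec d) :
    postMean k σ xs ys x =
      postMean k σ (fun i : Fin m => xs i.castSucc) (fun i : Fin m => ys i.castSucc) x +
        postCov k σ (fun i : Fin m => xs i.castSucc) (xs (Fin.last m)) x *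
        (ys (Fin.last m) - postMean k σ (fun i : Fin m => xs i.castSucc)
          (fun i : Fin m => ys i.castSucc) (xs (Fin.last m))) /
        (σ ^ 2 + postCov k σ (fun i : Fin m => xs i.castSucc) (xs (Fin.last m))
          (xs (Fin.last m))) := by
  have h := dotProduct_regGram_inv_succ hk hσ xs (kvec k xs x) ys
  rw [regGram_inv_dotProduct_comm hk hσ _ (fun i : Fin m => kvec k xs x i.castSucc)
    (kvec k (fun i : Fin m => xs i.castSucc) (xs (Fin.last m)))] at h
  exact h

/-- Update of the posterior covariance by one further observation. -/
theorem postCov_succ {d m : ℕ} {k : Vec d → Vec d → ℝ} (hk : IsPosSemidefKernel k)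
    {σ : ℝ} (hσ : 0 < σ) (xs : Fin (m + 1) → Vec d) (x x' : Vec d) :
    postCov k σ xs x x' =
      postCov k σ (fun i : Fin m => xs i.castSucc) x x' -
        postCov k σ (fun i : Fin m => xs i.castSucc) (xs (Fin.last m)) x *
        postCov k σ (fun i : Fin m => xs i.castSucc) (xs (Fin.last m)) x' /
        (σ ^ 2 + postCov k σ (fun i : Fin m => xs i.castSucc) (xs (Fin.last m))
          (xs (Fin.last m))) := by
  have h := dotProduct_regGram_inv_succ hk hσ xs (kvec k xs x) (kvec k xs x')
  rw [regGram_inv_dotProduct_comm hk hσ _ (fun i : Fin m => kvec k xs x i.castSucc)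
    (kvec k (fun i : Fin m => xs i.castSucc) (xs (Fin.last m)))] at h
  rw [postCov, h, ← sub_sub]
  rfl

/-- The Schur complement of the kernel matrix of the earlier points is the noise plus the posterior
variance at the new point. -/
theorem det_regGram_succ {d m : ℕ} {k : Vec d → Vec d → ℝ} (hk : IsPosSemidefKernel k)
    {σ : ℝ} (hσ : 0 < σ) (xs : Fin (m + 1) → Vec d) :
    (regGram k σ xs).det =
      (σ ^ 2 + postCov k σ (fun i : Fin m => xs i.castSucc) (xs (Fin.last m))
          (xs (Fin.last m))) * (regGram k σ fun i : Fin m => xs i.castSucc).det := by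
  set s := σ ^ 2 + postCov k σ (fun i : Fin m => xs i.castSucc) (xs (Fin.last m))
          (xs (Fin.last m)) with hs
  have hs0 : 0 < s := by
    have := postCov_nonneg hk hσ (fun i : Fin m => xs i.castSucc) (xs (Fin.last m))
    positivity
  -- The last diagonal entry of the inverse, by block inversion and by Cramer's rule.
  have h1 := dotProduct_regGram_inv_succ hk hσ xs (Pi.single (Fin.last m) 1)
    (Pi.single (Fin.last m) 1)
  have e0 : (fun i : Fin m => (Pi.single (Fin.last m) 1 : Fin (m + 1) → ℝ) i.castSucc) = 0 := by
    funext i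
    simp [(Fin.castSucc_lt_last i).ne]
  rw [e0] at h1
  simp only [zero_dotProduct, mulVec_zero, dotProduct_zero, Pi.single_eq_same, sub_zero,
    zero_add, mul_one, single_one_dotProduct, mulVec_single_one, col_apply] at h1
  rw [inv_def, Matrix.smul_apply, adjugate_fin_succ_eq_det_submatrix, Ring.inverse_eq_inv',
    smul_eq_mul] at h1
  have e2 : (regGram k σ xs).submatrix (Fin.last m).succAbove (Fin.last m).succAbove =
      regGram k σ fun i : Fin m => xs i.castSucc := by
    ext i j
    simp [regGram, gram, one_apply, Fin.ext_iff]
  rw [e2, ← two_mul, pow_mul] at h1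
  have hd := (regGram_posDef hk hσ xs).det_pos
  field_simp at h1
  norm_num at h1
  rw [← hs] at h1
  rw [h1]
  field_simp

theorem det_one_add_gram_succ {d m : ℕ} {k : Vec d → Vec d → ℝ} (hk : IsPosSemidefKernel k)
    {σ : ℝ} (hσ : 0 < σ) (xs : Fin (m + 1) → Vec d) :
    (1 + (σ ^ 2)⁻¹ • gram k xs).det =
      (1 + postCov k σ (fun i : Fin m => xs i.castSucc) (xs (Fin.last m))
          (xs (Fin.last m)) / σ ^ 2) *
        (1 + (σ ^ 2)⁻¹ • gram k fun i : Fin m => xs i.castSucc).det := by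
  have e : ∀ (n : ℕ) (zs : Fin n → Vec d),
      (1 + (σ ^ 2)⁻¹ • gram k zs).det = ((σ ^ 2)⁻¹) ^ n * (regGram k σ zs).det := by
    intro n zs
    have : (1 + (σ ^ 2)⁻¹ • gram k zs) = (σ ^ 2)⁻¹ • regGram k σ zs := by
      rw [regGram, smul_add, smul_smul, inv_mul_cancel₀ (by positivity), one_smul, add_comm]
    rw [this, det_smul, Fintype.card_fin]
  rw [e, e, det_regGram_succ hk hσ, pow_succ]
  field_simp

/-- The information gain of a sequence of points is the sum of the gains of single points. -/
theorem log_det_one_add_gram {d : ℕ} {k : Vec d → Vec d → ℝ} (hk : IsPosSemidefKernel k)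
    {σ : ℝ} (hσ : 0 < σ) (x : ℕ → Vec d) (T : ℕ) :
    0 < (1 + (σ ^ 2)⁻¹ • gram k fun i : Fin T => x i).det ∧
    Real.log (1 + (σ ^ 2)⁻¹ • gram k fun i : Fin T => x i).det =
      ∑ n ∈ Finset.range T,
        Real.log (1 + postCov k σ (fun i : Fin n => x i) (x n) (x n) / σ ^ 2) := by
  induction T with
  | zero => simp
  | succ T ih =>
    have h := det_one_add_gram_succ hk hσ (fun i : Fin (T + 1) => x i)
    simp only [Fin.val_castSucc, Fin.val_last] at h
    have hp : 0 < 1 + postCov k σ (fun i : Fin T => x i) (x T) (x T) / σ ^ 2 := by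
      have := postCov_nonneg hk hσ (fun i : Fin T => x i) (x T)
      positivity
    rw [h, Finset.sum_range_succ, Real.log_mul hp.ne' ih.1.ne', ih.2]
    exact ⟨mul_pos hp ih.1, add_comm _ _⟩

theorem sum_log_le_infoGain {d : ℕ} {k : Vec d → Vec d → ℝ} (hk : IsPosSemidefKernel k)
    {σ : ℝ} (hσ : 0 < σ) {D : Set (Vec d)} (hk1 : ∀ x ∈ D, k x x ≤ 1)
    (x : ℕ → Vec d) (hx : ∀ n, x n ∈ D) (T : ℕ) :
    ∑ n ∈ Finset.range T,
        Real.log (1 + postCov k σ (fun i : Fin n => x i) (x n) (x n) / σ ^ 2) ≤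
      2 * infoGain k σ D T := by
  have hle : 1 / 2 * Real.log (1 + (σ ^ 2)⁻¹ • gram k fun i : Fin T => x i).det ≤
      infoGain k σ D T := by
    refine le_csSup ⟨1 / 2 * (T * Real.log (1 + 1 / σ ^ 2)), ?_⟩ ⟨_, fun i => hx i, rfl⟩
    rintro s ⟨xs, hxs, rfl⟩
    obtain ⟨z, hz, hzx⟩ : ∃ z : ℕ → Vec d, (∀ n, z n ∈ D) ∧ (fun i : Fin T => z i) = xs := by
      refine ⟨fun n => if h : n < T then xs ⟨n, h⟩ else x 0, fun n => ?_, ?_⟩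
      · dsimp only
        split
        · exact hxs _
        · exact hx 0
      · funext i
        simp
    rw [← hzx, (log_det_one_add_gram hk hσ z T).2]
    gcongr
    calc _ ≤ ∑ _n ∈ Finset.range T, Real.log (1 + 1 / σ ^ 2) := by
          refine Finset.sum_le_sum fun n _ => Real.log_le_log ?_ ?_
          · have := postCov_nonneg hk hσ (fun i : Fin n => z i) (z n)
            positivity
          · gcongr
            exact (postCov_le hk hσ _ _).trans (hk1 _ (hz n))
      _ = _ := by simp
  rw [← (log_det_one_add_gram hk hσ x T).2]
  linarith

/-- Averaging the observations made near `x` predicts well: the posterior variance at `x` is small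
as soon as many points are close to `x`. -/
theorem postCov_le_of_close {d m : ℕ} {k : Vec d → Vec d → ℝ} (hk : IsPosSemidefKernel k)
    {σ : ℝ} (hσ : 0 < σ) (xs : Fin m → Vec d) (x : Vec d) (I : Finset (Fin m))
    (hI : I.Nonempty) {e : ℝ}
    (he : ∀ i ∈ I, k x x - 2 * k (xs i) x + k (xs i) (xs i) ≤ e) :
    postCov k σ xs x x ≤ e + σ ^ 2 / I.card := by
  have hc : (0 : ℝ) < I.card := by exact_mod_cast hI.card_pos
  set w : Fin m → ℝ := fun i => if i ∈ I then (I.card : ℝ)⁻¹ else 0 with hw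
  refine (postCov_le_predictor_error hk hσ xs x w).trans ?_
  have hww : w ⬝ᵥ w = 1 / I.card := by
    simp only [dotProduct, hw, mul_ite, mul_zero, ite_mul, zero_mul, Finset.sum_ite_mem,
      Finset.univ_inter, Finset.sum_const, nsmul_eq_mul]
    simp
    field_simp
  have hwk : w ⬝ᵥ kvec k xs x = (I.card : ℝ)⁻¹ * ∑ i ∈ I, k (xs i) x := by
    simp [dotProduct, hw, kvec, Finset.sum_ite_mem, Finset.mul_sum]
  -- `k a b ≤ (k a a + k b b) / 2` bounds the double sum.
  have hwg : w ⬝ᵥ gram k xs *ᵥ w ≤ (I.card : ℝ)⁻¹ * ∑ i ∈ I, k (xs i) (xs i) := by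
    have hpair : ∀ a b : Vec d, k a b ≤ (k a a + k b b) / 2 := by
      intro a b
      have := hk.quad_nonneg ![a, b] ![1, -1]
      simp [dotProduct, mulVec, gram, Fin.sum_univ_two, hk.symm b a] at this
      linarith
    calc w ⬝ᵥ gram k xs *ᵥ w
        = (I.card : ℝ)⁻¹ * ((I.card : ℝ)⁻¹ * ∑ i ∈ I, ∑ j ∈ I, k (xs i) (xs j)) := by
          simp [dotProduct, mulVec, hw, gram, Finset.sum_ite_mem, Finset.mul_sum]
          exact Finset.sum_congr rfl fun i _ => Finset.sum_congr rfl fun j _ => by ring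
      _ ≤ (I.card : ℝ)⁻¹ * ((I.card : ℝ)⁻¹ * ∑ i ∈ I, ∑ j ∈ I,
            (k (xs i) (xs i) + k (xs j) (xs j)) / 2) := by
          gcongr
          exact hpair _ _
      _ = _ := by
          simp only [← Finset.sum_div, Finset.sum_add_distrib, Finset.sum_const, nsmul_eq_mul,
            ← Finset.mul_sum]
          field_simp
          ring
  have hsum : k x x - 2 * (w ⬝ᵥ kvec k xs x) + (I.card : ℝ)⁻¹ * ∑ i ∈ I, k (xs i) (xs i) ≤ e := by
    have h1 : ∑ i ∈ I, (k x x - 2 * k (xs i) x + k (xs i) (xs i)) ≤ I.card * e := by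
      calc _ ≤ ∑ _i ∈ I, e := Finset.sum_le_sum he
        _ = _ := by simp
    rw [Finset.sum_add_distrib, Finset.sum_sub_distrib, ← Finset.mul_sum, Finset.sum_const,
      nsmul_eq_mul] at h1
    rw [hwk]
    have h2 : (I.card : ℝ) * (k x x - 2 * ((I.card : ℝ)⁻¹ * ∑ i ∈ I, k (xs i) x) +
        (I.card : ℝ)⁻¹ * ∑ i ∈ I, k (xs i) (xs i)) ≤ I.card * e := by
      have : (I.card : ℝ) * (k x x - 2 * ((I.card : ℝ)⁻¹ * ∑ i ∈ I, k (xs i) x) +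
        (I.card : ℝ)⁻¹ * ∑ i ∈ I, k (xs i) (xs i)) =
          I.card * k x x - 2 * ∑ i ∈ I, k (xs i) x + ∑ i ∈ I, k (xs i) (xs i) := by
        field_simp
      linarith
    exact le_of_mul_le_mul_left h2 hc
  rw [hww]
  have : σ ^ 2 * (1 / (I.card : ℝ)) = σ ^ 2 / I.card := by ring
  linarith

end

/-! ### Gaussian shifts -/

/-- Translating a centred Gaussian variable amounts to an exponential change of density. -/
theorem lintegral_gaussianReal_add (u : ℝ) {v : NNReal} (hv : v ≠ 0) {f : ℝ → ENNReal}
    (hf : Measurable f) :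
    ∫⁻ x, f (x + u) ∂gaussianReal 0 v =
      ∫⁻ x, ENNReal.ofReal (Real.exp ((u * x - u ^ 2 / 2) / v)) * f x ∂gaussianReal 0 v := by
  have hv' : (0 : ℝ) < v := by positivity
  have h1 : ∫⁻ x, f (x + u) ∂gaussianReal 0 v = ∫⁻ x, f x ∂gaussianReal u v := by
    rw [← zero_add u, ← gaussianReal_map_add_const, lintegral_map hf (by fun_prop), zero_add]
  rw [h1, gaussianReal_of_var_ne_zero _ hv, gaussianReal_of_var_ne_zero _ hv,
    lintegral_withDensity_eq_lintegral_mul _ (measurable_gaussianPDF _ _) hf,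
    lintegral_withDensity_eq_lintegral_mul _ (measurable_gaussianPDF _ _) (by fun_prop)]
  refine lintegral_congr fun x => ?_
  simp only [Pi.mul_apply, gaussianPDF, ← mul_assoc]
  rw [← ENNReal.ofReal_mul (gaussianPDFReal_nonneg _ _ _)]
  congr 2
  rw [gaussianPDFReal, gaussianPDFReal, mul_assoc, mul_assoc, ← Real.exp_add]
  congr 2
  field_simp
  ring

/-- Cameron–Martin: weighting jointly Gaussian variables `W` by `exp (Z - Var Z / 2)` translates
them by their covariances with `Z`. -/
theorem lintegral_exp_mul_gaussian {Ω : Type*} [MeasurableSpace Ω] {P : Measure Ω}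
    [IsProbabilityMeasure P] {ι : Type*} [Finite ι] {Z : Ω → ℝ} {W : ι → Ω → ℝ}
    (hG : IsGaussianProcess (Sum.elim (fun _ : Unit => Z) W) P)
    (hZ : Measurable Z) (hW : ∀ i, Measurable (W i)) (hmean : ∫ ω, Z ω ∂P = 0)
    {g : (ι → ℝ) → ENNReal} (hg : Measurable g) :
    ∫⁻ ω, ENNReal.ofReal (Real.exp (Z ω - Var[Z; P] / 2)) * g (fun i => W i ω) ∂P =
      ∫⁻ ω, g (fun i => W i ω + cov[W i, Z; P]) ∂P := by
  have hZG : HasGaussianLaw Z P := hG.hasGaussianLaw_eval (.inl ())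
  have hZ2 : MemLp Z 2 P := hZG.memLp_two
  have hW2 : ∀ i, MemLp (W i) 2 P := fun i => (hG.hasGaussianLaw_eval (.inr i)).memLp_two
  have hlaw := hZG.map_eq_gaussianReal
  rw [hmean] at hlaw
  have hvar := variance_nonneg Z P
  by_cases h0 : Var[Z; P] = 0
  · -- A degenerate `Z` vanishes almost surely, and its covariances vanish.
    have hZ0 : ∀ᵐ ω ∂P, Z ω = 0 := by
      rw [h0, Real.toNNReal_zero, gaussianReal_zero_var] at hlaw
      have : ∀ᵐ z ∂(P.map Z), z = 0 := by rw [hlaw]; simp [ae_dirac_eq]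
      exact ae_of_ae_map hZ.aemeasurable this
    have hc : ∀ i, cov[W i, Z; P] = 0 := fun i => by
      rw [covariance_eq_sub (hW2 i) hZ2, hmean, mul_zero, sub_zero]
      exact integral_eq_zero_of_ae (by filter_upwards [hZ0] with ω hω; simp [hω])
    simp only [hc, add_zero, h0, zero_div, sub_zero]
    refine lintegral_congr_ae ?_
    filter_upwards [hZ0] with ω hω
    simp [hω]
  · have hpos : 0 < Var[Z; P] := lt_of_le_of_ne hvar (Ne.symm h0)
    set s := Var[Z; P] with hs
    set c : ι → ℝ := fun i => cov[W i, Z; P] with hc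
    set R : ι → Ω → ℝ := fun i ω => W i ω - c i / s * Z ω with hR
    have hRm : ∀ i, Measurable (R i) := fun i => (hW i).sub (hZ.const_mul _)
    have hGR : IsGaussianProcess (Sum.elim (fun _ : Unit => Z) R) P := by
      classical
      refine hG.of_isGaussianProcess fun j => ?_
      rcases j with j | i
      · exact ⟨{.inl ()}, ContinuousLinearMap.proj ⟨.inl (), by simp⟩, fun ω => by simp⟩
      · refine ⟨{.inl (), .inr i}, ContinuousLinearMap.proj ⟨.inr i, by simp⟩ -
          (c i / s) • ContinuousLinearMap.proj ⟨.inl (), by simp⟩, fun ω => ?_⟩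
        simp [hR]
    have hind : IndepFun Z (fun ω i => R i ω) P := by
      have h := hGR.indepFun_of_covariance_eq_zero (fun _ => hZ.aemeasurable)
        (fun i => (hRm i).aemeasurable) (fun _ i => by
          have : cov[Z, R i; P] = cov[Z, W i; P] - c i / s * cov[Z, Z; P] := by
            rw [← covariance_const_mul_right, hR]
            exact covariance_fun_sub_right hZ2 (hW2 i) (hZ2.const_mul _)
          rw [this, covariance_self hZ.aemeasurable, covariance_comm Z (W i), ← hs]
          simp only [hc]
          field_simp
          ring)
      exact h.comp (φ := fun f : Unit → ℝ => f ()) (ψ := id) (measurable_pi_apply _) measurable_id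
    have hRvm : Measurable (fun ω i => R i ω) := measurable_pi_lambda _ hRm
    -- Integrate over `Z` and the independent residual `R` separately.
    have hjoint : P.map (fun ω => (Z ω, fun i => R i ω)) =
        (gaussianReal 0 s.toNNReal).prod (P.map fun ω i => R i ω) := by
      rw [(indepFun_iff_map_prod_eq_prod_map_map hZ.aemeasurable hRvm.aemeasurable).1 hind, hlaw]
    have key : ∀ F : ℝ × (ι → ℝ) → ENNReal, Measurable F →
        ∫⁻ ω, F (Z ω, fun i => R i ω) ∂P =
          ∫⁻ r, ∫⁻ z, F (z, r) ∂(gaussianReal 0 s.toNNReal) ∂(P.map fun ω i => R i ω) := by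
      intro F hF
      have : IsProbabilityMeasure (P.map fun ω i => R i ω) :=
        Measure.isProbabilityMeasure_map hRvm.aemeasurable
      rw [← lintegral_prod_symm _ hF.aemeasurable, ← hjoint,
        lintegral_map hF (hZ.prodMk hRvm)]
    have hWR : ∀ ω i, W i ω = R i ω + c i / s * Z ω := fun ω i => by simp [hR]
    have hsn : s.toNNReal ≠ 0 := by simpa using hpos
    have hsc : ((s.toNNReal : NNReal) : ℝ) = s := Real.coe_toNNReal _ hvar
    calc ∫⁻ ω, ENNReal.ofReal (Real.exp (Z ω - s / 2)) * g (fun i => W i ω) ∂P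
        = ∫⁻ ω, (fun p : ℝ × (ι → ℝ) => ENNReal.ofReal (Real.exp (p.1 - s / 2)) *
            g (fun i => p.2 i + c i / s * p.1)) (Z ω, fun i => R i ω) ∂P := by
          simp only [hWR]
      _ = ∫⁻ r, ∫⁻ z, ENNReal.ofReal (Real.exp (z - s / 2)) * g (fun i => r i + c i / s * z)
            ∂(gaussianReal 0 s.toNNReal) ∂(P.map fun ω i => R i ω) :=
          key (fun p => ENNReal.ofReal (Real.exp (p.1 - s / 2)) *
            g (fun i => p.2 i + c i / s * p.1)) (by fun_prop)
      _ = ∫⁻ r, ∫⁻ z, g (fun i => r i + c i / s * (z + s))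
            ∂(gaussianReal 0 s.toNNReal) ∂(P.map fun ω i => R i ω) := by
          refine lintegral_congr fun r => ?_
          rw [lintegral_gaussianReal_add s hsn (f := fun z => g fun i => r i + c i / s * z)
            (by fun_prop)]
          refine lintegral_congr fun z => ?_
          rw [hsc]
          congr 3
          field_simp
      _ = ∫⁻ ω, (fun p : ℝ × (ι → ℝ) => g (fun i => p.2 i + c i / s * (p.1 + s)))
            (Z ω, fun i => R i ω) ∂P := (key (fun p => g (fun i => p.2 i + c i / s * (p.1 + s)))
            (by fun_prop)).symm
      _ = _ := by
          refine lintegral_congr fun ω => ?_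
          simp only [hWR]
          congr 1
          funext i
          field_simp
          simp only [hc]
          ring

/-! ### Gaussian processes -/

theorem IsCentredGP.memLp {d : ℕ} {Ω : Type*} [MeasurableSpace Ω] {P : Measure Ω}
    {U : Vec d → Ω → ℝ} {k : Vec d → Vec d → ℝ} (hU : IsCentredGP P U k) (x : Vec d) :
    MemLp (U x) 2 P :=
  (hU.gaussian.hasGaussianLaw_eval x).memLp_two

theorem IsCentredGP.isPosSemidefKernel {d : ℕ} {Ω : Type*} [MeasurableSpace Ω] {P : Measure Ω}
    [IsProbabilityMeasure P] {U : Vec d → Ω → ℝ} {k : Vec d → Vec d → ℝ}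
    (hU : IsCentredGP P U k) : IsPosSemidefKernel k := by
  intro m xs
  refine Matrix.PosSemidef.of_dotProduct_mulVec_nonneg ?_ fun w => ?_
  · ext i j
    simp [gram, ← hU.cov, covariance_comm (U (xs j))]
  · have h := variance_nonneg (fun ω => ∑ i, w i * U (xs i) ω) P
    rw [← covariance_self
      (Finset.aemeasurable_fun_sum _ fun i _ => ((hU.measurable _).const_mul _).aemeasurable),
      covariance_fun_sum_fun_sum (fun i => (hU.memLp _).const_mul _)
        (fun i => (hU.memLp _).const_mul _)] at h
    simp only [covariance_const_mul_left, covariance_const_mul_right, hU.cov] at h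
    simpa [dotProduct, Matrix.mulVec, gram, Finset.mul_sum, mul_assoc, mul_comm, mul_left_comm]
      using h

/-- The likelihood of the feedback `y` when the unknown function takes the values `u` at the
points of evaluation, relative to the law of the noise. -/
def likelihood {m : ℕ} (σ : ℝ) (u y : Fin m → ℝ) : ℝ :=
  Real.exp ((u ⬝ᵥ y - u ⬝ᵥ u / 2) / σ ^ 2)

/-- Bayes' rule at fixed evaluation points `xs` and fixed feedback `y`: reweighted by the
likelihood, `U x` has the moment generating function of a normal variable with the posterior mean
and variance. -/
theorem lintegral_exp_posterior {d m : ℕ} {Ω : Type*} [MeasurableSpace Ω] {P : Measure Ω}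
    [IsProbabilityMeasure P] {U : Vec d → Ω → ℝ} {k : Vec d → Vec d → ℝ}
    (hU : IsCentredGP P U k) {σ : ℝ} (hσ : 0 < σ) (xs : Fin m → Vec d) (y : Fin m → ℝ)
    (x : Vec d) (θ : ℝ) :
    ∫⁻ ω, ENNReal.ofReal (Real.exp (θ * (U x ω - postMean k σ xs y x) -
        θ ^ 2 * postCov k σ xs x x / 2)) *
        ENNReal.ofReal (likelihood σ (fun i => U (xs i) ω) y) ∂P =
      ∫⁻ ω, ENNReal.ofReal (likelihood σ (fun i => U (xs i) ω) y) ∂P := by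
  have hk := hU.isPosSemidefKernel
  set q : Fin m → ℝ := Matrix.mulVec (regGram k σ xs)⁻¹ (kvec k xs x) with hq
  have hKq : Matrix.mulVec (gram k xs) q + σ ^ 2 • q = kvec k xs x := by
    have h := regGram_mulVec_inv hk hσ xs (kvec k xs x)
    rwa [← hq, Matrix.add_mulVec, Matrix.smul_mulVec, Matrix.one_mulVec] at h
  -- The part of `U x` that is not explained by the observed values; the remainder is absorbed
  -- by the noise.
  set Z : Ω → ℝ := fun ω => θ * U x ω - ∑ i, θ * q i * U (xs i) ω with hZ
  have hSm : ∀ i, MemLp (fun ω => θ * q i * U (xs i) ω) 2 P := fun i => (hU.memLp _).const_mul _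
  have hSm' : MemLp (fun ω => ∑ i, θ * q i * U (xs i) ω) 2 P :=
    memLp_finsetSum _ fun i _ => hSm i
  have hZm : Measurable Z := ((hU.measurable x).const_mul _).sub
    (Finset.measurable_fun_sum _ fun i _ => (hU.measurable _).const_mul _)
  have hZmean : ∫ ω, Z ω ∂P = 0 := by
    rw [hZ, integral_sub (((hU.memLp x).integrable one_le_two).const_mul _)
      (hSm'.integrable one_le_two), integral_const_mul, hU.mean, mul_zero,
      integral_finsetSum _ fun i _ => (hSm i).integrable one_le_two]
    simp [integral_const_mul, hU.mean]
  have hG : IsGaussianProcess (Sum.elim (fun _ : Unit => Z) fun i : Fin m => U (xs i)) P := by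
    classical
    refine hU.gaussian.of_isGaussianProcess fun j => ?_
    rcases j with j | i
    · refine ⟨insert x (Finset.univ.image xs),
        θ • ContinuousLinearMap.proj ⟨x, by simp⟩ - ∑ i, (θ * q i) •
          ContinuousLinearMap.proj ⟨xs i, by simp⟩, fun ω => ?_⟩
      simp [hZ]
    · exact ⟨{xs i}, ContinuousLinearMap.proj ⟨xs i, by simp⟩, fun ω => by simp⟩
  have hcovU : ∀ z, cov[U z, Z; P] = θ * (k z x - ∑ i, q i * k z (xs i)) := fun z => by
    rw [hZ, covariance_fun_sub_right (hU.memLp z) ((hU.memLp x).const_mul _) hSm',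
      covariance_const_mul_right, hU.cov, covariance_fun_sum_right hSm (hU.memLp z), mul_sub,
      Finset.mul_sum]
    congr 1
    refine Finset.sum_congr rfl fun i _ => ?_
    rw [covariance_const_mul_right, hU.cov, mul_assoc]
  have hcov : ∀ i, cov[U (xs i), Z; P] = θ * (σ ^ 2 * q i) := fun i => by
    rw [hcovU]
    congr 1
    have h := congrFun hKq i
    simp only [Pi.add_apply, Pi.smul_apply, smul_eq_mul, Matrix.mulVec, dotProduct, gram, kvec,
      Matrix.of_apply] at h
    rw [← h]
    have : ∑ j, q j * k (xs i) (xs j) = ∑ j, k (xs i) (xs j) * q j :=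
      Finset.sum_congr rfl fun j _ => mul_comm _ _
    rw [this]
    ring
  have hvar : Var[Z; P] = θ ^ 2 * (postCov k σ xs x x - σ ^ 2 * (q ⬝ᵥ q)) := by
    have e1 : Var[Z; P] = θ * cov[U x, Z; P] - ∑ i, θ * q i * cov[U (xs i), Z; P] := by
      rw [← covariance_self hZm.aemeasurable]
      conv_lhs => rw [hZ]
      rw [covariance_fun_sub_left ((hU.memLp x).const_mul _) hSm' (by
          rw [← hZ]; exact ((hU.memLp x).const_mul _).sub hSm'),
        covariance_const_mul_left, covariance_fun_sum_left hSm (by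
          rw [← hZ]; exact ((hU.memLp x).const_mul _).sub hSm')]
      congr 1
      exact Finset.sum_congr rfl fun i _ => by rw [covariance_const_mul_left]
    have e2 : postCov k σ xs x x = k x x - ∑ i, q i * k x (xs i) := by
      have : postCov k σ xs x x = k x x - kvec k xs x ⬝ᵥ q := rfl
      rw [this, dotProduct]
      congr 1
      exact Finset.sum_congr rfl fun i _ => by rw [kvec, hk.symm, mul_comm]
    rw [e1, hcovU, e2]
    simp only [hcov, dotProduct]
    have e3 : ∑ i, θ * q i * (θ * (σ ^ 2 * q i)) = θ ^ 2 * (σ ^ 2 * ∑ i, q i * q i) := by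
      simp only [Finset.mul_sum]
      exact Finset.sum_congr rfl fun i _ => by ring
    rw [e3]
    ring
  have hmu : postMean k σ xs y x = q ⬝ᵥ y := by
    have : postMean k σ xs y x = kvec k xs x ⬝ᵥ Matrix.mulVec (regGram k σ xs)⁻¹ y := rfl
    rw [this, regGram_inv_dotProduct_comm hk hσ, dotProduct_comm]
  have hm := lintegral_exp_mul_gaussian hG hZm (fun i => hU.measurable _) hZmean
    (g := fun w => ENNReal.ofReal (Real.exp (Var[Z; P] / 2 + θ * (q ⬝ᵥ w) -
      θ * postMean k σ xs y x - θ ^ 2 * postCov k σ xs x x / 2)) *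
      ENNReal.ofReal (likelihood σ w y))
    (by unfold likelihood dotProduct; fun_prop)
  refine Eq.trans ?_ (hm.trans ?_)
  · refine lintegral_congr fun ω => ?_
    rw [← mul_assoc, ← ENNReal.ofReal_mul (Real.exp_nonneg (Z ω - _)), ← Real.exp_add]
    congr 3
    simp only [hZ, dotProduct, Finset.mul_sum, ← mul_assoc]
    ring
  · refine lintegral_congr fun ω => ?_
    rw [← ENNReal.ofReal_mul (Real.exp_nonneg _)]
    congr 1
    simp only [likelihood]
    rw [← Real.exp_add]
    congr 1
    have e : (fun i => U (xs i) ω + cov[U (xs i), Z; P]) =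
        (fun i => U (xs i) ω) + (θ * σ ^ 2) • q := by
      funext i
      simp [hcov, mul_assoc]
    rw [e, hvar, hmu]
    set w : Fin m → ℝ := fun i => U (xs i) ω
    simp only [add_dotProduct, dotProduct_add, smul_dotProduct, dotProduct_smul, smul_eq_mul,
      dotProduct_comm w q]
    field_simp
    ring

/-! ### Adaptive observations -/

/-- The evaluation points that the decision rules `ξ` produce along the feedback `y`. -/
def decisions {S : Type*} (ξ : ∀ m : ℕ, (Fin m → ℝ) → S) {m : ℕ} (y : Fin m → ℝ) (i : Fin m) : S :=
  ξ i fun j => y (j.castLE i.2.le)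

theorem decisions_snoc_castSucc {S : Type*} (ξ : ∀ m : ℕ, (Fin m → ℝ) → S) {m : ℕ}
    (y : Fin m → ℝ) (e : ℝ) (i : Fin m) :
    decisions ξ (Fin.snoc y e : Fin (m + 1) → ℝ) i.castSucc = decisions ξ y i := by
  unfold decisions
  congr 1
  funext j
  exact Fin.snoc_castSucc (α := fun _ => ℝ) e y (j.castLE i.2.le)

theorem decisions_snoc_last {S : Type*} (ξ : ∀ m : ℕ, (Fin m → ℝ) → S) {m : ℕ}
    (y : Fin m → ℝ) (e : ℝ) :
    decisions ξ (Fin.snoc y e : Fin (m + 1) → ℝ) (Fin.last m) = ξ m y := by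
  unfold decisions
  congr 1
  funext j
  exact Fin.snoc_castSucc (α := fun _ => ℝ) e y j

theorem measurable_decisions {S : Type*} [MeasurableSpace S] {ξ : ∀ m : ℕ, (Fin m → ℝ) → S}
    (hξ : ∀ m, Measurable (ξ m)) {m : ℕ} (i : Fin m) :
    Measurable fun y : Fin m → ℝ => decisions ξ y i :=
  (hξ i).comp (measurable_pi_lambda _ fun _ => measurable_pi_apply _)

theorem measurable_snoc {m : ℕ} :
    Measurable fun p : (Fin m → ℝ) × ℝ => (Fin.snoc p.1 p.2 : Fin (m + 1) → ℝ) := by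
  refine measurable_pi_lambda _ fun i => ?_
  refine Fin.lastCases ?_ (fun i => ?_) i
  · simpa using measurable_snd
  · simp only [Fin.snoc_castSucc]
    fun_prop

theorem snoc_eq_of_nat {m : ℕ} (y : ℕ → ℝ) :
    (fun i : Fin (m + 1) => y i) = (Fin.snoc (fun i : Fin m => y i) (y m) : Fin (m + 1) → ℝ) := by
  funext i
  refine Fin.lastCases ?_ (fun i => ?_) i <;> simp

theorem likelihood_nonneg {m : ℕ} (σ : ℝ) (u y : Fin m → ℝ) : 0 ≤ likelihood σ u y :=
  Real.exp_nonneg _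

theorem likelihood_snoc {m : ℕ} (σ : ℝ) (u y : Fin m → ℝ) (a e : ℝ) :
    likelihood σ (Fin.snoc u a : Fin (m + 1) → ℝ) (Fin.snoc y e : Fin (m + 1) → ℝ) =
      likelihood σ u y * Real.exp ((a * e - a ^ 2 / 2) / σ ^ 2) := by
  rw [likelihood, likelihood, ← Real.exp_add]
  congr 1
  simp only [dotProduct, Fin.sum_univ_castSucc, Fin.snoc_castSucc, Fin.snoc_last]
  ring

theorem measurable_likelihood {α : Type*} [MeasurableSpace α] {m : ℕ} (σ : ℝ)
    {u y : α → Fin m → ℝ} (hu : ∀ i, Measurable fun a => u a i)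
    (hy : ∀ i, Measurable fun a => y a i) : Measurable fun a => likelihood σ (u a) (y a) := by
  unfold likelihood dotProduct
  fun_prop

/-- The feedback `y` consists of noisy values of the unknown function `u · (π ω)` at points that
are chosen by the decision rules `ξ` on the basis of the earlier feedback, and each noise variable
is independent of the unknown function and of the earlier noise. -/
structure IsAdaptiveFeedback {Ω Ω₁ S : Type*} [MeasurableSpace Ω] [MeasurableSpace Ω₁]
    [MeasurableSpace S] (P : Measure Ω) (π : Ω → Ω₁) (u : S → Ω₁ → ℝ) (ε y : ℕ → Ω → ℝ)
    (ξ : ∀ m : ℕ, (Fin m → ℝ) → S) (σ : ℝ) : Prop where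
  measurable_path : Measurable π
  measurable_eval : Measurable (Function.uncurry u)
  measurable_noise : ∀ i, Measurable (ε i)
  measurable_rule : ∀ m, Measurable (ξ m)
  feedback : ∀ i ω, y i ω = u (ξ i fun j => y j ω) (π ω) + ε i ω
  law : ∀ i, P.map (ε i) = gaussianReal 0 (Real.toNNReal (σ ^ 2))
  indep : ∀ m, IndepFun (fun ω => (π ω, fun i : Fin m => ε i ω)) (ε m) P

/-- The feedback is a measurable function of the unknown function and of the noise. -/
theorem IsAdaptiveFeedback.exists_eq {Ω Ω₁ S : Type*} [MeasurableSpace Ω] [MeasurableSpace Ω₁]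
    [MeasurableSpace S] {P : Measure Ω} {π : Ω → Ω₁} {u : S → Ω₁ → ℝ} {ε y : ℕ → Ω → ℝ}
    {ξ : ∀ m : ℕ, (Fin m → ℝ) → S} {σ : ℝ} (h : IsAdaptiveFeedback P π u ε y ξ σ) (m : ℕ) :
    ∃ ψ : Ω₁ × (Fin m → ℝ) → (Fin m → ℝ), Measurable ψ ∧
      ∀ ω, (fun i : Fin m => y i ω) = ψ (π ω, fun i => ε i ω) := by
  induction m with
  | zero => exact ⟨fun p => p.2, measurable_snd, fun ω => Subsingleton.elim _ _⟩
  | succ m ih =>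
    obtain ⟨ψ, hψ, hψy⟩ := ih
    have hrest : Measurable fun p : Ω₁ × (Fin (m + 1) → ℝ) =>
        ψ (p.1, fun i => p.2 i.castSucc) := by fun_prop
    refine ⟨fun p => (Fin.snoc (ψ (p.1, fun i => p.2 i.castSucc))
      (u (ξ m (ψ (p.1, fun i => p.2 i.castSucc))) p.1 + p.2 (Fin.last m)) : Fin (m + 1) → ℝ),
      measurable_snoc.comp (hrest.prodMk ?_), fun ω => ?_⟩
    · exact (h.measurable_eval.comp (((h.measurable_rule m).comp hrest).prodMk measurable_fst)).add
        ((measurable_pi_apply _).comp measurable_snd)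
    · rw [snoc_eq_of_nat (fun i => y i ω), h.feedback m ω, hψy ω]
      rfl

theorem IsAdaptiveFeedback.measurable {Ω Ω₁ S : Type*} [MeasurableSpace Ω] [MeasurableSpace Ω₁]
    [MeasurableSpace S] {P : Measure Ω} {π : Ω → Ω₁} {u : S → Ω₁ → ℝ} {ε y : ℕ → Ω → ℝ}
    {ξ : ∀ m : ℕ, (Fin m → ℝ) → S} {σ : ℝ} (h : IsAdaptiveFeedback P π u ε y ξ σ) (m : ℕ) :
    Measurable fun ω => (π ω, fun i : Fin m => y i ω) := by
  obtain ⟨ψ, hψ, hψy⟩ := h.exists_eq m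
  have h1 := h.measurable_path
  have h2 := h.measurable_noise
  simp only [hψy]
  fun_prop

/-- Change of measure for adaptive observations: relative to a fixed law `ρ` of the feedback, the
joint law of the unknown function and the feedback has the likelihood as its density. For given
feedback, the evaluation points are then no longer random. -/
theorem IsAdaptiveFeedback.exists_lintegral_eq {Ω Ω₁ S : Type*} [MeasurableSpace Ω]
    [MeasurableSpace Ω₁] [MeasurableSpace S] {P : Measure Ω} [IsProbabilityMeasure P]
    {π : Ω → Ω₁} {u : S → Ω₁ → ℝ} {ε y : ℕ → Ω → ℝ} {ξ : ∀ m : ℕ, (Fin m → ℝ) → S} {σ : ℝ}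
    (H' : IsAdaptiveFeedback P π u ε y ξ σ) (hσ : 0 < σ) (m : ℕ) :
    ∃ ρ : Measure (Fin m → ℝ), IsProbabilityMeasure ρ ∧
      ∀ F : Ω₁ × (Fin m → ℝ) → ENNReal, Measurable F →
        ∫⁻ ω, F (π ω, fun i => y i ω) ∂P =
          ∫⁻ z, ∫⁻ ω, F (π ω, z) *
            ENNReal.ofReal (likelihood σ (fun i => u (decisions ξ z i) (π ω)) z) ∂P ∂ρ := by
  have hπ := H'.measurable_path
  have hu := H'.measurable_eval
  have hξ := H'.measurable_rule
  induction m with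
  | zero =>
    refine ⟨Measure.dirac ![], inferInstance, fun F hF => ?_⟩
    rw [lintegral_dirac]
    refine lintegral_congr fun ω => ?_
    have : (fun i : Fin 0 => y i ω) = ![] := Subsingleton.elim _ _
    rw [this]
    simp [likelihood]
  | succ m ih =>
    obtain ⟨ρ, hρ, ih⟩ := ih
    obtain ⟨ψ, hψ, hψy⟩ := H'.exists_eq m
    set γ := gaussianReal 0 (Real.toNNReal (σ ^ 2)) with hγ
    have hσ2 : (0 : ℝ) < σ ^ 2 := by positivity
    have hv : Real.toNNReal (σ ^ 2) ≠ 0 := by simpa using hσ.ne'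
    have hvc : ((Real.toNNReal (σ ^ 2) : NNReal) : ℝ) = σ ^ 2 := Real.coe_toNNReal _ hσ2.le
    have hp := H'.measurable m
    -- The next noise variable is independent of the past.
    have hindy : IndepFun (fun ω => (π ω, fun i : Fin m => y i ω)) (ε m) P := by
      have h := (H'.indep m).comp (φ := fun p => (p.1, ψ p)) (ψ := id)
        (measurable_fst.prodMk hψ) measurable_id
      refine h.congr (.of_forall fun ω => ?_) .rfl
      simp [hψy ω]
    have hjoint : P.map (fun ω => ((π ω, fun i : Fin m => y i ω), ε m ω)) =
        (P.map fun ω => (π ω, fun i : Fin m => y i ω)).prod γ := by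
      rw [(indepFun_iff_map_prod_eq_prod_map_map hp.aemeasurable (H'.measurable_noise m).aemeasurable).1 hindy,
        H'.law]
    have : IsProbabilityMeasure (P.map fun ω => (π ω, fun i : Fin m => y i ω)) :=
      Measure.isProbabilityMeasure_map hp.aemeasurable
    obtain ⟨sn, hsn, hsnm⟩ : ∃ sn : (Fin m → ℝ) × ℝ → Fin (m + 1) → ℝ,
        (∀ z e, sn (z, e) = Fin.snoc z e) ∧ Measurable sn :=
      ⟨fun p => Fin.snoc p.1 p.2, fun _ _ => rfl, measurable_snoc⟩
    refine ⟨(ρ.prod γ).map sn, Measure.isProbabilityMeasure_map hsnm.aemeasurable, fun F hF => ?_⟩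
    have hum : Measurable fun p : Ω₁ × (Fin m → ℝ) => u (ξ m p.2) p.1 :=
      hu.comp (((hξ m).comp measurable_snd).prodMk measurable_fst)
    -- the density of one further observation
    obtain ⟨w, hw, hwm⟩ : ∃ w : (Ω₁ × (Fin m → ℝ)) × ℝ → ℝ, (∀ p e, w (p, e) =
        Real.exp ((u (ξ m p.2) p.1 * e - u (ξ m p.2) p.1 ^ 2 / 2) / σ ^ 2)) ∧ Measurable w := by
      refine ⟨fun q => Real.exp ((u (ξ m q.1.2) q.1.1 * q.2 - u (ξ m q.1.2) q.1.1 ^ 2 / 2) /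
        σ ^ 2), fun _ _ => rfl, ?_⟩
      have hu' : Measurable fun q : (Ω₁ × (Fin m → ℝ)) × ℝ => u (ξ m q.1.2) q.1.1 :=
        hum.comp measurable_fst
      fun_prop
    have hFs : Measurable fun q : (Ω₁ × (Fin m → ℝ)) × ℝ => F (q.1.1, sn (q.1.2, q.2)) := by
      fun_prop
    have hGm : Measurable fun q : (Ω₁ × (Fin m → ℝ)) × ℝ =>
        F (q.1.1, sn (q.1.2, q.2 + u (ξ m q.1.2) q.1.1)) := by
      have hu' : Measurable fun q : (Ω₁ × (Fin m → ℝ)) × ℝ => u (ξ m q.1.2) q.1.1 :=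
        hum.comp measurable_fst
      fun_prop
    have hF' : Measurable fun q : (Ω₁ × (Fin m → ℝ)) × ℝ => ENNReal.ofReal (w q) *
        F (q.1.1, sn (q.1.2, q.2)) := hwm.ennreal_ofReal.mul hFs
    obtain ⟨H, hH, hHm⟩ : ∃ H : (Fin (m + 1) → ℝ) × Ω → ENNReal, (∀ z ω, H (z, ω) =
        F (π ω, z) * ENNReal.ofReal (likelihood σ (fun i => u (decisions ξ z i) (π ω)) z)) ∧
        Measurable H := by
      have h1 : ∀ i, Measurable fun q : (Fin (m + 1) → ℝ) × Ω =>
          u (decisions ξ q.1 i) (π q.2) := fun i =>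
        hu.comp (((measurable_decisions hξ i).comp measurable_fst).prodMk
          (hπ.comp measurable_snd))
      have h2 : Measurable fun q : (Fin (m + 1) → ℝ) × Ω =>
          likelihood σ (fun i => u (decisions ξ q.1 i) (π q.2)) q.1 :=
        measurable_likelihood σ h1 fun i => by fun_prop
      have h3 : Measurable fun q : (Fin (m + 1) → ℝ) × Ω => F (π q.2, q.1) := by fun_prop
      exact ⟨fun q => F (π q.2, q.1) * ENNReal.ofReal
        (likelihood σ (fun i => u (decisions ξ q.1 i) (π q.2)) q.1), fun _ _ => rfl,
        h3.mul h2.ennreal_ofReal⟩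
    simp only [← hH]
    calc ∫⁻ ω, F (π ω, fun i => y i ω) ∂P
        = ∫⁻ ω, (fun q : (Ω₁ × (Fin m → ℝ)) × ℝ =>
            F (q.1.1, sn (q.1.2, q.2 + u (ξ m q.1.2) q.1.1)))
            ((π ω, fun i : Fin m => y i ω), ε m ω) ∂P := by
          refine lintegral_congr fun ω => ?_
          rw [snoc_eq_of_nat (fun i => y i ω), H'.feedback m ω]
          simp only [hsn, add_comm (ε m ω)]
      _ = ∫⁻ p, ∫⁻ e, F (p.1, sn (p.2, e + u (ξ m p.2) p.1)) ∂γ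
            ∂(P.map fun ω => (π ω, fun i : Fin m => y i ω)) := by
          rw [← lintegral_map hGm (hp.prodMk (H'.measurable_noise m)), hjoint, lintegral_prod _ hGm.aemeasurable]
      _ = ∫⁻ p, ∫⁻ e, ENNReal.ofReal (w (p, e)) * F (p.1, sn (p.2, e)) ∂γ
            ∂(P.map fun ω => (π ω, fun i : Fin m => y i ω)) := by
          refine lintegral_congr fun p => ?_
          have h := lintegral_gaussianReal_add (u (ξ m p.2) p.1) hv
            (f := fun e => F (p.1, sn (p.2, e))) (by fun_prop)
          rw [hvc] at h
          simp only [hw]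
          exact h
      _ = ∫⁻ ω, ∫⁻ e, ENNReal.ofReal (w ((π ω, fun i => y i ω), e)) *
            F (π ω, sn (fun i => y i ω, e)) ∂γ ∂P := by
          rw [lintegral_map hF'.lintegral_prod_right' hp]
      _ = ∫⁻ z, ∫⁻ ω, (∫⁻ e, ENNReal.ofReal (w ((π ω, z), e)) * F (π ω, sn (z, e)) ∂γ) *
            ENNReal.ofReal (likelihood σ (fun i => u (decisions ξ z i) (π ω)) z) ∂P ∂ρ :=
          ih (fun p => ∫⁻ e, ENNReal.ofReal (w (p, e)) * F (p.1, sn (p.2, e)) ∂γ)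
            hF'.lintegral_prod_right'
      _ = ∫⁻ z, ∫⁻ ω, ∫⁻ e, H (sn (z, e), ω) ∂γ ∂P ∂ρ := by
          refine lintegral_congr fun z => lintegral_congr fun ω => ?_
          rw [← lintegral_mul_const _ (by fun_prop)]
          refine lintegral_congr fun e => ?_
          have e1 : (fun i => u (decisions ξ (Fin.snoc z e : Fin (m + 1) → ℝ) i) (π ω)) =
              (Fin.snoc (fun i => u (decisions ξ z i) (π ω)) (u (ξ m z) (π ω)) :
                Fin (m + 1) → ℝ) := by
            funext i
            refine Fin.lastCases ?_ (fun i => ?_) i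
            · simp [decisions_snoc_last]
            · simp [decisions_snoc_castSucc]
          rw [hH, hsn, e1, likelihood_snoc, ENNReal.ofReal_mul (likelihood_nonneg _ _ _), hw]
          ring
      _ = ∫⁻ z, ∫⁻ e, ∫⁻ ω, H (sn (z, e), ω) ∂P ∂γ ∂ρ := by
          refine lintegral_congr fun z => lintegral_lintegral_swap ?_
          exact Measurable.aemeasurable (by fun_prop)
      _ = ∫⁻ z, ∫⁻ ω, H (z, ω) ∂P ∂((ρ.prod γ).map sn) := by
          have hI := hHm.lintegral_prod_right' (ν := P)
          rw [lintegral_map hI hsnm]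
          exact (lintegral_prod _ (hI.comp hsnm).aemeasurable).symm

/-! ### Confidence bounds for adaptive observations -/

theorem measurable_dotProduct_regGram_inv {d m : ℕ} {D : Set (Vec d)} {α : Type*}
    [MeasurableSpace α] {k : Vec d → Vec d → ℝ} (hk : Measurable fun q : D × D => k q.1 q.2)
    (σ : ℝ) {p : α → Fin m → D} (hp : ∀ i, Measurable fun a => p a i)
    {f g : α → Fin m → ℝ} (hf : ∀ i, Measurable fun a => f a i)
    (hg : ∀ i, Measurable fun a => g a i) :
    Measurable fun a => f a ⬝ᵥ
      Matrix.mulVec (regGram k σ fun i => (p a i : Vec d))⁻¹ (g a) := by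
  have hA : ∀ i j, Measurable fun a => regGram k σ (fun i => (p a i : Vec d)) i j := fun i j => by
    simp only [regGram, Matrix.add_apply, gram, Matrix.of_apply]
    exact (hk.comp ((hp i).prodMk (hp j))).add_const _
  -- Inverse matrices are rational functions of the entries.
  have hAv : Measurable fun a => fun i j => regGram k σ (fun i => (p a i : Vec d)) i j :=
    measurable_pi_lambda _ fun i => measurable_pi_lambda _ fun j => hA i j
  have hdet : Measurable fun a => (regGram k σ fun i => (p a i : Vec d)).det := by
    have : Continuous fun M : Fin m → Fin m → ℝ => (Matrix.of M).det :=
      Continuous.matrix_det continuous_id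
    exact this.measurable.comp hAv
  have hadj : ∀ i j, Measurable fun a =>
      (regGram k σ fun i => (p a i : Vec d)).adjugate i j := fun i j => by
    have : Continuous fun M : Fin m → Fin m → ℝ => (Matrix.of M).adjugate i j :=
      (Continuous.matrix_adjugate continuous_id).matrix_elem i j
    exact this.measurable.comp hAv
  simp only [dotProduct, Matrix.mulVec, Matrix.inv_def, Matrix.smul_apply, smul_eq_mul,
    Ring.inverse_eq_inv']
  fun_prop

theorem measurable_postMean {d m : ℕ} {D : Set (Vec d)} {α : Type*}
    [MeasurableSpace α] {k : Vec d → Vec d → ℝ} (hk : Measurable fun q : D × D => k q.1 q.2)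
    (σ : ℝ) {p : α → Fin m → D} (hp : ∀ i, Measurable fun a => p a i)
    {y : α → Fin m → ℝ} (hy : ∀ i, Measurable fun a => y a i) {z : α → D} (hz : Measurable z) :
    Measurable fun a => postMean k σ (fun i => (p a i : Vec d)) (y a) (z a) :=
  measurable_dotProduct_regGram_inv hk σ hp (fun i => hk.comp ((hp i).prodMk hz)) hy

theorem measurable_postCov {d m : ℕ} {D : Set (Vec d)} {α : Type*}
    [MeasurableSpace α] {k : Vec d → Vec d → ℝ} (hk : Measurable fun q : D × D => k q.1 q.2)
    (σ : ℝ) {p : α → Fin m → D} (hp : ∀ i, Measurable fun a => p a i)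
    {z : α → D} (hz : Measurable z) :
    Measurable fun a => postCov k σ (fun i => (p a i : Vec d)) (z a) (z a) :=
  (hk.comp (hz.prodMk hz)).sub (measurable_dotProduct_regGram_inv hk σ hp
    (fun i => hk.comp ((hp i).prodMk hz)) (fun i => hk.comp ((hp i).prodMk hz)))

/-- An exponential of the posterior error has integral one, for decision rules, a target `ζ` and
an exponent `θ` that may depend on the feedback. -/
theorem IsAdaptiveFeedback.lintegral_exp_error {d : ℕ} {Ω Ω₁ : Type*} [MeasurableSpace Ω]
    [MeasurableSpace Ω₁] {P : Measure Ω} [IsProbabilityMeasure P] {π : Ω → Ω₁}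
    {D : Set (Vec d)} {u : D → Ω₁ → ℝ} {ε y : ℕ → Ω → ℝ} {ξ : ∀ m : ℕ, (Fin m → ℝ) → D} {σ : ℝ}
    (H : IsAdaptiveFeedback P π u ε y ξ σ) (hσ : 0 < σ) {U : Vec d → Ω → ℝ}
    {k : Vec d → Vec d → ℝ} (hU : IsCentredGP P U k) (hUu : ∀ (x : D) ω, U x ω = u x (π ω))
    (hk : Measurable fun q : D × D => k q.1 q.2) (m : ℕ)
    {ζ : (Fin m → ℝ) → D} (hζ : Measurable ζ) {θ : (Fin m → ℝ) → ℝ} (hθ : Measurable θ) :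
    ∃ F : Ω₁ × (Fin m → ℝ) → ENNReal, Measurable F ∧
      (∀ w z, F (w, z) = ENNReal.ofReal (Real.exp (θ z * (u (ζ z) w -
        postMean k σ (fun i => ((decisions ξ z i : D) : Vec d)) z (ζ z)) -
        θ z ^ 2 * postCov k σ (fun i => ((decisions ξ z i : D) : Vec d)) (ζ z) (ζ z) / 2))) ∧
      ∫⁻ ω, F (π ω, fun i => y i ω) ∂P = 1 := by
  obtain ⟨ρ, hρ, h⟩ := H.exists_lintegral_eq hσ m
  have hdec : ∀ i : Fin m, Measurable fun q : Ω₁ × (Fin m → ℝ) => decisions ξ q.2 i := fun i =>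
    (measurable_decisions H.measurable_rule i).comp measurable_snd
  have hz : Measurable fun q : Ω₁ × (Fin m → ℝ) => ζ q.2 := hζ.comp measurable_snd
  have hm := measurable_postMean hk σ hdec (y := fun q => q.2) (fun i => by fun_prop) hz
  have hc := measurable_postCov hk σ hdec hz
  have hu' : Measurable fun q : Ω₁ × (Fin m → ℝ) => u (ζ q.2) q.1 :=
    H.measurable_eval.comp (hz.prodMk measurable_fst)
  have hθ' : Measurable fun q : Ω₁ × (Fin m → ℝ) => θ q.2 := hθ.comp measurable_snd
  obtain ⟨F, hFe, hF⟩ : ∃ F : Ω₁ × (Fin m → ℝ) → ENNReal,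
      (∀ w z, F (w, z) = ENNReal.ofReal (Real.exp (θ z * (u (ζ z) w -
        postMean k σ (fun i => ((decisions ξ z i : D) : Vec d)) z (ζ z)) -
        θ z ^ 2 * postCov k σ (fun i => ((decisions ξ z i : D) : Vec d)) (ζ z) (ζ z) / 2))) ∧
      Measurable F :=
    ⟨_, fun _ _ => rfl, ((hθ'.mul (hu'.sub hm)).sub
      (((hθ'.pow_const 2).mul hc).div_const 2)).exp.ennreal_ofReal⟩
  refine ⟨F, hF, hFe, ?_⟩
  rw [h F hF]
  have h1 := h (fun _ => 1) measurable_const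
  simp only [one_mul, lintegral_const, measure_univ, mul_one] at h1
  rw [h1]
  refine lintegral_congr fun z => ?_
  simp only [hFe, ← hUu]
  exact lintegral_exp_posterior hU hσ (fun i => ((decisions ξ z i : D) : Vec d)) z (ζ z) (θ z)

/-- Confidence bound for the posterior at a point that may depend on the feedback. -/
theorem IsAdaptiveFeedback.measure_error_le {d : ℕ} {Ω Ω₁ : Type*} [MeasurableSpace Ω]
    [MeasurableSpace Ω₁] {P : Measure Ω} [IsProbabilityMeasure P] {π : Ω → Ω₁}
    {D : Set (Vec d)} {u : D → Ω₁ → ℝ} {ε y : ℕ → Ω → ℝ} {ξ : ∀ m : ℕ, (Fin m → ℝ) → D} {σ : ℝ}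
    (H : IsAdaptiveFeedback P π u ε y ξ σ) (hσ : 0 < σ) {U : Vec d → Ω → ℝ}
    {k : Vec d → Vec d → ℝ} (hU : IsCentredGP P U k) (hUu : ∀ (x : D) ω, U x ω = u x (π ω))
    (hk : Measurable fun q : D × D => k q.1 q.2) (m : ℕ)
    {ζ : (Fin m → ℝ) → D} (hζ : Measurable ζ) {c e : ℝ} (hc : 0 ≤ c)
    (he : 0 < e) :
    P {ω | c * (postStd k σ (fun i : Fin m => ((ξ i fun j => y j ω : D) : Vec d))
        (ζ fun i => y i ω) + e) <
      |U (ζ fun i => y i ω) ω - postMean k σ (fun i : Fin m => ((ξ i fun j => y j ω : D) : Vec d))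
        (fun i => y i ω) (ζ fun i => y i ω)|} ≤ 2 * ENNReal.ofReal (Real.exp (-(c ^ 2 / 2))) := by
  have hK := hU.isPosSemidefKernel
  have hs : Measurable fun z : Fin m → ℝ =>
      postStd k σ (fun i => ((decisions ξ z i : D) : Vec d)) (ζ z) :=
    (measurable_postCov hk σ (measurable_decisions H.measurable_rule) hζ).sqrt
  set M : Ω → ℝ := fun ω => postMean k σ (fun i : Fin m => ((ξ i fun j => y j ω : D) : Vec d))
        (fun i => y i ω) (ζ fun i => y i ω) with hM
  set S : Ω → ℝ := fun ω => postStd k σ (fun i : Fin m => ((ξ i fun j => y j ω : D) : Vec d))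
        (ζ fun i => y i ω) with hS
  have hS0 : ∀ ω, 0 ≤ S ω := fun ω => Real.sqrt_nonneg _
  have side : ∀ c' : ℝ, c' ^ 2 = c ^ 2 →
      P {ω | c ^ 2 * (S ω + e) ≤ c' * (U (ζ fun i => y i ω) ω - M ω)} ≤
        ENNReal.ofReal (Real.exp (-(c ^ 2 / 2))) := by
    intro c' hc'
    -- The exponent of Chernoff's bound; the margin `e` keeps it finite where `S` vanishes.
    obtain ⟨F, hF, hFe, h1⟩ := H.lintegral_exp_error hσ hU hUu hk m hζ
      (θ := fun z => c' / (postStd k σ (fun i => ((decisions ξ z i : D) : Vec d)) (ζ z) + e))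
      ((hs.add_const e).const_div c')
    have hmk := mul_meas_ge_le_lintegral (μ := P) (hF.comp (H.measurable m))
      (ENNReal.ofReal (Real.exp (c ^ 2 / 2)))
    simp only [Function.comp_apply] at hmk
    rw [h1] at hmk
    have hsub : {ω | c ^ 2 * (S ω + e) ≤ c' * (U (ζ fun i => y i ω) ω - M ω)} ⊆
        {ω | ENNReal.ofReal (Real.exp (c ^ 2 / 2)) ≤ F (π ω, fun i => y i ω)} := by
      intro ω hω
      simp only [Set.mem_ofPred_eq] at hω ⊢
      rw [hFe, ← hUu]
      refine ENNReal.ofReal_le_ofReal (Real.exp_le_exp.2 ?_)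
      change c ^ 2 / 2 ≤ c' / (S ω + e) * (U (ζ fun i => y i ω) ω - M ω) -
        (c' / (S ω + e)) ^ 2 * postCov k σ (fun i : Fin m => ((ξ i fun j => y j ω : D) : Vec d))
          (ζ fun i => y i ω) (ζ fun i => y i ω) / 2
      have hsq : postCov k σ (fun i : Fin m => ((ξ i fun j => y j ω : D) : Vec d))
          (ζ fun i => y i ω) (ζ fun i => y i ω) = S ω ^ 2 :=
        (Real.sq_sqrt (postCov_nonneg hK hσ _ _)).symm
      have hpos : 0 < S ω + e := by linarith [hS0 ω]
      have a1 : c ^ 2 ≤ c' / (S ω + e) * (U (ζ fun i => y i ω) ω - M ω) := by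
        rw [div_mul_eq_mul_div, le_div_iff₀ hpos]
        exact hω
      have a2 : (c' / (S ω + e)) ^ 2 * S ω ^ 2 ≤ c ^ 2 := by
        rw [div_pow, hc', div_mul_eq_mul_div, div_le_iff₀ (by positivity)]
        exact mul_le_mul_of_nonneg_left (pow_le_pow_left₀ (hS0 ω) (by linarith) 2) (sq_nonneg c)
      rw [hsq]
      linarith
    have h2 := (mul_le_mul_right (measure_mono (μ := P) hsub)
      (ENNReal.ofReal (Real.exp (c ^ 2 / 2)))).trans hmk
    rw [Real.exp_neg, ENNReal.ofReal_inv_of_pos (Real.exp_pos _)]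
    rw [ENNReal.le_inv_iff_mul_le, mul_comm]
    exact h2
  have hcover : {ω | c * (S ω + e) < |U (ζ fun i => y i ω) ω - M ω|} ⊆
      {ω | c ^ 2 * (S ω + e) ≤ c * (U (ζ fun i => y i ω) ω - M ω)} ∪
      {ω | c ^ 2 * (S ω + e) ≤ -c * (U (ζ fun i => y i ω) ω - M ω)} := by
    intro ω hω
    simp only [Set.mem_ofPred_eq, Set.mem_union] at hω ⊢
    rcases abs_cases (U (ζ fun i => y i ω) ω - M ω) with ⟨h, -⟩ | ⟨h, -⟩
    · left
      rw [sq, mul_assoc]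
      exact mul_le_mul_of_nonneg_left (by linarith) hc
    · right
      rw [sq, mul_assoc, neg_mul, ← mul_neg]
      exact mul_le_mul_of_nonneg_left (by linarith) hc
  calc _ ≤ _ := measure_mono hcover
    _ ≤ _ := measure_union_le _ _
    _ ≤ _ := add_le_add (side c rfl) (side (-c) (neg_sq c))
    _ = _ := (two_mul _).symm

/-! ### Regularity of the unknown function and of the kernel -/

theorem norm_le_sqrt_mul_of_abs_le {d : ℕ} {v : Vec d} {M : ℝ} (hM : 0 ≤ M)
    (hv : ∀ j, |v j| ≤ M) : ‖v‖ ≤ Real.sqrt d * M := by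
  rw [EuclideanSpace.norm_eq]
  refine Real.sqrt_le_iff.2 ⟨by positivity, ?_⟩
  rw [mul_pow, Real.sq_sqrt (Nat.cast_nonneg d)]
  calc ∑ j, ‖v j‖ ^ 2 ≤ ∑ _j : Fin d, M ^ 2 :=
        Finset.sum_le_sum fun j _ => pow_le_pow_left₀ (norm_nonneg _) (hv j) 2
    _ = d * M ^ 2 := by simp

theorem abs_sub_le_of_norm_gradient_le {d : ℕ} {D : Set (Vec d)} (hD : Convex ℝ D)
    {f : Vec d → ℝ} (hf : ∀ x ∈ D, DifferentiableAt ℝ f x) {C : ℝ}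
    (hC : ∀ x ∈ D, ‖gradient f x‖ ≤ C) {x y : Vec d} (hx : x ∈ D) (hy : y ∈ D) :
    |f x - f y| ≤ C * ‖x - y‖ := by
  refine hD.norm_image_sub_le_of_norm_hasFDerivWithin_le (f' := fun z => fderiv ℝ f z)
    (fun z hz => (hf z hz).hasFDerivAt.hasFDerivWithinAt) (fun z hz => ?_) hy hx
  have := hC z hz
  rwa [gradient, LinearIsometryEquiv.norm_map] at this

/-- The tail bounds on the partial derivatives make `U` Lipschitz off a small event. -/
theorem measure_not_lipschitz_le {d : ℕ} {Ω : Type*} [MeasurableSpace Ω] {P : Measure Ω}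
    {D : Set (Vec d)} (hD : Convex ℝ D) {U : Vec d → Ω → ℝ}
    (hUdiff : ∀ ω, ∀ x ∈ D, DifferentiableAt ℝ (fun z => U z ω) x) {a b : ℝ}
    (hUtail : ∀ j : Fin d, ∀ M : ℝ, 0 < M →
      P {ω | ∃ x ∈ D, M < |gradient (fun z => U z ω) x j|} ≤
        ENNReal.ofReal (a * Real.exp (-(M / b) ^ 2))) {M : ℝ} (hM : 0 < M) :
    P {ω | ¬ ∀ x ∈ D, ∀ y ∈ D, |U x ω - U y ω| ≤ Real.sqrt d * M * ‖x - y‖} ≤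
      d * ENNReal.ofReal (a * Real.exp (-(M / b) ^ 2)) := by
  calc P {ω | ¬ ∀ x ∈ D, ∀ y ∈ D, |U x ω - U y ω| ≤ Real.sqrt d * M * ‖x - y‖}
      ≤ P (⋃ j : Fin d, {ω | ∃ x ∈ D, M < |gradient (fun z => U z ω) x j|}) := by
        refine measure_mono fun ω hω => ?_
        simp only [Set.mem_iUnion, Set.mem_ofPred_eq]
        by_contra! hcon
        exact hω fun x hx y hy => abs_sub_le_of_norm_gradient_le hD (hUdiff ω)
          (fun z hz => norm_le_sqrt_mul_of_abs_le hM.le fun j => hcon j z hz) hx hy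
    _ ≤ ∑ j : Fin d, P {ω | ∃ x ∈ D, M < |gradient (fun z => U z ω) x j|} :=
        measure_iUnion_fintype_le _ _
    _ ≤ ∑ _j : Fin d, ENNReal.ofReal (a * Real.exp (-(M / b) ^ 2)) :=
        Finset.sum_le_sum fun j _ => hUtail j M hM
    _ = _ := by simp

/-- `U` is Lipschitz on `D`, with a constant that does not depend on `ω`, off an event of arbitrarily
small probability. -/
theorem exists_lipschitz_event {d : ℕ} {Ω : Type*} [MeasurableSpace Ω] {P : Measure Ω}
    {D : Set (Vec d)} (hD : Convex ℝ D) {U : Vec d → Ω → ℝ}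
    (hUdiff : ∀ ω, ∀ x ∈ D, DifferentiableAt ℝ (fun z => U z ω) x) {a b : ℝ} (hb : 0 < b)
    (hUtail : ∀ j : Fin d, ∀ M : ℝ, 0 < M →
      P {ω | ∃ x ∈ D, M < |gradient (fun z => U z ω) x j|} ≤
        ENNReal.ofReal (a * Real.exp (-(M / b) ^ 2))) {η : ℝ} (hη : 0 < η) :
    ∃ C : ℝ, 0 ≤ C ∧ P {ω | ¬ ∀ x ∈ D, ∀ y ∈ D, |U x ω - U y ω| ≤ C * ‖x - y‖} ≤
      ENNReal.ofReal η := by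
  have hlim : Filter.Tendsto (fun M : ℝ => d * (a * Real.exp (-(M / b) ^ 2))) Filter.atTop
      (nhds (d * (a * 0))) := by
    refine Filter.Tendsto.const_mul _ (Filter.Tendsto.const_mul _ ?_)
    refine Real.tendsto_exp_neg_atTop_nhds_zero.comp ?_
    exact (Filter.tendsto_pow_atTop two_ne_zero).comp (Filter.tendsto_id.atTop_div_const hb)
  simp only [mul_zero] at hlim
  obtain ⟨M, hM, hM0⟩ := ((hlim.eventually (gt_mem_nhds hη)).and
    (Filter.eventually_gt_atTop 0)).exists
  refine ⟨Real.sqrt d * M, by positivity,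
    (measure_not_lipschitz_le hD hUdiff hUtail hM0).trans ?_⟩
  rw [← ENNReal.ofReal_natCast, ← ENNReal.ofReal_mul (Nat.cast_nonneg d)]
  exact ENNReal.ofReal_le_ofReal hM.le

/-- A centred Gaussian variable that is small with probability at least `3 / 4` has a small
variance, as its characteristic function shows. -/
theorem variance_le_of_measure_le {Ω : Type*} [MeasurableSpace Ω] {P : Measure Ω}
    [IsProbabilityMeasure P] {Z : Ω → ℝ} (hZ : Measurable Z) {v : NNReal}
    (hlaw : P.map Z = gaussianReal 0 v) {τ : ℝ} (hτ : 0 < τ)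
    (h : P {ω | τ < |Z ω|} ≤ ENNReal.ofReal (1 / 4)) : (v : ℝ) ≤ 6 * τ ^ 2 := by
  have h1 : ∫ ω, Real.cos (Z ω / τ) ∂P = Real.exp (-(v / (2 * τ ^ 2))) := by
    have hc := charFun_gaussianReal (μ := 0) (v := v) (1 / τ)
    rw [← hlaw, charFun_apply_real, integral_map hZ.aemeasurable (by fun_prop)] at hc
    have hre := congrArg Complex.re hc
    have e1 : (∫ ω, Complex.exp (↑(1 / τ) * ↑(Z ω) * Complex.I) ∂P).re =
        ∫ ω, Real.cos (Z ω / τ) ∂P := by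
      have hint : Integrable (fun ω => Complex.exp (↑(1 / τ) * ↑(Z ω) * Complex.I)) P := by
        refine Integrable.of_bound (by fun_prop) 1 (.of_forall fun ω => ?_)
        rw [← Complex.ofReal_mul, Complex.norm_exp_ofReal_mul_I]
      have := integral_re hint
      simp only [RCLike.re_to_complex] at this
      rw [← this]
      refine integral_congr_ae (.of_forall fun ω => ?_)
      simp only
      rw [← Complex.ofReal_mul, Complex.exp_ofReal_mul_I_re]
      congr 1
      ring
    rw [e1] at hre
    rw [hre, ← Complex.exp_ofReal_re]
    congr 2
    push_cast
    ring
  have hms : MeasurableSet {ω | τ < |Z ω|} := measurableSet_lt measurable_const hZ.abs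
  have h2 : (1 : ℝ) / 8 ≤ ∫ ω, Real.cos (Z ω / τ) ∂P := by
    have hlow : ∀ ω, 1 / 2 - 3 / 2 * Set.indicator {ω | τ < |Z ω|} (fun _ => (1 : ℝ)) ω ≤
        Real.cos (Z ω / τ) := by
      intro ω
      by_cases hω : τ < |Z ω|
      · rw [Set.indicator_of_mem (by exact hω)]
        linarith [Real.neg_one_le_cos (Z ω / τ)]
      · rw [Set.indicator_of_notMem (by exact hω)]
        have := Real.one_sub_sq_div_two_le_cos (x := Z ω / τ)
        have : (Z ω / τ) ^ 2 ≤ 1 := by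
          rw [div_pow, div_le_one (by positivity)]
          exact sq_le_sq' (by linarith [neg_abs_le (Z ω)]) (by linarith [le_abs_self (Z ω)])
        linarith
    have hint : Integrable (fun ω => 1 / 2 - 3 / 2 *
        Set.indicator {ω | τ < |Z ω|} (fun _ => (1 : ℝ)) ω) P :=
      (integrable_const _).sub (((integrable_const _).indicator hms).const_mul _)
    have hP : P.real {ω | τ < |Z ω|} ≤ 1 / 4 := by
      rw [measureReal_def]
      exact ENNReal.toReal_le_of_le_ofReal (by norm_num) h
    calc (1 : ℝ) / 8 ≤ 1 / 2 - 3 / 2 * P.real {ω | τ < |Z ω|} := by linarith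
      _ = ∫ ω, (1 / 2 - 3 / 2 * Set.indicator {ω | τ < |Z ω|} (fun _ => (1 : ℝ)) ω) ∂P := by
          rw [integral_sub (integrable_const _) (((integrable_const _).indicator hms).const_mul _),
            integral_const_mul, integral_indicator hms]
          simp
      _ ≤ _ := integral_mono hint (Integrable.of_bound (by fun_prop) 1
          (.of_forall fun ω => Real.abs_cos_le_one _)) hlow
  rw [h1] at h2
  by_contra! hv
  have h3 : 3 < (v : ℝ) / (2 * τ ^ 2) := by
    rw [lt_div_iff₀ (by positivity)]
    linarith
  have h4 : Real.exp (-((v : ℝ) / (2 * τ ^ 2))) < Real.exp (-3) := Real.exp_lt_exp.2 (by linarith)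
  have h5 : Real.exp (-3) ≤ 1 / 8 := by
    have : (2 : ℝ) ≤ Real.exp 1 := by linarith [Real.add_one_le_exp (1 : ℝ)]
    have h8 : (8 : ℝ) ≤ Real.exp 3 := by
      have : Real.exp 3 = Real.exp 1 ^ 3 := by rw [← Real.exp_nat_mul]; norm_num
      rw [this]
      calc (8 : ℝ) = 2 ^ 3 := by norm_num
        _ ≤ _ := by gcongr
    rw [Real.exp_neg, ← one_div]
    exact one_div_le_one_div_of_le (by norm_num) h8
  linarith

/-- A process with Lipschitz paths has a Lipschitz kernel. -/
theorem exists_kernel_lipschitz {d : ℕ} {Ω : Type*} [MeasurableSpace Ω] {P : Measure Ω}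
    [IsProbabilityMeasure P] {D : Set (Vec d)} (hD : Convex ℝ D) {U : Vec d → Ω → ℝ}
    {k : Vec d → Vec d → ℝ} (hU : IsCentredGP P U k)
    (hUdiff : ∀ ω, ∀ x ∈ D, DifferentiableAt ℝ (fun z => U z ω) x) {a b : ℝ} (hb : 0 < b)
    (hUtail : ∀ j : Fin d, ∀ M : ℝ, 0 < M →
      P {ω | ∃ x ∈ D, M < |gradient (fun z => U z ω) x j|} ≤
        ENNReal.ofReal (a * Real.exp (-(M / b) ^ 2))) :
    ∃ C : ℝ, 0 ≤ C ∧ ∀ x ∈ D, ∀ y ∈ D,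
      k x x - 2 * k y x + k y y ≤ C ^ 2 * ‖x - y‖ ^ 2 := by
  have hk := hU.isPosSemidefKernel
  obtain ⟨C, hC, hP⟩ := exists_lipschitz_event hD hUdiff hb hUtail (η := 1 / 4) (by norm_num)
  refine ⟨3 * (C + 1), by positivity, fun x hx y hy => ?_⟩
  by_cases hxy : x = y
  · subst hxy
    simp
    linarith
  have hn : 0 < ‖x - y‖ := norm_pos_iff.2 (sub_ne_zero.2 hxy)
  have hZ : Measurable (U x - U y) := (hU.measurable x).sub (hU.measurable y)
  have hlaw := (hU.gaussian.hasGaussianLaw_sub (s := x) (t := y)).map_eq_gaussianReal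
  have hmean : ∫ ω, (U x - U y) ω ∂P = 0 := by
    simp only [Pi.sub_apply]
    rw [integral_sub ((hU.memLp x).integrable one_le_two) ((hU.memLp y).integrable one_le_two),
      hU.mean, hU.mean, sub_zero]
  rw [hmean] at hlaw
  have hvar : Var[U x - U y; P] = k x x - 2 * k y x + k y y := by
    rw [← covariance_self hZ.aemeasurable, covariance_sub_sub (hU.memLp x) (hU.memLp y)
      (hU.memLp x) (hU.memLp y), hU.cov, hU.cov, hU.cov, hU.cov, hk.symm x y]
    ring
  have h := variance_le_of_measure_le hZ hlaw (τ := (C + 1) * ‖x - y‖) (by positivity) (by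
    refine (measure_mono fun ω hω => ?_).trans hP
    simp only [Set.mem_ofPred_eq, Pi.sub_apply] at hω ⊢
    intro hcon
    nlinarith [hcon x hx y hy])
  rw [Real.coe_toNNReal _ (variance_nonneg _ _), hvar] at h
  nlinarith [sq_nonneg ((C + 1) * ‖x - y‖)]

/-- The kernel is Lipschitz in each argument, by the Cauchy–Schwarz inequality for `k`. -/
theorem abs_kernel_sub_le {d : ℕ} {D : Set (Vec d)} {k : Vec d → Vec d → ℝ}
    (hk : IsPosSemidefKernel k) (hk1 : ∀ x ∈ D, k x x ≤ 1) {C : ℝ} (hC : 0 ≤ C)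
    (hlip : ∀ x ∈ D, ∀ y ∈ D, k x x - 2 * k y x + k y y ≤ C ^ 2 * ‖x - y‖ ^ 2)
    {z x y : Vec d} (hz : z ∈ D) (hx : x ∈ D) (hy : y ∈ D) :
    |k z x - k z y| ≤ C * ‖x - y‖ := by
  set s := k z x - k z y with hs
  -- in terms of the process, `E (U x - U y - s U z)² ≥ 0` with `s = E (U x - U y) U z`
  have h := hk.quad_nonneg ![z, x, y] ![-s, 1, -1]
  simp [dotProduct, Matrix.mulVec, gram, Fin.sum_univ_three, hk.symm x z, hk.symm y z,
    hk.symm x y] at h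
  have h1 := hlip x hx y hy
  have h2 : s ^ 2 * k z z ≤ s ^ 2 * 1 := mul_le_mul_of_nonneg_left (hk1 z hz) (sq_nonneg s)
  refine abs_le_of_sq_le_sq ?_ (by positivity)
  nlinarith

theorem continuous_kernel {d : ℕ} {D : Set (Vec d)} {k : Vec d → Vec d → ℝ}
    (hk : IsPosSemidefKernel k) (hk1 : ∀ x ∈ D, k x x ≤ 1) {C : ℝ} (hC : 0 ≤ C)
    (hlip : ∀ x ∈ D, ∀ y ∈ D, k x x - 2 * k y x + k y y ≤ C ^ 2 * ‖x - y‖ ^ 2) :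
    Continuous fun q : D × D => k q.1 q.2 := by
  refine (LipschitzWith.of_dist_le_mul (K := Real.toNNReal (2 * C)) fun p q => ?_).continuous
  rw [Real.coe_toNNReal _ (by positivity), Real.dist_eq]
  have h1 : ‖(p.1 : Vec d) - q.1‖ ≤ dist p q := by
    rw [← dist_eq_norm]; exact le_max_left (dist p.1 q.1) (dist p.2 q.2)
  have h2 : ‖(p.2 : Vec d) - q.2‖ ≤ dist p q := by
    rw [← dist_eq_norm]; exact le_max_right (dist p.1 q.1) (dist p.2 q.2)
  have h3 := abs_kernel_sub_le hk hk1 hC hlip p.1.2 p.2.2 q.2.2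
  have h4 := abs_kernel_sub_le hk hk1 hC hlip q.2.2 p.1.2 q.1.2
  rw [hk.symm _ (p.1 : Vec d), hk.symm _ (q.1 : Vec d)] at h4
  calc |k p.1 p.2 - k q.1 q.2|
      ≤ |k p.1 p.2 - k p.1 q.2| + |k p.1 q.2 - k q.1 q.2| := abs_sub_le _ _ _
    _ ≤ C * dist p q + C * dist p q := by
        gcongr
        · exact h3.trans (mul_le_mul_of_nonneg_left h2 hC)
        · exact h4.trans (mul_le_mul_of_nonneg_left h1 hC)
    _ = _ := by ring

/-! ### The feedback of the algorithm -/

/-- If `A` is independent of `(B, C)` and `B` of `C`, then `(A, B)` is independent of `C`. -/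
theorem indepFun_prodMk_left {Ω α β γ : Type*} [MeasurableSpace Ω] [MeasurableSpace α]
    [MeasurableSpace β] [MeasurableSpace γ] {P : Measure Ω} [IsProbabilityMeasure P]
    {A : Ω → α} {B : Ω → β} {C : Ω → γ} (hA : Measurable A) (hB : Measurable B)
    (hC : Measurable C) (h : IndepFun A (fun ω => (B ω, C ω)) P) (h' : IndepFun B C P) :
    IndepFun (fun ω => (A ω, B ω)) C P := by
  have hAB : IndepFun A B P := h.comp (φ := id) (ψ := Prod.fst) measurable_id measurable_fst
  rw [indepFun_iff_map_prod_eq_prod_map_map (by fun_prop) (by fun_prop)] at h h' hAB ⊢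
  have := Measure.isProbabilityMeasure_map (μ := P) hA.aemeasurable
  have := Measure.isProbabilityMeasure_map (μ := P) hB.aemeasurable
  have := Measure.isProbabilityMeasure_map (μ := P) hC.aemeasurable
  rw [h', ← Measure.prodAssoc_prod] at h
  have h2 := congrArg (Measure.map MeasurableEquiv.prodAssoc.symm) h
  rw [MeasurableEquiv.map_symm_map, Measure.map_map (by fun_prop) (by fun_prop)] at h2
  rw [hAB]
  exact h2

/-- The sample space carrying only the σ-algebra generated by the process `U`: it records the path
of `U` and nothing of the noise. -/
def PathSpace {d : ℕ} {Ω : Type*} (_U : Vec d → Ω → ℝ) : Type _ := Ω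

instance {d : ℕ} {Ω : Type*} (U : Vec d → Ω → ℝ) : MeasurableSpace (PathSpace U) :=
  MeasurableSpace.comap (fun (ω : Ω) x => U x ω) inferInstance

/-- The path of `U` as a random element. -/
def toPath {d : ℕ} {Ω : Type*} (U : Vec d → Ω → ℝ) (ω : Ω) : PathSpace U := ω

/-- Evaluation of a path at a point of `D`. -/
def evalPath {d : ℕ} {Ω : Type*} (D : Set (Vec d)) (U : Vec d → Ω → ℝ) (x : D)
    (ω : PathSpace U) : ℝ := U x ω

theorem measurable_toPath {d : ℕ} {Ω : Type*} [MeasurableSpace Ω] {U : Vec d → Ω → ℝ}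
    (hUm : ∀ x, Measurable (U x)) : Measurable (toPath U) := by
  rintro _ ⟨s, hs, rfl⟩
  exact (measurable_pi_lambda (fun (ω : Ω) x => U x ω) hUm) hs

theorem measurable_evalPath {d : ℕ} {Ω : Type*} (D : Set (Vec d)) (U : Vec d → Ω → ℝ) (x : D) :
    Measurable (evalPath D U x) :=
  (measurable_pi_apply (x : Vec d)).comp
    (comap_measurable (fun (ω : Ω) (x : Vec d) => U x ω))

theorem IsNoise.indepFun_toPath {d : ℕ} {Ω : Type*} [MeasurableSpace Ω] {P : Measure Ω}
    {U : Vec d → Ω → ℝ} {σ : ℝ} {ε : ℕ → Ω → ℝ} (hε : IsNoise P U ε σ) :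
    IndepFun (toPath U) (fun ω i => ε i ω) P := by
  have h := hε.indep_process
  rw [IndepFun_iff_Indep] at h ⊢
  have e : MeasurableSpace.comap (toPath U) inferInstance =
      MeasurableSpace.comap (fun (ω : Ω) (x : Vec d) => U x ω) inferInstance :=
    MeasurableSpace.comap_comp
  rw [e]
  exact h

/-- By the Doob–Dynkin lemma the decisions are functions of the feedback received, so that the
algorithm is an instance of adaptive observation. -/
theorem exists_isAdaptiveFeedback {d : ℕ} {Ω : Type*} [MeasurableSpace Ω] {P : Measure Ω}
    [IsProbabilityMeasure P] {D : Set (Vec d)} (hD : IsCompact D) (hne : D.Nonempty)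
    {U : Vec d → Ω → ℝ} (hUm : ∀ x, Measurable (U x))
    (hUc : ∀ ω, Continuous fun x : D => U x ω) {σ : ℝ}
    {ε : ℕ → Ω → ℝ} (hε : IsNoise P U ε σ) {X : ℕ → Ω → Vec d} (hXD : ∀ n ω, X n ω ∈ D)
    (hXmeas : ∀ n, Measurable[pastFeedback U ε X n] (X n)) :
    ∃ ξ : ∀ m : ℕ, (Fin m → ℝ) → D,
      IsAdaptiveFeedback P (toPath U) (evalPath D U) (fun i => ε (i + 1))
        (fun i => feedback U ε X (i + 1)) ξ σ ∧
      ∀ m ω, X (m + 1) ω = ξ m fun i => feedback U ε X (i + 1) ω := by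
  have hrule : ∀ m, ∃ g : (Fin m → ℝ) → D, Measurable g ∧
      (fun ω => (⟨X (m + 1) ω, hXD _ ω⟩ : D)) =
        g ∘ fun ω => fun i : Fin m => feedback U ε X (i + 1) ω := by
    intro m
    have : Nonempty D := hne.to_subtype
    have : StandardBorelSpace D := hD.isClosed.measurableSet.standardBorel
    refine Measurable.exists_eq_measurable_comp (Measurable.subtype_mk ?_)
    refine (hXmeas (m + 1)).mono (iSup₂_le fun i hi => ?_) le_rfl
    rw [Nat.add_sub_cancel, Finset.mem_Icc] at hi
    have e : feedback U ε X i = (fun z : Fin m → ℝ => z ⟨i - 1, by omega⟩) ∘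
        fun ω => fun i : Fin m => feedback U ε X (i + 1) ω := by
      funext ω
      simp [Nat.sub_add_cancel hi.1]
    rw [e, ← MeasurableSpace.comap_comp]
    exact MeasurableSpace.comap_mono (measurable_pi_apply _).comap_le
  choose ξ hξ hξX using hrule
  have hXξ : ∀ m ω, X (m + 1) ω = ξ m fun i => feedback U ε X (i + 1) ω := fun m ω =>
    congrArg Subtype.val (congrFun (hξX m) ω)
  refine ⟨ξ, ⟨measurable_toPath hUm, ?_, fun i => hε.measurable _, hξ, ?_, fun i => hε.law _, ?_⟩,
    hXξ⟩
  · exact measurable_uncurry_of_continuous_of_measurable (u := evalPath D U) hUc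
      fun x => measurable_evalPath D U x
  · intro i ω
    simp only [feedback, evalPath, toPath]
    rw [hXξ i ω]
    rfl
  · intro m
    have h1 : IndepFun (toPath U)
        (fun ω => ((fun i : Fin m => ε (i + 1) ω), ε (m + 1) ω)) P :=
      hε.indepFun_toPath.comp (φ := id)
        (ψ := fun z : ℕ → ℝ => ((fun i : Fin m => z (i + 1)), z (m + 1)))
        measurable_id (by fun_prop)
    have h2 : IndepFun (fun ω => fun i : Fin m => ε (i + 1) ω) (ε (m + 1)) P := by
      have := hε.indep.indepFun_finset (Finset.Icc 1 m) {m + 1} (by simp) hε.measurable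
      exact this.comp 
        (φ := fun (z : Finset.Icc 1 m → ℝ) (i : Fin m) => z ⟨i + 1, by simp⟩)
        (ψ := fun z : ({m + 1} : Finset ℕ) → ℝ => z ⟨m + 1, by simp⟩)
        (measurable_pi_lambda _ fun i => measurable_pi_apply _) (measurable_pi_apply _)
    exact indepFun_prodMk_left (measurable_toPath hUm)
      (measurable_pi_lambda _ fun i => hε.measurable _) (hε.measurable _) h1 h2

theorem IsNoise.measure_abs_gt_le {d : ℕ} {Ω : Type*} [MeasurableSpace Ω] {P : Measure Ω}
    [IsProbabilityMeasure P] {U : Vec d → Ω → ℝ} {σ : ℝ} {ε : ℕ → Ω → ℝ}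
    (hε : IsNoise P U ε σ) (n : ℕ) {c : ℝ} (hc : 0 ≤ c) :
    P {ω | c < |ε n ω|} ≤ ENNReal.ofReal (2 * Real.exp (-(c ^ 2 / (2 * σ ^ 2)))) := by
  have hv : ((Real.toNNReal (σ ^ 2) : NNReal) : ℝ) = σ ^ 2 := Real.coe_toNNReal _ (sq_nonneg σ)
  have hlaw := hε.law n
  have hsub : HasSubgaussianMGF (ε n) (Real.toNNReal (σ ^ 2)) P := by
    refine ⟨fun t => ?_, fun t => ?_⟩
    · have := integrable_exp_mul_gaussianReal (μ := 0) (v := Real.toNNReal (σ ^ 2)) t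
      rw [← hlaw] at this
      exact this.comp_measurable (hε.measurable n)
    · rw [mgf_gaussianReal hlaw]
      simp
  have hside : ∀ Z : Ω → ℝ, HasSubgaussianMGF Z (Real.toNNReal (σ ^ 2)) P →
      P {ω | c ≤ Z ω} ≤ ENNReal.ofReal (Real.exp (-(c ^ 2 / (2 * σ ^ 2)))) := by
    intro Z hZ
    have h := hZ.measure_ge_le hc
    rw [hv, neg_div] at h
    rw [← ofReal_measureReal (measure_ne_top _ _)]
    exact ENNReal.ofReal_le_ofReal h
  calc P {ω | c < |ε n ω|} ≤ P ({ω | c ≤ ε n ω} ∪ {ω | c ≤ (-ε n) ω}) := by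
        refine measure_mono fun ω hω => ?_
        rcases lt_abs.1 (show c < |ε n ω| from hω) with h | h
        · exact Or.inl h.le
        · exact Or.inr h.le
    _ ≤ _ := measure_union_le _ _
    _ ≤ _ := add_le_add (hside _ hsub) (hside _ hsub.neg)
    _ = _ := by
        rw [← ENNReal.ofReal_add (Real.exp_nonneg _) (Real.exp_nonneg _), ← two_mul]

/-! ### The confidence parameter -/

theorem one_le_dim_of_lt {d : ℕ} {a δ : ℝ} (hδ0 : 0 < δ) (hδa : δ < 2 * d * a) : 1 ≤ d := by
  rcases Nat.eq_zero_or_pos d with rfl | h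
  · simp at hδa
    linarith
  · exact h

/-- `β_n` is affine in `log n`. -/
theorem exists_beta_eq {d : ℕ} {a b r δ : ℝ} (hδ0 : 0 < δ) (hδa : δ < 2 * d * a) (hb : 0 < b)
    (hr : 0 < r) :
    ∃ A : ℝ, ∀ n : ℕ, 1 ≤ n → beta d a b r δ n = A + (4 + 4 * d) * Real.log n := by
  have hd : (0 : ℝ) < d := by exact_mod_cast one_le_dim_of_lt hδ0 hδa
  have hlog : 0 < Real.log (4 * d * a / δ) := Real.log_pos (by
    rw [lt_div_iff₀ hδ0]
    linarith)
  refine ⟨2 * Real.log (2 * Real.pi ^ 2 / (3 * δ)) +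
    2 * d * Real.log (d * b * r * Real.sqrt (Real.log (4 * d * a / δ))), fun n hn => ?_⟩
  have hn0 : (0 : ℝ) < n := by exact_mod_cast hn
  have hpi := Real.pi_pos
  have e1 : 2 * (n : ℝ) ^ 2 * Real.pi ^ 2 / (3 * δ) = n ^ 2 * (2 * Real.pi ^ 2 / (3 * δ)) := by ring
  have e2 : d * (n : ℝ) ^ 2 * b * r * Real.sqrt (Real.log (4 * d * a / δ)) =
      n ^ 2 * (d * b * r * Real.sqrt (Real.log (4 * d * a / δ))) := by ring
  rw [beta, e1, e2, Real.log_mul (by positivity) (by positivity),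
    Real.log_mul (by positivity) (by positivity), Real.log_pow]
  push_cast
  ring

theorem beta_mono {d : ℕ} {a b r δ : ℝ} (hδ0 : 0 < δ) (hδa : δ < 2 * d * a) (hb : 0 < b)
    (hr : 0 < r) {m n : ℕ} (hm : 1 ≤ m) (hmn : m ≤ n) :
    beta d a b r δ m ≤ beta d a b r δ n := by
  obtain ⟨A, hA⟩ := exists_beta_eq hδ0 hδa hb hr
  rw [hA m hm, hA n (hm.trans hmn)]
  have : Real.log m ≤ Real.log n :=
    Real.log_le_log (by exact_mod_cast hm) (by exact_mod_cast hmn)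
  gcongr

theorem eventually_one_add_log_le_beta {d : ℕ} {a b r δ : ℝ} (hδ0 : 0 < δ) (hδa : δ < 2 * d * a)
    (hb : 0 < b) (hr : 0 < r) :
    ∀ᶠ n : ℕ in Filter.atTop, 1 + Real.log n ≤ beta d a b r δ n := by
  obtain ⟨A, hA⟩ := exists_beta_eq hδ0 hδa hb hr
  have hlog : Filter.Tendsto (fun n : ℕ => Real.log n) Filter.atTop Filter.atTop :=
    Real.tendsto_log_atTop.comp tendsto_natCast_atTop_atTop
  filter_upwards [Filter.eventually_ge_atTop 1, hlog.eventually_ge_atTop (1 - A),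
    hlog.eventually_ge_atTop 0] with n hn h1 h2
  rw [hA n hn]
  have : 0 ≤ (d : ℝ) * Real.log n := by positivity
  nlinarith

theorem exists_sqrt_beta_le {d : ℕ} {a b r δ : ℝ} (hδ0 : 0 < δ) (hδa : δ < 2 * d * a)
    (hb : 0 < b) (hr : 0 < r) :
    ∃ C : ℝ, 0 ≤ C ∧ ∀ n : ℕ, 1 ≤ n → Real.sqrt (beta d a b r δ n) ≤ C * (1 + Real.log n) := by
  obtain ⟨A, hA⟩ := exists_beta_eq hδ0 hδa hb hr
  refine ⟨1 + |A| + (4 + 4 * d), by positivity, fun n hn => ?_⟩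
  have hlog : 0 ≤ Real.log n := Real.log_natCast_nonneg n
  rw [hA n hn]
  refine Real.sqrt_le_iff.2 ⟨by positivity, ?_⟩
  have h1 : A + (4 + 4 * d) * Real.log n ≤ (1 + |A| + (4 + 4 * d)) * (1 + Real.log n) := by
    have := le_abs_self A
    have : 0 ≤ |A| * Real.log n := by positivity
    nlinarith
  have h2 : 1 ≤ (1 + |A| + (4 + 4 * d)) * (1 + Real.log n) := by
    have : 0 ≤ |A| * Real.log n := by positivity
    have : 0 ≤ |A| := abs_nonneg A
    have : (0 : ℝ) ≤ (d : ℝ) * Real.log n := by positivity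
    nlinarith
  nlinarith

/-- The confidence level of `n` is summable even against nets of cardinality `O(n^d)`. -/
theorem exists_card_mul_exp_beta_le {d : ℕ} {a b r δ : ℝ} (hδ0 : 0 < δ) (hδa : δ < 2 * d * a)
    (hb : 0 < b) (hr : 0 < r) :
    ∃ K : ℝ, 0 ≤ K ∧ ∀ n : ℕ, 1 ≤ n →
      ((r * n + 1) ^ d + 1) * (2 * Real.exp (-(beta d a b r δ n / 2))) ≤ K / (n : ℝ) ^ 2 := by
  obtain ⟨A, hA⟩ := exists_beta_eq hδ0 hδa hb hr
  refine ⟨((r + 1) ^ d + 1) * (2 * Real.exp (-A / 2)), by positivity, fun n hn => ?_⟩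
  have hn0 : (0 : ℝ) < n := by exact_mod_cast hn
  have hn1 : (1 : ℝ) ≤ n := by exact_mod_cast hn
  have e : Real.exp (-(beta d a b r δ n / 2)) =
      Real.exp (-A / 2) / ((n : ℝ) ^ 2 * ((n : ℝ) ^ d * (n : ℝ) ^ d)) := by
    have : -(beta d a b r δ n / 2) = -A / 2 - (2 + d + d : ℕ) * Real.log n := by
      rw [hA n hn]
      push_cast
      ring
    rw [this, Real.exp_sub, Real.exp_nat_mul, Real.exp_log hn0, pow_add, pow_add, mul_assoc]
  have hnd : (1 : ℝ) ≤ (n : ℝ) ^ d := one_le_pow₀ hn1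
  have h1 : (r * n + 1) ^ d + 1 ≤ ((r + 1) ^ d + 1) * (n : ℝ) ^ d := by
    have : (r * n + 1) ^ d ≤ ((r + 1) * n) ^ d :=
      pow_le_pow_left₀ (by positivity) (by nlinarith) d
    rw [mul_pow] at this
    linarith
  calc ((r * n + 1) ^ d + 1) * (2 * Real.exp (-(beta d a b r δ n / 2)))
      ≤ (((r + 1) ^ d + 1) * (n : ℝ) ^ d) * (2 * Real.exp (-(beta d a b r δ n / 2))) := by gcongr
    _ = ((r + 1) ^ d + 1) * (2 * Real.exp (-A / 2)) / ((n : ℝ) ^ 2 * (n : ℝ) ^ d) := by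
        rw [e]
        field_simp
    _ ≤ ((r + 1) ^ d + 1) * (2 * Real.exp (-A / 2)) / ((n : ℝ) ^ 2 * 1) := by gcongr
    _ = _ := by rw [mul_one]

/-! ### Nets of the decision set -/

/-- The points of `D` with coordinates in a common cell of side `1 / n` are `√d / n`-close, which
gives nets of polynomial size. -/
theorem exists_net {d : ℕ} {D : Set (Vec d)} {r : ℝ} (hr : 0 < r)
    (hDbox : ∀ x ∈ D, ∀ j, 0 ≤ x j ∧ x j ≤ r) {n : ℕ} (hn : 1 ≤ n) :
    ∃ S : Finset (Vec d), (∀ z ∈ S, z ∈ D) ∧ (S.card : ℝ) ≤ (r * n + 1) ^ d ∧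
      ∀ x ∈ D, ∃ z ∈ S, ‖x - z‖ ≤ Real.sqrt d / n := by
  classical
  have hn0 : (0 : ℝ) < n := by exact_mod_cast hn
  obtain ⟨cell, hcell⟩ : ∃ cell : Vec d → Fin d → ℕ, ∀ x j, cell x j = ⌊x j * n⌋₊ :=
    ⟨fun x j => ⌊x j * n⌋₊, fun _ _ => rfl⟩
  set B : Finset (Fin d → ℕ) := Fintype.piFinset fun _ => Finset.range (⌊r * n⌋₊ + 1) with hB
  have hmem : ∀ x ∈ D, cell x ∈ B := by
    intro x hx
    rw [hB, Fintype.mem_piFinset]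
    intro j
    rw [hcell, Finset.mem_range, Nat.lt_succ_iff]
    exact Nat.floor_le_floor (mul_le_mul_of_nonneg_right (hDbox x hx j).2 hn0.le)
  set F : Finset (Fin d → ℕ) := B.filter fun p => ∃ x ∈ D, cell x = p with hF
  have hrep : ∀ p : F, ∃ x ∈ D, cell x = p := fun p => (Finset.mem_filter.1 p.2).2
  choose g hgD hg using hrep
  refine ⟨Finset.univ.image g, ?_, ?_, ?_⟩
  · intro z hz
    obtain ⟨p, -, rfl⟩ := Finset.mem_image.1 hz
    exact hgD p
  · have h1 : (Finset.univ.image g).card ≤ (⌊r * n⌋₊ + 1) ^ d := by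
      calc (Finset.univ.image g).card ≤ (Finset.univ : Finset F).card := Finset.card_image_le
        _ = F.card := by simp
        _ ≤ B.card := Finset.card_filter_le _ _
        _ = _ := by simp [hB]
    calc ((Finset.univ.image g).card : ℝ) ≤ ((⌊r * n⌋₊ + 1 : ℕ) : ℝ) ^ d := by exact_mod_cast h1
      _ ≤ _ := by
        push_cast
        gcongr
        exact Nat.floor_le (by positivity)
  · intro x hx
    have hxF : cell x ∈ F := Finset.mem_filter.2 ⟨hmem x hx, x, hx, rfl⟩
    refine ⟨g ⟨cell x, hxF⟩, Finset.mem_image_of_mem _ (Finset.mem_univ _), ?_⟩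
    have hgx : cell (g ⟨cell x, hxF⟩) = cell x := hg ⟨cell x, hxF⟩
    have := norm_le_sqrt_mul_of_abs_le (v := x - g ⟨cell x, hxF⟩) (M := 1 / n) (by positivity) ?_
    · rwa [mul_one_div] at this
    intro j
    have hj := congrFun hgx j
    rw [hcell, hcell] at hj
    have a1 := Nat.floor_le (mul_nonneg (hDbox x hx j).1 hn0.le)
    have a2 := Nat.lt_floor_add_one (x j * n)
    have b1 := Nat.floor_le (mul_nonneg (hDbox _ (hgD ⟨cell x, hxF⟩) j).1 hn0.le)
    have b2 := Nat.lt_floor_add_one (g ⟨cell x, hxF⟩ j * n)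
    rw [hj] at b1 b2
    rw [PiLp.sub_apply, abs_le]
    constructor
    · rw [neg_le, le_div_iff₀ hn0]
      linarith
    · rw [le_div_iff₀ hn0]
      linarith

/-! ### The event on which the regret is bounded -/

/-- Posterior mean after `m` steps of a run. The decision `x 0` receives no feedback, hence the shift
of the indices. -/
def runMean {d : ℕ} (k : Vec d → Vec d → ℝ) (σ : ℝ) (x : ℕ → Vec d) (y : ℕ → ℝ) (m : ℕ)
    (z : Vec d) : ℝ :=
  postMean k σ (fun i : Fin m => x (i + 1)) (fun i : Fin m => y (i + 1)) z

/-- Posterior standard deviation after `m` steps of a run, with the same indices as `runMean`. -/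
def runStd {d : ℕ} (k : Vec d → Vec d → ℝ) (σ : ℝ) (x : ℕ → Vec d) (m : ℕ) (z : Vec d) : ℝ :=
  postStd k σ (fun i : Fin m => x (i + 1)) z

theorem ucb_eq {d : ℕ} (k : Vec d → Vec d → ℝ) (σ : ℝ) (β : ℕ → ℝ) (x : ℕ → Vec d) (y : ℕ → ℝ)
    (n : ℕ) (z : Vec d) :
    ucb k σ β x y n z = runMean k σ x y (n - 1) z + Real.sqrt (β n) * runStd k σ x (n - 1) z := rfl

/-- The properties of `u`, of the decisions `x` and of the feedback `y` from which the regret bound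
follows: `u` is bounded and Lipschitz on `D`, the noise grows at most like `√log n`, and from time
`N` on the confidence intervals are correct, up to `√β_n / n`, on a net and at the decision. -/
structure IsGoodRun {d : ℕ} (D : Set (Vec d)) (k : Vec d → Vec d → ℝ) (σ : ℝ) (β : ℕ → ℝ)
    (net : ℕ → Finset (Vec d)) (C B : ℝ) (N : ℕ) (u : Vec d → ℝ) (x : ℕ → Vec d) (y : ℕ → ℝ) :
    Prop where
  lipschitz : ∀ z ∈ D, ∀ w ∈ D, |u z - u w| ≤ C * ‖z - w‖
  start : |u (x 0)| ≤ B
  noise : ∀ n, 1 ≤ n → |y n - u (x n)| ≤ B * Real.sqrt (1 + Real.log n)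
  confidence : ∀ n, N ≤ n → ∀ z, z ∈ net n ∨ z = x n →
    |u z - runMean k σ x y (n - 1) z| ≤ Real.sqrt (β n) * (runStd k σ x (n - 1) z + 1 / n)

/-- Countable union bound for events with summable probabilities, from a late enough time on. -/
theorem exists_measure_tail_le {Ω : Type*} [MeasurableSpace Ω] {P : Measure Ω}
    {E : ℕ → Set Ω} {f : ℕ → ℝ} (hf0 : ∀ n, 0 ≤ f n) (hf : Summable f) {N₀ : ℕ}
    (hE : ∀ n, N₀ ≤ n → P (E n) ≤ ENNReal.ofReal (f n)) {η : ℝ} (hη : 0 < η) :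
    ∃ N, N₀ ≤ N ∧ P {ω | ∃ n, N ≤ n ∧ ω ∈ E n} ≤ ENNReal.ofReal η := by
  obtain ⟨N, hN, hN₀⟩ := (((tendsto_sum_nat_add f).eventually (gt_mem_nhds hη)).and
    (Filter.eventually_ge_atTop N₀)).exists
  refine ⟨N, hN₀, ?_⟩
  calc P {ω | ∃ n, N ≤ n ∧ ω ∈ E n} ≤ P (⋃ i, E (i + N)) := by
        refine measure_mono ?_
        rintro ω ⟨n, hn, hω⟩
        refine Set.mem_iUnion.2 ⟨n - N, ?_⟩
        rwa [Nat.sub_add_cancel hn]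
    _ ≤ ∑' i, P (E (i + N)) := measure_iUnion_le _
    _ ≤ ∑' i, ENNReal.ofReal (f (i + N)) :=
        ENNReal.tsum_le_tsum fun i => hE _ (hN₀.trans (Nat.le_add_left _ _))
    _ = ENNReal.ofReal (∑' i, f (i + N)) :=
        (ENNReal.ofReal_tsum_of_nonneg (fun i => hf0 _) ((summable_nat_add_iff N).2 hf)).symm
    _ ≤ _ := ENNReal.ofReal_le_ofReal hN.le

/-- The noise is `O(√log n)` off an event of arbitrarily small probability. -/
theorem exists_noise_event {d : ℕ} {Ω : Type*} [MeasurableSpace Ω] {P : Measure Ω}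
    [IsProbabilityMeasure P] {U : Vec d → Ω → ℝ} {σ : ℝ} (hσ : 0 < σ) {ε : ℕ → Ω → ℝ}
    (hε : IsNoise P U ε σ) {η : ℝ} (hη : 0 < η) :
    ∃ B, 0 ≤ B ∧ P {ω | ¬ ∀ n, 1 ≤ n → |ε n ω| ≤ B * Real.sqrt (1 + Real.log n)} ≤
      ENNReal.ofReal η := by
  have hs : Summable fun n : ℕ => 1 / (n : ℝ) ^ 2 := Real.summable_one_div_nat_pow.2 one_lt_two
  set S := ∑' n : ℕ, 1 / (n : ℝ) ^ 2 with hS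
  have hlim : Filter.Tendsto (fun q : ℝ => 2 * Real.exp (-q) * S) Filter.atTop
      (nhds (2 * 0 * S)) :=
    (Real.tendsto_exp_neg_atTop_nhds_zero.const_mul 2).mul_const S
  rw [mul_zero, zero_mul] at hlim
  -- with `B = σ √(2 q)` the tail at time `n` is `2 exp (-q) n ^ (-q)`, summable as `q ≥ 2`
  obtain ⟨q, hq, hq2⟩ := ((hlim.eventually (gt_mem_nhds hη)).and
    (Filter.eventually_ge_atTop 2)).exists
  have hq0 : 0 ≤ q := by linarith
  refine ⟨σ * Real.sqrt (2 * q), by positivity, ?_⟩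
  have hE : ∀ n : ℕ, P {ω | 1 ≤ n ∧ σ * Real.sqrt (2 * q) * Real.sqrt (1 + Real.log n) < |ε n ω|} ≤
      ENNReal.ofReal (2 * Real.exp (-q) * (1 / (n : ℝ) ^ 2)) := by
    intro n
    rcases Nat.eq_zero_or_pos n with rfl | hn
    · simp
    have hn0 : (0 : ℝ) < n := by exact_mod_cast hn
    have hlog : 0 ≤ Real.log n := Real.log_natCast_nonneg n
    refine (measure_mono fun ω hω => hω.2).trans
      ((hε.measure_abs_gt_le n (by positivity)).trans (ENNReal.ofReal_le_ofReal ?_))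
    have e : (σ * Real.sqrt (2 * q) * Real.sqrt (1 + Real.log n)) ^ 2 / (2 * σ ^ 2) =
        q + q * Real.log n := by
      rw [mul_pow, mul_pow, Real.sq_sqrt (by positivity), Real.sq_sqrt (by positivity)]
      field_simp
    rw [e, neg_add, Real.exp_add, mul_assoc]
    gcongr
    calc Real.exp (-(q * Real.log n)) ≤ Real.exp (-((2 : ℕ) * Real.log n)) := by
          gcongr
          exact_mod_cast hq2
      _ = _ := by rw [Real.exp_neg, Real.exp_nat_mul, Real.exp_log hn0, one_div]
  calc P {ω | ¬ ∀ n : ℕ, 1 ≤ n → |ε n ω| ≤ σ * Real.sqrt (2 * q) * Real.sqrt (1 + Real.log n)}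
      ≤ P (⋃ n : ℕ, {ω | 1 ≤ n ∧
          σ * Real.sqrt (2 * q) * Real.sqrt (1 + Real.log n) < |ε n ω|}) := by
        refine measure_mono fun ω hω => ?_
        simp only [Set.mem_iUnion, Set.mem_ofPred_eq] at hω ⊢
        by_contra! hcon
        exact hω fun n hn => hcon n hn
    _ ≤ ∑' n : ℕ, P {ω | 1 ≤ n ∧
          σ * Real.sqrt (2 * q) * Real.sqrt (1 + Real.log n) < |ε n ω|} := measure_iUnion_le _
    _ ≤ ∑' n : ℕ, ENNReal.ofReal (2 * Real.exp (-q) * (1 / (n : ℝ) ^ 2)) :=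
        ENNReal.tsum_le_tsum hE
    _ = ENNReal.ofReal (∑' n : ℕ, 2 * Real.exp (-q) * (1 / (n : ℝ) ^ 2)) :=
        (ENNReal.ofReal_tsum_of_nonneg (fun n => by positivity) (hs.mul_left _)).symm
    _ ≤ _ := by
        rw [tsum_mul_left]
        exact ENNReal.ofReal_le_ofReal hq.le

/-- A random variable is bounded off an event of arbitrarily small probability. -/
theorem exists_start_event {Ω : Type*} [MeasurableSpace Ω] {P : Measure Ω}
    [IsProbabilityMeasure P] {Z : Ω → ℝ} (hZ : Measurable Z) {η : ℝ} (hη : 0 < η) :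
    ∃ B, 0 ≤ B ∧ P {ω | ¬ |Z ω| ≤ B} ≤ ENNReal.ofReal η := by
  have hlim : Filter.Tendsto (fun n : ℕ => P {ω | (n : ℝ) < |Z ω|}) Filter.atTop
      (nhds (P (⋂ n : ℕ, {ω | (n : ℝ) < |Z ω|}))) := by
    refine tendsto_measure_iInter_atTop
      (fun n => (measurableSet_lt measurable_const hZ.abs).nullMeasurableSet) ?_
      ⟨0, measure_ne_top _ _⟩
    intro m n hmn ω hω
    simp only [Set.mem_ofPred_eq] at hω ⊢
    have : (m : ℝ) ≤ n := by exact_mod_cast hmn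
    linarith
  have hempty : (⋂ n : ℕ, {ω | (n : ℝ) < |Z ω|}) = ∅ := by
    refine Set.eq_empty_of_forall_notMem fun ω hω => ?_
    obtain ⟨n, hn⟩ := exists_nat_gt |Z ω|
    exact lt_asymm hn (Set.mem_iInter.1 hω n)
  rw [hempty, measure_empty] at hlim
  obtain ⟨n, hn⟩ := (hlim.eventually (gt_mem_nhds (ENNReal.ofReal_pos.2 hη))).exists
  exact ⟨n, Nat.cast_nonneg n, by simpa using hn.le⟩

/-- The confidence intervals on the nets and at the decisions are correct from a fixed time on, off an
event of arbitrarily small probability. -/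
theorem exists_confidence_event {d : ℕ} {Ω : Type*} [MeasurableSpace Ω] {P : Measure Ω}
    [IsProbabilityMeasure P] {D : Set (Vec d)} (hD : IsCompact D) (hne : D.Nonempty)
    {k : Vec d → Vec d → ℝ} {U : Vec d → Ω → ℝ} (hU : IsCentredGP P U k)
    (hUc : ∀ ω, Continuous fun x : D => U x ω) (hkc : Continuous fun q : D × D => k q.1 q.2)
    {σ : ℝ} (hσ : 0 < σ) {ε : ℕ → Ω → ℝ} (hε : IsNoise P U ε σ)
    {a b r δ : ℝ} (hδ0 : 0 < δ) (hδa : δ < 2 * d * a) (hb : 0 < b) (hr : 0 < r)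
    {net : ℕ → Finset (Vec d)} (hnetD : ∀ n, 1 ≤ n → ∀ z ∈ net n, z ∈ D)
    (hnet : ∀ n, 1 ≤ n → ((net n).card : ℝ) ≤ (r * n + 1) ^ d)
    {X : ℕ → Ω → Vec d} (hXD : ∀ n ω, X n ω ∈ D)
    (hXmeas : ∀ n, Measurable[pastFeedback U ε X n] (X n)) {η : ℝ} (hη : 0 < η) :
    ∃ N : ℕ, 1 ≤ N ∧ (∀ n : ℕ, N ≤ n → 1 + Real.log n ≤ beta d a b r δ n) ∧
      P {ω | ¬ ∀ n : ℕ, N ≤ n → ∀ z, z ∈ net n ∨ z = X n ω →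
        |U z ω - runMean k σ (fun i => X i ω) (fun i => feedback U ε X i ω) (n - 1) z| ≤
          Real.sqrt (beta d a b r δ n) * (runStd k σ (fun i => X i ω) (n - 1) z + 1 / n)} ≤
        ENNReal.ofReal η := by
  classical
  obtain ⟨ξ, H, hξ⟩ := exists_isAdaptiveFeedback hD hne hU.measurable hUc hε hXD hXmeas
  obtain ⟨K, hK0, hK⟩ := exists_card_mul_exp_beta_le hδ0 hδa hb hr (r := r)
  obtain ⟨N₁, hN₁⟩ := Filter.eventually_atTop.1 (eventually_one_add_log_le_beta hδ0 hδa hb hr)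
  set bad : ℕ → Ω → Vec d → Prop := fun n ω z =>
    Real.sqrt (beta d a b r δ n) * (runStd k σ (fun i => X i ω) (n - 1) z + 1 / n) <
      |U z ω - runMean k σ (fun i => X i ω) (fun i => feedback U ε X i ω) (n - 1) z| with hbad
  have hpoint : ∀ n, max 1 N₁ ≤ n → ∀ ζ : (Fin (n - 1) → ℝ) → D, Measurable ζ →
      P {ω | bad n ω (ζ fun i => feedback U ε X (i + 1) ω)} ≤
        ENNReal.ofReal (2 * Real.exp (-(beta d a b r δ n / 2))) := by
    intro n hn ζ hζ
    have hn1 : 1 ≤ n := (le_max_left _ _).trans hn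
    have hβ := hN₁ n ((le_max_right _ _).trans hn)
    have hβ0 : 0 ≤ beta d a b r δ n := by
      have := Real.log_natCast_nonneg n
      linarith
    have h := H.measure_error_le hσ hU (fun _ _ => rfl) hkc.measurable (n - 1) hζ
      (Real.sqrt_nonneg (beta d a b r δ n)) (e := 1 / n)
      (by have : (0 : ℝ) < n := by exact_mod_cast hn1
          positivity)
    rw [Real.sq_sqrt hβ0] at h
    rw [ENNReal.ofReal_mul zero_le_two, ENNReal.ofReal_ofNat]
    refine (measure_mono fun ω hω => ?_).trans h
    simp only [hbad, runStd, runMean, Set.mem_ofPred_eq, hξ] at hω ⊢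
    exact hω
  set E : ℕ → Set Ω := fun n => {ω | ∃ z, (z ∈ net n ∨ z = X n ω) ∧ bad n ω z} with hE
  have hPE : ∀ n, max 1 N₁ ≤ n → P (E n) ≤ ENNReal.ofReal (K * (1 / (n : ℝ) ^ 2)) := by
    intro n hn
    have hn1 : 1 ≤ n := (le_max_left _ _).trans hn
    set p := Real.exp (-(beta d a b r δ n / 2)) with hp
    calc P (E n) ≤ P ((⋃ z ∈ net n, {ω | bad n ω z}) ∪ {ω | bad n ω (X n ω)}) := by
          refine measure_mono ?_
          rintro ω ⟨z, hz | rfl, hzb⟩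
          · exact Or.inl (Set.mem_iUnion₂.2 ⟨z, hz, hzb⟩)
          · exact Or.inr hzb
      _ ≤ P (⋃ z ∈ net n, {ω | bad n ω z}) + P {ω | bad n ω (X n ω)} := measure_union_le _ _
      _ ≤ ∑ z ∈ net n, ENNReal.ofReal (2 * p) + ENNReal.ofReal (2 * p) := by
          refine add_le_add ((measure_biUnion_finset_le _ _).trans
            (Finset.sum_le_sum fun z hz => ?_)) ?_
          · exact hpoint n hn (fun _ => ⟨z, hnetD n hn1 z hz⟩) measurable_const
          · refine le_trans (le_of_eq ?_) (hpoint n hn (ξ (n - 1)) (H.measurable_rule _))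
            congr 1
            ext ω
            have := hξ (n - 1) ω
            rw [Nat.sub_add_cancel hn1] at this
            simp only [Set.mem_ofPred_eq, this]
      _ = ENNReal.ofReal (((net n).card + 1) * (2 * p)) := by
          rw [Finset.sum_const, nsmul_eq_mul, add_mul, one_mul,
            ENNReal.ofReal_add (by positivity) (by positivity),
            ENNReal.ofReal_mul (p := ((net n).card : ℝ)) (by positivity), ENNReal.ofReal_natCast]
      _ ≤ ENNReal.ofReal (K / (n : ℝ) ^ 2) := by
          refine ENNReal.ofReal_le_ofReal (le_trans ?_ (hK n hn1))
          gcongr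
          exact hnet n hn1
      _ = _ := by rw [mul_one_div]
  obtain ⟨N, hN, hPN⟩ := exists_measure_tail_le (fun n => by positivity)
    ((Real.summable_one_div_nat_pow.2 one_lt_two).mul_left K) hPE hη
  refine ⟨N, (le_max_left _ _).trans hN,
    fun n hn => hN₁ n ((le_max_right _ _).trans (hN.trans hn)), ?_⟩
  refine (measure_mono fun ω hω => ?_).trans hPN
  simp only [Set.mem_ofPred_eq] at hω
  push Not at hω
  obtain ⟨n, hn, z, hz, hzb⟩ := hω
  exact ⟨n, hn, z, hz, hzb⟩

/-- With probability at least `1 - δ` the run is good. -/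
theorem exists_isGoodRun {d : ℕ} {Ω : Type*} [MeasurableSpace Ω] {P : Measure Ω}
    [IsProbabilityMeasure P] {D : Set (Vec d)} (hD : IsCompact D) (hDc : Convex ℝ D)
    {k : Vec d → Vec d → ℝ} {U : Vec d → Ω → ℝ} (hU : IsCentredGP P U k)
    (hkc : Continuous fun q : D × D => k q.1 q.2)
    (hUdiff : ∀ ω, ∀ x ∈ D, DifferentiableAt ℝ (fun z => U z ω) x) {a b : ℝ} (hb : 0 < b)
    (hUtail : ∀ j : Fin d, ∀ M : ℝ, 0 < M →
      P {ω | ∃ x ∈ D, M < |gradient (fun z => U z ω) x j|} ≤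
        ENNReal.ofReal (a * Real.exp (-(M / b) ^ 2)))
    {σ : ℝ} (hσ : 0 < σ) {ε : ℕ → Ω → ℝ} (hε : IsNoise P U ε σ)
    {r δ : ℝ} (hδ0 : 0 < δ) (hδa : δ < 2 * d * a) (hr : 0 < r)
    {net : ℕ → Finset (Vec d)} (hnetD : ∀ n, 1 ≤ n → ∀ z ∈ net n, z ∈ D)
    (hnet : ∀ n, 1 ≤ n → ((net n).card : ℝ) ≤ (r * n + 1) ^ d)
    {x₀ : Vec d} {X : ℕ → Ω → Vec d} (hX0 : ∀ ω, X 0 ω = x₀) (hXD : ∀ n ω, X n ω ∈ D)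
    (hXmeas : ∀ n, Measurable[pastFeedback U ε X n] (X n)) :
    ∃ (C B : ℝ) (N : ℕ), 0 ≤ C ∧ 0 ≤ B ∧ 1 ≤ N ∧
      (∀ n, N ≤ n → 1 + Real.log n ≤ beta d a b r δ n) ∧
      P {ω | ¬ IsGoodRun D k σ (beta d a b r δ) net C B N (fun z => U z ω) (fun n => X n ω)
        (fun n => feedback U ε X n ω)} ≤ ENNReal.ofReal δ := by
  have hη : 0 < δ / 4 := by positivity
  have hΩ : Nonempty Ω := by
    by_contra hcon
    rw [not_nonempty_iff] at hcon
    exact IsProbabilityMeasure.ne_zero P (Measure.eq_zero_of_isEmpty P)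
  have hne : D.Nonempty := ⟨_, hXD 0 hΩ.some⟩
  have hUc : ∀ ω, Continuous fun x : D => U x ω := fun ω =>
    continuousOn_iff_continuous_domRestrict.1 fun x hx =>
      (hUdiff ω x hx).continuousAt.continuousWithinAt
  obtain ⟨C, hC, hP1⟩ := exists_lipschitz_event hDc hUdiff hb hUtail hη
  obtain ⟨B₁, hB₁, hP2⟩ := exists_start_event (P := P) (hU.measurable x₀) hη
  obtain ⟨B₂, hB₂, hP3⟩ := exists_noise_event hσ hε hη
  obtain ⟨N, hN, hβ, hP4⟩ := exists_confidence_event hD hne hU hUc hkc hσ hε hδ0 hδa hb hr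
    hnetD hnet hXD hXmeas hη
  refine ⟨C, max B₁ B₂, N, hC, hB₁.trans (le_max_left _ _), hN, hβ, ?_⟩
  refine (measure_mono fun ω hω => ?_).trans ((measure_union_le _ _).trans (add_le_add
    ((measure_union_le _ _).trans (add_le_add hP1 hP2))
    ((measure_union_le _ _).trans (add_le_add hP3 hP4))) |>.trans (le_of_eq ?_))
  · by_contra hcon
    simp only [Set.mem_union, Set.mem_ofPred_eq, not_or, not_not] at hcon
    obtain ⟨⟨h1, h2⟩, h3, h4⟩ := hcon
    refine hω ⟨h1, ?_, fun n hn => ?_, h4⟩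
    · rw [hX0]
      exact h2.trans (le_max_left _ _)
    · rw [feedback, add_sub_cancel_left]
      exact (h3 n hn).trans (by gcongr; exact le_max_right _ _)
  · rw [← ENNReal.ofReal_add hη.le hη.le, ← ENNReal.ofReal_add (by positivity) (by positivity)]
    congr 1
    ring

/-! ### The projected gradient step -/

theorem gradient_neg_eq {d : ℕ} (f : Vec d → ℝ) (x : Vec d) :
    gradient (fun z => -f z) x = -gradient f x := by
  rw [gradient, gradient, fderiv_fun_neg, map_neg]

/-- Descent lemma on a convex set. -/
theorem SmoothOn.le_add_sq {d : ℕ} {D : Set (Vec d)} (hD : Convex ℝ D) {f : Vec d → ℝ} {Θ : ℝ}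
    (hf : SmoothOn D f Θ) {x y : Vec d} (hx : x ∈ D) (hy : y ∈ D) :
    f y ≤ f x + inner ℝ (gradient f x) (y - x) + Θ / 2 * ‖y - x‖ ^ 2 := by
  set v := y - x with hv
  have hmem : ∀ s ∈ Set.Icc (0 : ℝ) 1, x + s • v ∈ D := by
    intro s hs
    exact hD.add_smul_sub_mem hx hy hs
  have hderiv : ∀ s ∈ Set.Icc (0 : ℝ) 1, HasDerivAt
      (fun s : ℝ => f (x + s • v) - s * inner ℝ (gradient f x) v - Θ / 2 * ‖v‖ ^ 2 * s ^ 2)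
      (inner ℝ (gradient f (x + s • v)) v - inner ℝ (gradient f x) v - Θ * ‖v‖ ^ 2 * s) s := by
    intro s hs
    have h1 : HasDerivAt (fun s : ℝ => x + s • v) v s := by
      simpa using ((hasDerivAt_id s).smul_const v).const_add x
    have h2 := (hf.1 _ (hmem s hs)).hasGradientAt.hasFDerivAt.comp_hasDerivAt s h1
    rw [InnerProductSpace.toDual_apply_apply] at h2
    have h3 : HasDerivAt (fun s : ℝ => s * inner ℝ (gradient f x) v)
        (inner ℝ (gradient f x) v) s := by
      simpa using (hasDerivAt_id s).mul_const (inner ℝ (gradient f x) v)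
    have h4 : HasDerivAt (fun s : ℝ => Θ / 2 * ‖v‖ ^ 2 * s ^ 2) (Θ * ‖v‖ ^ 2 * s) s := by
      have := (hasDerivAt_pow 2 s).const_mul (Θ / 2 * ‖v‖ ^ 2)
      refine this.congr_deriv ?_
      push_cast
      ring
    exact (h2.sub h3).sub h4
  have hanti : AntitoneOn
      (fun s : ℝ => f (x + s • v) - s * inner ℝ (gradient f x) v - Θ / 2 * ‖v‖ ^ 2 * s ^ 2)
      (Set.Icc 0 1) := by
    refine antitoneOn_of_hasDerivWithinAt_nonpos (convex_Icc 0 1)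
      (fun s hs => (hderiv s hs).continuousAt.continuousWithinAt)
      (fun s hs => (hderiv s (interior_subset hs)).hasDerivWithinAt) fun s hs => ?_
    have hs' := interior_subset hs
    have h1 : inner ℝ (gradient f (x + s • v)) v - inner ℝ (gradient f x) v ≤
        (Θ * ‖x + s • v - x‖) * ‖v‖ := by
      rw [← inner_sub_left]
      exact (real_inner_le_norm _ _).trans
        (mul_le_mul_of_nonneg_right (hf.2 _ (hmem s hs') _ hx) (norm_nonneg _))
    rw [add_sub_cancel_left, norm_smul, Real.norm_of_nonneg hs'.1] at h1
    nlinarith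
  have := hanti (Set.left_mem_Icc.2 zero_le_one) (Set.right_mem_Icc.2 zero_le_one) zero_le_one
  simp only [one_smul, zero_smul, add_zero, hv, add_sub_cancel] at this
  linarith

/-- The projected gradient step minimises the quadratic model in the proximal gap. -/
theorem proxGap_eq_of_isProjection {d : ℕ} {D : Set (Vec d)} {φ : Vec d → ℝ} {x p : Vec d} {α : ℝ}
    (hα : 0 < α) (hp : IsProjection D (x + α • gradient φ x) p) :
    proxGap D φ x (1 / α) = -2 * (1 / α) *
      (inner ℝ (-gradient φ x) (p - x) + 1 / α / 2 * ‖p - x‖ ^ 2) := by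
  have hsq : ∀ y, inner ℝ (-gradient φ x) (y - x) + 1 / α / 2 * ‖y - x‖ ^ 2 =
      1 / α / 2 * ‖x + α • gradient φ x - y‖ ^ 2 - α / 2 * ‖gradient φ x‖ ^ 2 := by
    intro y
    have e : x + α • gradient φ x - y = α • gradient φ x - (y - x) := by abel
    rw [e, norm_sub_sq_real (α • gradient φ x), norm_smul, real_inner_smul_left, inner_neg_left,
      Real.norm_of_nonneg hα.le]
    field_simp
    ring
  rw [proxGap]
  congr 1
  refine IsLeast.csInf_eq ⟨⟨p, hp.1, rfl⟩, ?_⟩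
  rintro _ ⟨y, hy, rfl⟩
  simp only [hsq]
  have := pow_le_pow_left₀ (norm_nonneg _) (hp.2 y hy) 2
  gcongr

/-- Under the proximal PL condition a projected gradient step contracts the distance to the
maximum. -/
theorem ProxPL.maxOver_sub_le {d : ℕ} {D : Set (Vec d)} (hD : Convex ℝ D) {φ : Vec d → ℝ}
    {α Θ κ : ℝ} (hα : 0 < α) (hαΘ : α ≤ 1 / Θ) (hΘ : 0 < Θ) (h : ProxPL D φ Θ κ (1 / α))
    {x p : Vec d} (hx : x ∈ D) (hp : IsProjection D (x + α • gradient φ x) p) :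
    maxOver D φ - φ p ≤ (1 - α * κ) * (maxOver D φ - φ x) := by
  have h1 := h.1.le_add_sq hD hx hp.1
  rw [gradient_neg_eq] at h1
  have h2 := h.2 x hx
  rw [proxGap_eq_of_isProjection hα hp] at h2
  set q := inner ℝ (-gradient φ x) (p - x)
  have h3 : Θ / 2 * ‖p - x‖ ^ 2 ≤ 1 / α / 2 * ‖p - x‖ ^ 2 := by
    have : Θ ≤ 1 / α := by rwa [le_div_comm₀ hα hΘ] at hαΘ
    gcongr
  have h4 : α * (κ * (maxOver D φ - φ x)) ≤ -(q + 1 / α / 2 * ‖p - x‖ ^ 2) := by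
    calc α * (κ * (maxOver D φ - φ x)) ≤
          α * (1 / 2 * (-2 * (1 / α) * (q + 1 / α / 2 * ‖p - x‖ ^ 2))) := by gcongr
      _ = _ := by field_simp
  linarith

/-! ### Maxima over the decision set -/

theorem le_maxOver {d : ℕ} {D : Set (Vec d)} (hD : IsCompact D) {g : Vec d → ℝ}
    (hg : ContinuousOn g D) {x : Vec d} (hx : x ∈ D) : g x ≤ maxOver D g :=
  le_csSup (hD.bddAbove_image hg) ⟨x, hx, rfl⟩

theorem maxOver_le {d : ℕ} {D : Set (Vec d)} (hne : D.Nonempty) {g : Vec d → ℝ} {c : ℝ}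
    (hc : ∀ x ∈ D, g x ≤ c) : maxOver D g ≤ c := by
  refine csSup_le (hne.image g) ?_
  rintro _ ⟨x, hx, rfl⟩
  exact hc x hx

theorem drift_nonneg {d : ℕ} (D : Set (Vec d)) (V : Vec d → ℝ → ℝ) (t : ℕ → ℝ) (n : ℕ) :
    0 ≤ drift D V t n := by
  refine Real.sSup_nonneg ?_
  rintro _ ⟨x, -, rfl⟩
  exact abs_nonneg _

/-! ### The drift term -/

/-- The inner sum `∑_{z=1}^{n-1} η^z Δ_{n-z+1}` of the drift term. -/
def driftStep (η : ℝ) (Δ : ℕ → ℝ) (n : ℕ) : ℝ :=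
  ∑ z ∈ Finset.Icc 1 (n - 1), η ^ z * Δ (n - z + 1)

theorem driftStep_succ (η : ℝ) (Δ : ℕ → ℝ) {n : ℕ} (hn : 1 ≤ n) :
    driftStep η Δ (n + 1) = η * (Δ (n + 1) + driftStep η Δ n) := by
  obtain ⟨m, rfl⟩ := Nat.exists_eq_add_of_le' hn
  have h1 : ∀ j, driftStep η Δ (j + 1) =
      ∑ i ∈ Finset.range j, η ^ (i + 1) * Δ (j - i + 1) := by
    intro j
    have := Finset.sum_Ico_add' (fun z => η ^ z * Δ (j + 1 - z + 1)) 0 j 1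
    simp only [Nat.add_sub_add_right, zero_add] at this
    rw [Finset.range_eq_Ico, this]
    rfl
  rw [h1, h1, Finset.sum_range_succ', add_comm, mul_add, Finset.mul_sum]
  congr 1
  · simp
  · refine Finset.sum_congr rfl fun i hi => ?_
    rw [Nat.add_sub_add_right]
    ring

theorem driftStep_one (η : ℝ) (Δ : ℕ → ℝ) : driftStep η Δ 1 = 0 := by simp [driftStep]

theorem driftStep_le {η : ℝ} (hη0 : 0 ≤ η) (hη1 : η < 1) {Δ : ℕ → ℝ} {M : ℝ} (hM : 0 ≤ M)
    (hΔ : ∀ n, 2 ≤ n → Δ n ≤ M) {n : ℕ} (hn : 1 ≤ n) :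
    driftStep η Δ n ≤ M * η / (1 - η) := by
  have h1 : 0 < 1 - η := by linarith
  induction n, hn using Nat.le_induction with
  | base =>
    rw [driftStep_one]
    positivity
  | succ n hn ih =>
    rw [driftStep_succ η Δ hn]
    calc η * (Δ (n + 1) + driftStep η Δ n) ≤ η * (M + M * η / (1 - η)) := by
          gcongr
          exact hΔ _ (by omega)
      _ = _ := by field_simp; ring

theorem driftTerm_le {η : ℝ} (hη0 : 0 ≤ η) (hη1 : η < 1) {Δ : ℕ → ℝ} {M : ℝ} (hM : 0 ≤ M)
    (hΔ : ∀ n, 2 ≤ n → Δ n ≤ M) (T : ℕ) : driftTerm η Δ T ≤ 2 * M * η * T / (1 - η) := by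
  calc driftTerm η Δ T = 2 * ∑ n ∈ Finset.Icc 1 T, driftStep η Δ n := rfl
    _ ≤ 2 * ∑ _n ∈ Finset.Icc 1 T, M * η / (1 - η) := by
        gcongr with n hn
        exact driftStep_le hη0 hη1 hM hΔ (Finset.mem_Icc.1 hn).1
    _ = _ := by
        rw [Finset.sum_const, Nat.card_Icc, nsmul_eq_mul, Nat.add_sub_cancel]
        ring

/-- Summing the geometric weights, the drift term is the total drift times `2 η / (1 - η)` up to
the weights cut off at the horizon. -/
theorem sum_drift_le_driftTerm {η : ℝ} (hη0 : 0 ≤ η) (hη1 : η < 1) {Δ : ℕ → ℝ} {M : ℝ}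
    (hM : 0 ≤ M) (hΔ : ∀ n, 2 ≤ n → Δ n ≤ M) {T : ℕ} (hT : 1 ≤ T) :
    2 * η / (1 - η) * ∑ n ∈ Finset.Icc 2 T, Δ n ≤
      driftTerm η Δ T + 2 * M / (1 - η) ^ 2 := by
  have h1 : 0 < 1 - η := by linarith
  have key : (1 - η) * ∑ n ∈ Finset.Icc 1 T, driftStep η Δ n =
      η * ∑ n ∈ Finset.Icc 2 T, Δ n - η * driftStep η Δ T := by
    induction T, hT using Nat.le_induction with
    | base => simp [driftStep_one]
    | succ T hT ih =>
      rw [Finset.sum_Icc_succ_top (by omega), Finset.sum_Icc_succ_top (by omega), mul_add, ih,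
        driftStep_succ η Δ hT]
      ring
  have h2 := driftStep_le hη0 hη1 hM hΔ hT
  have h3 : η * driftStep η Δ T ≤ M / (1 - η) := by
    calc η * driftStep η Δ T ≤ η * (M * η / (1 - η)) := by gcongr
      _ = M * (η * η) / (1 - η) := by ring
      _ ≤ M * 1 / (1 - η) := by
          gcongr
          nlinarith
      _ = _ := by rw [mul_one]
  have h4 : driftTerm η Δ T = 2 * ∑ n ∈ Finset.Icc 1 T, driftStep η Δ n := rfl
  rw [h4]
  have e : 2 * η / (1 - η) * ∑ n ∈ Finset.Icc 2 T, Δ n =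
      2 * ((1 - η) * ∑ n ∈ Finset.Icc 1 T, driftStep η Δ n + η * driftStep η Δ T) / (1 - η) := by
    rw [key]
    ring
  rw [e]
  calc 2 * ((1 - η) * ∑ n ∈ Finset.Icc 1 T, driftStep η Δ n + η * driftStep η Δ T) / (1 - η)
      ≤ 2 * ((1 - η) * ∑ n ∈ Finset.Icc 1 T, driftStep η Δ n + M / (1 - η)) / (1 - η) := by
        gcongr
    _ = _ := by field_simp

/-! ### Posterior variances along a run -/

/-- For small `s` the linear term of the regret and a quadratic correction are dominated by the
information gained: the leading constant has room because `log (1 + σ⁻²) < σ⁻²`. -/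
theorem exists_slack {σ : ℝ} (hσ : 0 < σ) (K : ℝ) :
    ∃ s₀ : ℝ, 0 < s₀ ∧ ∀ s, 0 ≤ s → s ≤ s₀ → 2 * s + K * s ^ 2 ≤
      2 * Real.sqrt (Real.log (1 + s ^ 2 / σ ^ 2) / Real.log (1 + (σ ^ 2)⁻¹)) := by
  set l := Real.log (1 + (σ ^ 2)⁻¹) with hl
  have hinv : 0 < (σ ^ 2)⁻¹ := by positivity
  have hl0 : 0 < l := Real.log_pos (by linarith)
  have hl1 : l < (σ ^ 2)⁻¹ := by
    have := Real.log_lt_sub_one_of_pos (x := 1 + (σ ^ 2)⁻¹) (by positivity) (by linarith)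
    linarith
  have hlim : Filter.Tendsto (fun s : ℝ => (1 + K / 2 * s) ^ 2 * (l * (σ ^ 2 + s ^ 2)))
      (nhds 0) (nhds ((1 + K / 2 * 0) ^ 2 * (l * (σ ^ 2 + 0 ^ 2)))) :=
    Continuous.tendsto (by fun_prop) 0
  have hlt : (1 + K / 2 * 0) ^ 2 * (l * (σ ^ 2 + 0 ^ 2)) < 1 := by
    have : l * σ ^ 2 < (σ ^ 2)⁻¹ * σ ^ 2 := by gcongr
    rw [inv_mul_cancel₀ (by positivity)] at this
    simpa using this
  obtain ⟨e, he, hball⟩ := Metric.eventually_nhds_iff.1 (hlim.eventually (gt_mem_nhds hlt))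
  refine ⟨e / 2, by positivity, fun s hs0 hs => ?_⟩
  have hs1 := hball (y := s) (by rw [Real.dist_eq, sub_zero, abs_of_nonneg hs0]; linarith)
  have hsq : s + K / 2 * s ^ 2 ≤ Real.sqrt (Real.log (1 + s ^ 2 / σ ^ 2) / l) := by
    refine Real.le_sqrt_of_sq_le ?_
    rw [le_div_iff₀ hl0]
    have hlog : s ^ 2 / (σ ^ 2 + s ^ 2) ≤ Real.log (1 + s ^ 2 / σ ^ 2) := by
      have := Real.one_sub_inv_le_log_of_pos (x := 1 + s ^ 2 / σ ^ 2) (by positivity)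
      refine le_trans (le_of_eq ?_) this
      field_simp
      ring
    refine le_trans ?_ hlog
    rw [le_div_iff₀ (by positivity)]
    have e1 : (s + K / 2 * s ^ 2) ^ 2 * l * (σ ^ 2 + s ^ 2) =
        s ^ 2 * ((1 + K / 2 * s) ^ 2 * (l * (σ ^ 2 + s ^ 2))) := by ring
    rw [e1]
    nlinarith [sq_nonneg s]
  linarith

theorem runStd_sq {d : ℕ} {k : Vec d → Vec d → ℝ} (hk : IsPosSemidefKernel k) {σ : ℝ}
    (hσ : 0 < σ) (x : ℕ → Vec d) (m : ℕ) (z : Vec d) :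
    runStd k σ x m z ^ 2 = postCov k σ (fun i : Fin m => x (i + 1)) z z :=
  Real.sq_sqrt (postCov_nonneg hk hσ _ z)

theorem runStd_le_one {d : ℕ} {k : Vec d → Vec d → ℝ} (hk : IsPosSemidefKernel k) {σ : ℝ}
    (hσ : 0 < σ) (x : ℕ → Vec d) (m : ℕ) {z : Vec d} (hz : k z z ≤ 1) :
    runStd k σ x m z ≤ 1 :=
  Real.sqrt_le_one.2 ((postCov_le hk hσ _ z).trans hz)

/-- The standard deviation at the decision exceeds a given level boundedly often: among many
decisions in a small cell the late ones are predicted well from the early ones. -/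
theorem exists_card_runStd_gt_le {d : ℕ} {D : Set (Vec d)} {r : ℝ} (hr : 0 < r)
    (hDbox : ∀ x ∈ D, ∀ j, 0 ≤ x j ∧ x j ≤ r) {k : Vec d → Vec d → ℝ}
    (hk : IsPosSemidefKernel k) {C : ℝ} (hC : 0 ≤ C)
    (hlip : ∀ x ∈ D, ∀ y ∈ D, k x x - 2 * k y x + k y y ≤ C ^ 2 * ‖x - y‖ ^ 2) {σ : ℝ}
    (hσ : 0 < σ) {s₀ : ℝ} (hs₀ : 0 < s₀) :
    ∃ M : ℕ, ∀ x : ℕ → Vec d, (∀ n, x n ∈ D) → ∀ T : ℕ,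
      ((Finset.Icc 1 T).filter fun n => s₀ < runStd k σ x (n - 1) (x n)).card ≤ M := by
  classical
  obtain ⟨q, hq⟩ := exists_nat_gt (C * (2 * Real.sqrt d) / (s₀ / 2))
  obtain ⟨w, hw⟩ := exists_nat_gt (σ ^ 2 / (s₀ ^ 2 / 2))
  obtain ⟨S, hSD, -, hS⟩ := exists_net hr hDbox (n := q + 1) (by omega)
  have hq0 : (0 : ℝ) < ((q + 1 : ℕ) : ℝ) := by positivity
  choose! g hgS hg using hS
  refine ⟨S.card * (w + 1), fun x hx T => ?_⟩
  rw [mul_comm]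
  refine Finset.card_le_mul_card_image_of_maps_to (f := fun n => g (x n))
    (fun n _ => hgS _ (hx n)) (w + 1) fun z hz => ?_
  set F := ((Finset.Icc 1 T).filter fun n => s₀ < runStd k σ x (n - 1) (x n)).filter
    fun n => g (x n) = z with hF
  by_contra! hcard
  have hFne : F.Nonempty := Finset.card_pos.1 (by omega)
  set n := F.max' hFne with hn
  have hnF : n ∈ F := F.max'_mem hFne
  simp only [hF, Finset.mem_filter, Finset.mem_Icc] at hnF
  set I : Finset (Fin (n - 1)) := Finset.univ.filter fun i => (i : ℕ) + 1 ∈ F with hI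
  have hIcard : w + 1 ≤ I.card := by
    have hsub : F.erase n ⊆ I.image fun i : Fin (n - 1) => (i : ℕ) + 1 := by
      intro m hm
      have hmF := Finset.mem_of_mem_erase hm
      have hlt := F.lt_max'_of_mem_erase_max' hFne hm
      have hm1 : 1 ≤ m := by
        simp only [hF, Finset.mem_filter, Finset.mem_Icc] at hmF
        exact hmF.1.1.1
      refine Finset.mem_image.2 ⟨⟨m - 1, by omega⟩, ?_, Nat.sub_add_cancel hm1⟩
      simpa [hI, Nat.sub_add_cancel hm1] using hmF
    have h1 := (Finset.card_le_card hsub).trans Finset.card_image_le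
    rw [Finset.card_erase_of_mem (F.max'_mem hFne)] at h1
    omega
  have hclose : ∀ i ∈ I, k (x n) (x n) - 2 * k (x (i + 1)) (x n) + k (x (i + 1)) (x (i + 1)) ≤
      (s₀ / 2) ^ 2 := by
    intro i hi
    have hiF : (i : ℕ) + 1 ∈ F := by simpa [hI] using hi
    simp only [hF, Finset.mem_filter] at hiF
    refine (hlip _ (hx n) _ (hx _)).trans ?_
    rw [← mul_pow]
    refine pow_le_pow_left₀ (by positivity) ?_ 2
    have h1 := hg _ (hx n)
    have h2 := hg _ (hx (i + 1))
    rw [hnF.2] at h1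
    rw [hiF.2, norm_sub_rev] at h2
    have h3 : ‖x n - x (i + 1)‖ ≤ 2 * Real.sqrt d / ((q + 1 : ℕ) : ℝ) := by
      calc ‖x n - x (i + 1)‖ ≤ ‖x n - z‖ + ‖z - x (i + 1)‖ := norm_sub_le_norm_sub_add_norm_sub _ _ _
        _ ≤ Real.sqrt d / ((q + 1 : ℕ) : ℝ) + Real.sqrt d / ((q + 1 : ℕ) : ℝ) := add_le_add h1 h2
        _ = _ := by ring
    calc C * ‖x n - x (i + 1)‖ ≤ C * (2 * Real.sqrt d / ((q + 1 : ℕ) : ℝ)) := by gcongr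
      _ = C * (2 * Real.sqrt d) / ((q + 1 : ℕ) : ℝ) := by ring
      _ ≤ s₀ / 2 := by
        rw [div_lt_iff₀ (by positivity)] at hq
        rw [div_le_iff₀ hq0]
        push_cast
        nlinarith
  have hpost := postCov_le_of_close hk hσ (fun i : Fin (n - 1) => x (i + 1)) (x n) I
    (Finset.card_pos.1 (by omega)) hclose
  have hsmall : σ ^ 2 / I.card ≤ s₀ ^ 2 / 2 := by
    have hIw : (w : ℝ) + 1 ≤ I.card := by exact_mod_cast hIcard
    rw [div_lt_iff₀ (by positivity)] at hw
    rw [div_le_iff₀ (by linarith [Nat.cast_nonneg (α := ℝ) w])]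
    nlinarith [sq_nonneg s₀]
  have hgt := hnF.1.2
  have := pow_lt_pow_left₀ hgt hs₀.le two_ne_zero
  rw [runStd_sq hk hσ] at this
  nlinarith

/-! ### Regret on the good event -/

theorem continuousOn_of_abs_sub_le {d : ℕ} {D : Set (Vec d)} {f : Vec d → ℝ} {C : ℝ}
    (hf : ∀ z ∈ D, ∀ w ∈ D, |f z - f w| ≤ C * ‖z - w‖) : ContinuousOn f D := by
  refine (LipschitzOnWith.of_dist_le_mul (K := Real.toNNReal C) fun z hz w hw => ?_).continuousOn
  rw [Real.dist_eq, dist_eq_norm]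
  exact (hf z hz w hw).trans (by gcongr; exact Real.le_coe_toNNReal C)

theorem SmoothOn.continuousOn_of_neg {d : ℕ} {D : Set (Vec d)} {f : Vec d → ℝ} {Θ : ℝ}
    (hf : SmoothOn D (fun z => -f z) Θ) : ContinuousOn f D := fun x hx => by
  have h := (hf.1 x hx).continuousAt.fun_neg
  simp only [neg_neg] at h
  exact h.continuousWithinAt

theorem norm_sub_le_of_mem_box {d : ℕ} {D : Set (Vec d)} {r : ℝ} (hr : 0 < r)
    (hDbox : ∀ x ∈ D, ∀ j, 0 ≤ x j ∧ x j ≤ r) {z w : Vec d} (hz : z ∈ D) (hw : w ∈ D) :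
    ‖z - w‖ ≤ Real.sqrt d * r := by
  refine norm_le_sqrt_mul_of_abs_le hr.le fun j => ?_
  rw [PiLp.sub_apply, abs_le]
  constructor <;> linarith [hDbox z hz j, hDbox w hw j]

/-- Optimism: the regret of a step is the distance of the surrogate to its maximum plus twice the
width of the confidence interval, up to the resolution of the net. -/
theorem IsGoodRun.regret_step_le {d : ℕ} {D : Set (Vec d)} (hD : IsCompact D)
    {k : Vec d → Vec d → ℝ} {σ : ℝ} {β : ℕ → ℝ} {net : ℕ → Finset (Vec d)} {C B : ℝ} {N : ℕ}
    {u : Vec d → ℝ} {x : ℕ → Vec d} {y : ℕ → ℝ} (h : IsGoodRun D k σ β net C B N u x y)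
    (hC : 0 ≤ C) {n : ℕ} (hN : N ≤ n) (hxD : x n ∈ D) (hnetD : ∀ z ∈ net n, z ∈ D)
    (hcover : ∀ z ∈ D, ∃ w ∈ net n, ‖z - w‖ ≤ Real.sqrt d / n) {v : Vec d → ℝ} {A : ℝ}
    (hA : 0 ≤ A) (hv : ∀ z ∈ D, ∀ w ∈ D, |v z - v w| ≤ A * ‖z - w‖)
    (hcont : ContinuousOn (fun z => v z + ucb k σ β x y n z) D) :
    maxOver D (fun z => v z + u z) - (v (x n) + u (x n)) ≤
      (maxOver D (fun z => v z + ucb k σ β x y n z) - (v (x n) + ucb k σ β x y n (x n))) +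
        2 * (Real.sqrt (β n) * runStd k σ x (n - 1) (x n)) +
        (2 * Real.sqrt (β n) + (A + C) * Real.sqrt d) * (1 / n) := by
  rw [sub_le_iff_le_add]
  refine maxOver_le ⟨_, hxD⟩ fun z hz => ?_
  obtain ⟨w, hw, hzw⟩ := hcover z hz
  have hwD := hnetD w hw
  have h1 := (abs_le.1 (h.confidence n hN w (Or.inl hw))).2
  have h2 := (abs_le.1 (h.confidence n hN _ (Or.inr rfl))).1
  have h3 := (le_abs_self _).trans (hv z hz w hwD)
  have h4 := (le_abs_self _).trans (h.lipschitz z hz w hwD)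
  have h5 := le_maxOver hD hcont hwD
  have h6 : (A + C) * ‖z - w‖ ≤ (A + C) * (Real.sqrt d / n) := by gcongr
  have h7 : (A + C) * (Real.sqrt d / n) = (A + C) * Real.sqrt d * (1 / n) := by ring
  simp only [ucb_eq] at h5 ⊢
  nlinarith

/-- On the good event the upper confidence bounds grow at most logarithmically on `D`: they are
controlled on the net by the values of `u`, and the posterior mean varies little between
neighbouring points of the net. -/
theorem IsGoodRun.abs_ucb_le {d : ℕ} {D : Set (Vec d)}
    {k : Vec d → Vec d → ℝ} (hk : IsPosSemidefKernel k) (hk1 : ∀ z ∈ D, k z z ≤ 1) {Ck : ℝ}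
    (hCk : 0 ≤ Ck) (hlip : ∀ z ∈ D, ∀ w ∈ D, k z z - 2 * k w z + k w w ≤ Ck ^ 2 * ‖z - w‖ ^ 2)
    {σ : ℝ} (hσ : 0 < σ) {β : ℕ → ℝ} {net : ℕ → Finset (Vec d)} {C B : ℝ} (hB : 0 ≤ B) {N : ℕ}
    {u : Vec d → ℝ} {x : ℕ → Vec d} {y : ℕ → ℝ} (h : IsGoodRun D k σ β net C B N u x y)
    {B' : ℝ} (hu : ∀ z ∈ D, |u z| ≤ B')
    {n : ℕ} (hn : 1 ≤ n) (hN : N ≤ n) (hxD : ∀ i, x i ∈ D) (hnetD : ∀ z ∈ net n, z ∈ D)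
    (hcover : ∀ z ∈ D, ∃ w ∈ net n, ‖z - w‖ ≤ Real.sqrt d / n) {Cβ : ℝ}
    (hβ : Real.sqrt (β n) ≤ Cβ * (1 + Real.log n)) {z : Vec d} (hz : z ∈ D) :
    |ucb k σ β x y n z| ≤
      (B' + 3 * Cβ + Ck * Real.sqrt d * (B' + B) / σ ^ 2) * (1 + Real.log n) := by
  obtain ⟨w, hw, hzw⟩ := hcover z hz
  have hwD := hnetD w hw
  have hB' : 0 ≤ B' := (abs_nonneg _).trans (hu z hz)
  have hn0 : (0 : ℝ) < n := by exact_mod_cast hn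
  have hn1 : (1 : ℝ) ≤ n := by exact_mod_cast hn
  have hlog : 0 ≤ Real.log n := Real.log_natCast_nonneg n
  set l := 1 + Real.log n with hl
  have hl1 : 1 ≤ l := by linarith
  have hsβ := Real.sqrt_nonneg (β n)
  have hstd : ∀ z ∈ D, runStd k σ x (n - 1) z ≤ 1 := fun z hz =>
    runStd_le_one hk hσ x _ (hk1 z hz)
  have hstd0 : ∀ z, 0 ≤ runStd k σ x (n - 1) z := fun z => Real.sqrt_nonneg _
  have hsqrtl : Real.sqrt l ≤ l := Real.sqrt_le_iff.2 ⟨by linarith, by nlinarith⟩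
  have hy : ∀ i : Fin (n - 1), |y (i + 1)| ≤ (B' + B) * l := by
    intro i
    have h1 := h.noise (i + 1) (by omega)
    have h2 := hu _ (hxD (i + 1))
    have h3 : Real.sqrt (1 + Real.log ((i + 1 : ℕ) : ℝ)) ≤ l := by
      refine (Real.sqrt_le_sqrt ?_).trans hsqrtl
      have : Real.log ((i + 1 : ℕ) : ℝ) ≤ Real.log n :=
        Real.log_le_log (by positivity) (by exact_mod_cast (by omega : (i : ℕ) + 1 ≤ n))
      linarith
    calc |y (i + 1)| = |(y (i + 1) - u (x (i + 1))) + u (x (i + 1))| := by rw [sub_add_cancel]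
      _ ≤ |y (i + 1) - u (x (i + 1))| + |u (x (i + 1))| := abs_add_le _ _
      _ ≤ B * l + B' * l := add_le_add (h1.trans (by gcongr)) (h2.trans (le_mul_of_one_le_right hB' hl1))
      _ = _ := by ring
  have hmean : |runMean k σ x y (n - 1) z - runMean k σ x y (n - 1) w| ≤
      Ck * Real.sqrt d * (B' + B) / σ ^ 2 * l := by
    have h1 := abs_dotProduct_regGram_inv_le hk hσ (fun i : Fin (n - 1) => x (i + 1))
      (u := kvec k (fun i : Fin (n - 1) => x (i + 1)) z -
        kvec k (fun i : Fin (n - 1) => x (i + 1)) w) (v := fun i : Fin (n - 1) => y (i + 1))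
      (p := Ck * (Real.sqrt d / n)) (q := (B' + B) * l) (by positivity) (by positivity)
      (fun i => (abs_kernel_sub_le hk hk1 hCk hlip (hxD _) hz hwD).trans (by gcongr)) hy
    rw [sub_dotProduct] at h1
    refine h1.trans ?_
    have h2 : ((n - 1 : ℕ) : ℝ) ≤ n := by exact_mod_cast Nat.sub_le n 1
    calc ((n - 1 : ℕ) : ℝ) * (Ck * (Real.sqrt d / n)) * ((B' + B) * l) / σ ^ 2
        ≤ n * (Ck * (Real.sqrt d / n)) * ((B' + B) * l) / σ ^ 2 := by gcongr
      _ = _ := by field_simp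
  have hw1 := h.confidence n hN w (Or.inl hw)
  have hw2 : Real.sqrt (β n) * (runStd k σ x (n - 1) w + 1 / n) ≤ Real.sqrt (β n) * 2 := by
    have : 1 / (n : ℝ) ≤ 1 := by rw [div_le_one hn0]; exact hn1
    have := hstd w hwD
    gcongr
    linarith
  have hz1 : Real.sqrt (β n) * runStd k σ x (n - 1) z ≤ Real.sqrt (β n) * 1 := by
    gcongr
    exact hstd z hz
  have hz2 : 0 ≤ Real.sqrt (β n) * runStd k σ x (n - 1) z := mul_nonneg hsβ (hstd0 z)
  have huw := abs_le.1 (hu w hwD)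
  have hB'l : B' ≤ B' * l := le_mul_of_one_le_right hB' hl1
  rw [abs_le] at hmean hw1
  rw [ucb_eq, abs_le]
  constructor <;> nlinarith

/-- The upper confidence bound at the decision decreases by little when the feedback received there
is added, since the update is proportional to the posterior variance. -/
theorem IsGoodRun.ucb_sub_succ_le {d : ℕ} {D : Set (Vec d)}
    {k : Vec d → Vec d → ℝ} (hk : IsPosSemidefKernel k) (hk1 : ∀ z ∈ D, k z z ≤ 1)
    {σ : ℝ} (hσ : 0 < σ) {β : ℕ → ℝ} {net : ℕ → Finset (Vec d)} {C B : ℝ} (hB : 0 ≤ B) {N : ℕ}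
    {u : Vec d → ℝ} {x : ℕ → Vec d} {y : ℕ → ℝ} (h : IsGoodRun D k σ β net C B N u x y)
    {n : ℕ} (hn : 1 ≤ n) (hN : N ≤ n) (hxD : x n ∈ D) (hβ : 1 + Real.log n ≤ β n)
    (hβmono : β n ≤ β (n + 1)) :
    ucb k σ β x y n (x n) - ucb k σ β x y (n + 1) (x n) ≤
      (B + 3) / σ ^ 2 * (Real.sqrt (β n) * runStd k σ x (n - 1) (x n) ^ 2) := by
  obtain ⟨m, rfl⟩ := Nat.exists_eq_add_of_le' hn
  have hσ2 : 0 < σ ^ 2 := by positivity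
  have hn0 : (0 : ℝ) < ((m + 1 : ℕ) : ℝ) := by positivity
  have hn1 : (1 : ℝ) ≤ ((m + 1 : ℕ) : ℝ) := by exact_mod_cast hn
  rw [ucb_eq, ucb_eq, Nat.add_sub_cancel, Nat.add_sub_cancel]
  have hmean := postMean_succ hk hσ (fun i : Fin (m + 1) => x (i + 1))
    (fun i : Fin (m + 1) => y (i + 1)) (x (m + 1))
  have hcov := postCov_succ hk hσ (fun i : Fin (m + 1) => x (i + 1)) (x (m + 1)) (x (m + 1))
  have hs2 := runStd_sq hk hσ x m (x (m + 1))
  have hs2' := runStd_sq hk hσ x (m + 1) (x (m + 1))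
  simp only [Fin.val_castSucc, Fin.val_last] at hmean hcov
  rw [← hs2] at hmean hcov
  rw [← hs2'] at hcov
  have hconf := h.confidence (m + 1) hN _ (Or.inr rfl)
  have hnoise := h.noise (m + 1) hn
  rw [Nat.add_sub_cancel] at hconf
  have hs0 : 0 ≤ runStd k σ x m (x (m + 1)) := Real.sqrt_nonneg _
  have hs0' : 0 ≤ runStd k σ x (m + 1) (x (m + 1)) := Real.sqrt_nonneg _
  have hs1 : runStd k σ x m (x (m + 1)) ≤ 1 := runStd_le_one hk hσ x m (hk1 _ hxD)
  change runMean k σ x y (m + 1) (x (m + 1)) = runMean k σ x y m (x (m + 1)) +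
    _ * (_ - runMean k σ x y m (x (m + 1))) / _ at hmean
  rw [hmean]
  set s := runStd k σ x m (x (m + 1))
  set s' := runStd k σ x (m + 1) (x (m + 1))
  set μ := runMean k σ x y m (x (m + 1))
  set q := Real.sqrt (β (m + 1))
  have hq0 : 0 ≤ q := Real.sqrt_nonneg _
  have hqq : q ≤ Real.sqrt (β (m + 1 + 1)) := Real.sqrt_le_sqrt hβmono
  -- the innovation `y - μ` is at most of the order of `√β`
  have hinn : |y (m + 1) - μ| ≤ q * (B + 2) := by
    have h1 : B * Real.sqrt (1 + Real.log ((m + 1 : ℕ) : ℝ)) ≤ B * q := by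
      gcongr
      exact Real.sqrt_le_sqrt hβ
    have h2 : q * (s + 1 / ((m + 1 : ℕ) : ℝ)) ≤ q * 2 := by
      have : 1 / ((m + 1 : ℕ) : ℝ) ≤ 1 := by rw [div_le_one hn0]; exact hn1
      gcongr
      linarith
    calc |y (m + 1) - μ| ≤ |y (m + 1) - u (x (m + 1))| + |u (x (m + 1)) - μ| := abs_sub_le _ _ _
      _ ≤ B * q + q * 2 := add_le_add (hnoise.trans h1) (hconf.trans h2)
      _ = _ := by ring
  have hfrac : s ^ 2 / (σ ^ 2 + s ^ 2) ≤ s ^ 2 / σ ^ 2 := by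
    gcongr
    linarith [sq_nonneg s]
  have hfrac0 : 0 ≤ s ^ 2 / (σ ^ 2 + s ^ 2) := by positivity
  have hmove : -(s ^ 2 * (y (m + 1) - μ) / (σ ^ 2 + s ^ 2)) ≤ s ^ 2 / σ ^ 2 * (q * (B + 2)) := by
    calc -(s ^ 2 * (y (m + 1) - μ) / (σ ^ 2 + s ^ 2))
        = s ^ 2 / (σ ^ 2 + s ^ 2) * (-(y (m + 1) - μ)) := by ring
      _ ≤ s ^ 2 / (σ ^ 2 + s ^ 2) * (q * (B + 2)) := by
          gcongr
          exact (neg_le_abs _).trans hinn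
      _ ≤ _ := by gcongr
  -- `s - s' = (s² - s'²) / (s + s')`
  have hstd : s - s' ≤ s ^ 2 / σ ^ 2 := by
    rcases hs0.eq_or_lt with h0 | hpos
    · rw [← h0]
      simpa using hs0'
    have h1 : s ^ 2 - s' ^ 2 ≤ s ^ 2 * s ^ 2 / σ ^ 2 := by
      rw [hcov, sub_sub_cancel]
      gcongr
      linarith [sq_nonneg s]
    have h2 : (s - s') * s ≤ s ^ 2 / σ ^ 2 * s := by
      by_cases hss : s ≤ s'
      · exact (mul_nonpos_of_nonpos_of_nonneg (by linarith) hs0).trans (by positivity)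
      · calc (s - s') * s ≤ (s - s') * (s + s') := by
              have : 0 ≤ s - s' := by linarith
              gcongr
              linarith
          _ = s ^ 2 - s' ^ 2 := by ring
          _ ≤ s ^ 2 * s ^ 2 / σ ^ 2 := h1
          _ = s ^ 2 / σ ^ 2 * s * s := by ring
          _ ≤ s ^ 2 / σ ^ 2 * s * 1 := by gcongr
          _ = _ := mul_one _
    exact le_of_mul_le_mul_right h2 hpos
  have h3 : q * s' ≤ Real.sqrt (β (m + 1 + 1)) * s' := by gcongr
  have h4 : q * (s - s') ≤ q * (s ^ 2 / σ ^ 2) := by gcongr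
  calc μ + q * s - (μ + s ^ 2 * (y (m + 1) - μ) / (σ ^ 2 + s ^ 2) +
        Real.sqrt (β (m + 1 + 1)) * s')
      ≤ s ^ 2 / σ ^ 2 * (q * (B + 2)) + q * (s ^ 2 / σ ^ 2) := by linarith
    _ = _ := by ring

/-- Summation of a contraction whose target moves. -/
theorem sum_le_of_contraction {a m Δ J : ℕ → ℝ} {η : ℝ} (hη0 : 0 ≤ η) (hη1 : η < 1) {N T : ℕ}
    (hNT : N ≤ T) (ha : 0 ≤ a T)
    (h : ∀ n, N ≤ n → n < T → a (n + 1) ≤ η * (a n + (m (n + 1) - m n) + Δ (n + 1) + J n)) :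
    ∑ n ∈ Finset.Ioc N T, a n ≤ η / (1 - η) *
      (a N + (m T - m N) + ∑ n ∈ Finset.Ioc N T, Δ n + ∑ n ∈ Finset.Ico N T, J n) := by
  have h1 : 0 < 1 - η := by linarith
  have key : (1 - η) * ∑ n ∈ Finset.Ioc N T, a n ≤ η * (a N - a T + (m T - m N) +
      ∑ n ∈ Finset.Ioc N T, Δ n + ∑ n ∈ Finset.Ico N T, J n) := by
    clear ha
    induction T, hNT using Nat.le_induction with
    | base => simp
    | succ T hT ih =>
      have := ih fun n hn hnT => h n hn (by omega)
      rw [← Finset.insert_Ioc_right_eq_Ioc_add_one hT, Finset.sum_insert (by simp),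
        Finset.sum_insert (by simp), Finset.sum_Ico_succ_top hT]
      have := h T hT (by omega)
      nlinarith
  rw [div_mul_eq_mul_div, le_div_iff₀ h1]
  nlinarith

/-- Cauchy–Schwarz bounds the sum of the widths by the information gain, the finitely many large
ones apart; the quadratic correction costs only a constant. -/
theorem exists_sum_width_le {d : ℕ} {D : Set (Vec d)} {r : ℝ} (hr : 0 < r)
    (hDbox : ∀ x ∈ D, ∀ j, 0 ≤ x j ∧ x j ≤ r) {k : Vec d → Vec d → ℝ}
    (hk : IsPosSemidefKernel k) (hk1 : ∀ z ∈ D, k z z ≤ 1) {C : ℝ} (hC : 0 ≤ C)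
    (hlip : ∀ x ∈ D, ∀ y ∈ D, k x x - 2 * k y x + k y y ≤ C ^ 2 * ‖x - y‖ ^ 2) {σ : ℝ}
    (hσ : 0 < σ) {K : ℝ} (hK : 0 ≤ K) :
    ∃ A : ℝ, 0 ≤ A ∧ ∀ x : ℕ → Vec d, (∀ n, x n ∈ D) → ∀ T : ℕ,
      ∑ n ∈ Finset.Icc 1 T, (2 * runStd k σ x (n - 1) (x n) +
        K * runStd k σ x (n - 1) (x n) ^ 2) ≤ Real.sqrt (C₁ σ * T * infoGain k σ D T) + A := by
  obtain ⟨s₀, hs₀, hslack⟩ := exists_slack hσ K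
  obtain ⟨M, hM⟩ := exists_card_runStd_gt_le hr hDbox hk hC hlip hσ hs₀
  refine ⟨M * (2 + K), by positivity, fun x hx T => ?_⟩
  set s : ℕ → ℝ := fun n => runStd k σ x (n - 1) (x n) with hs
  set l := Real.log (1 + (σ ^ 2)⁻¹) with hl
  have hinv : 0 < (σ ^ 2)⁻¹ := by positivity
  have hl0 : 0 < l := Real.log_pos (by linarith)
  have hs0 : ∀ n, 0 ≤ s n := fun n => Real.sqrt_nonneg _
  have hs1 : ∀ n, s n ≤ 1 := fun n => runStd_le_one hk hσ x _ (hk1 _ (hx n))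
  have hg0 : ∀ n, 0 ≤ Real.log (1 + s n ^ 2 / σ ^ 2) := fun n => Real.log_nonneg (by
    have : 0 ≤ s n ^ 2 / σ ^ 2 := by positivity
    linarith)
  have hterm : ∀ n, 2 * s n + K * s n ^ 2 ≤ 2 * Real.sqrt (Real.log (1 + s n ^ 2 / σ ^ 2) / l) +
      if s₀ < s n then 2 + K else 0 := by
    intro n
    split_ifs with hn
    · have h1 : s n ^ 2 ≤ 1 := pow_le_one₀ (hs0 n) (hs1 n)
      have h2 := hs1 n
      have : 0 ≤ Real.sqrt (Real.log (1 + s n ^ 2 / σ ^ 2) / l) := Real.sqrt_nonneg _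
      nlinarith
    · rw [add_zero]
      exact hslack _ (hs0 n) (not_lt.1 hn)
  have hinfo : ∑ n ∈ Finset.Icc 1 T, Real.log (1 + s n ^ 2 / σ ^ 2) ≤ 2 * infoGain k σ D T := by
    refine le_trans (le_of_eq ?_)
      (sum_log_le_infoGain hk hσ hk1 (fun n => x (n + 1)) (fun n => hx _) T)
    have e := Finset.sum_Ico_add' (fun n => Real.log (1 + s n ^ 2 / σ ^ 2)) 0 T 1
    rw [← Finset.range_eq_Ico] at e
    refine e.symm.trans (Finset.sum_congr rfl fun n _ => ?_)
    rw [hs]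
    simp only
    rw [runStd_sq hk hσ]
    rfl
  have hcs : ∑ n ∈ Finset.Icc 1 T, 2 * Real.sqrt (Real.log (1 + s n ^ 2 / σ ^ 2) / l) ≤
      Real.sqrt (C₁ σ * T * infoGain k σ D T) := by
    refine Real.le_sqrt_of_sq_le ?_
    rw [← Finset.mul_sum, mul_pow]
    have h1 := sq_sum_le_card_mul_sum_sq (s := Finset.Icc 1 T)
      (f := fun n => Real.sqrt (Real.log (1 + s n ^ 2 / σ ^ 2) / l))
    have h2 : ∑ n ∈ Finset.Icc 1 T, Real.sqrt (Real.log (1 + s n ^ 2 / σ ^ 2) / l) ^ 2 =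
        (∑ n ∈ Finset.Icc 1 T, Real.log (1 + s n ^ 2 / σ ^ 2)) / l := by
      rw [Finset.sum_div]
      exact Finset.sum_congr rfl fun n _ => Real.sq_sqrt (div_nonneg (hg0 n) hl0.le)
    rw [h2, Nat.card_Icc, Nat.add_sub_cancel] at h1
    calc 2 ^ 2 * (∑ n ∈ Finset.Icc 1 T, Real.sqrt (Real.log (1 + s n ^ 2 / σ ^ 2) / l)) ^ 2
        ≤ 2 ^ 2 * (T * ((2 * infoGain k σ D T) / l)) := by
          gcongr
          exact h1.trans (by gcongr)
      _ = _ := by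
          rw [C₁]
          ring
  have hcount : ∑ n ∈ Finset.Icc 1 T, (if s₀ < s n then 2 + K else 0) ≤ M * (2 + K) := by
    rw [← Finset.sum_filter, Finset.sum_const, nsmul_eq_mul]
    gcongr
    exact hM x hx T
  calc ∑ n ∈ Finset.Icc 1 T, (2 * s n + K * s n ^ 2)
      ≤ ∑ n ∈ Finset.Icc 1 T, (2 * Real.sqrt (Real.log (1 + s n ^ 2 / σ ^ 2) / l) +
          if s₀ < s n then 2 + K else 0) := Finset.sum_le_sum fun n _ => hterm n
    _ ≤ _ := by
      rw [Finset.sum_add_distrib]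
      exact add_le_add hcs hcount

/-- Cumulative drift dominates the change of `V` over several steps. -/
theorem sub_le_sum_drift {d : ℕ} {D : Set (Vec d)} (hD : IsCompact D) {V : Vec d → ℝ → ℝ}
    {t : ℕ → ℝ} (hVc : ∀ n, 1 ≤ n → ContinuousOn (fun z => V z (t n)) D) {z : Vec d} (hz : z ∈ D)
    {N T : ℕ} (hN : 1 ≤ N) (hNT : N ≤ T) :
    V z (t T) - V z (t N) ≤ ∑ n ∈ Finset.Ioc N T, drift D V t n := by
  induction T, hNT using Nat.le_induction with
  | base => simp
  | succ T hT ih =>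
    rw [← Finset.insert_Ioc_right_eq_Ioc_add_one hT, Finset.sum_insert (by simp)]
    have h := le_maxOver hD (g := fun z => |V z (t (T + 1)) - V z (t (T + 1 - 1))|)
      ((hVc _ (by omega)).sub (hVc _ (by omega))).abs hz
    rw [Nat.add_sub_cancel] at h
    have h2 : |V z (t (T + 1)) - V z (t T)| ≤ drift D V t (T + 1) := h
    linarith [le_abs_self (V z (t (T + 1)) - V z (t T))]

theorem abs_sub_le_drift {d : ℕ} {D : Set (Vec d)} (hD : IsCompact D) {V : Vec d → ℝ → ℝ}
    {t : ℕ → ℝ} (hVc : ∀ n, 1 ≤ n → ContinuousOn (fun z => V z (t n)) D) {z : Vec d} (hz : z ∈ D)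
    {n : ℕ} (hn : 1 ≤ n) : |V z (t (n + 1)) - V z (t n)| ≤ drift D V t (n + 1) :=
  le_maxOver hD (g := fun z => |V z (t (n + 1)) - V z (t (n + 1 - 1))|)
    ((hVc _ (by omega)).sub (hVc _ (by omega))).abs hz

/-- A single term of the regret is at most the oscillation of the objective over `D`. -/
theorem regret_term_le {d : ℕ} {D : Set (Vec d)} {r : ℝ} (hr : 0 < r)
    (hDbox : ∀ x ∈ D, ∀ j, 0 ≤ x j ∧ x j ≤ r) {v u : Vec d → ℝ} {A C : ℝ} (hA : 0 ≤ A)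
    (hC : 0 ≤ C) (hv : ∀ z ∈ D, ∀ w ∈ D, |v z - v w| ≤ A * ‖z - w‖)
    (hu : ∀ z ∈ D, ∀ w ∈ D, |u z - u w| ≤ C * ‖z - w‖) {x : Vec d} (hx : x ∈ D) :
    maxOver D (fun z => v z + u z) - (v x + u x) ≤ (A + C) * (Real.sqrt d * r) := by
  rw [sub_le_iff_le_add]
  refine maxOver_le ⟨x, hx⟩ fun z hz => ?_
  have h1 := (le_abs_self _).trans (hv z hz x hx)
  have h2 := (le_abs_self _).trans (hu z hz x hx)
  have h3 : (A + C) * ‖z - x‖ ≤ (A + C) * (Real.sqrt d * r) := by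
    gcongr
    exact norm_sub_le_of_mem_box hr hDbox hz hx
  linarith

/-- The total suboptimality of the decisions for the surrogate objectives. -/
theorem IsGoodRun.sum_gap_le {d : ℕ} {D : Set (Vec d)} (hD : IsCompact D) {r : ℝ} (hr : 0 < r)
    (hDbox : ∀ x ∈ D, ∀ j, 0 ≤ x j ∧ x j ≤ r) {V : Vec d → ℝ → ℝ} {t : ℕ → ℝ} {A : ℝ}
    (hA : 0 ≤ A)
    (hV : ∀ n, 1 ≤ n → ∀ z ∈ D, ∀ w ∈ D, |V z (t n) - V w (t n)| ≤ A * ‖z - w‖)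
    {k : Vec d → Vec d → ℝ} (hk : IsPosSemidefKernel k) (hk1 : ∀ z ∈ D, k z z ≤ 1)
    {σ : ℝ} (hσ : 0 < σ) {β : ℕ → ℝ} {net : ℕ → Finset (Vec d)} {C B : ℝ} (hB : 0 ≤ B) {N : ℕ}
    (hN1 : 1 ≤ N) (hβ : ∀ n, N ≤ n → 1 + Real.log n ≤ β n)
    (hβmono : ∀ n, 1 ≤ n → β n ≤ β (n + 1))
    {u : Vec d → ℝ} {x : ℕ → Vec d} {y : ℕ → ℝ} (h : IsGoodRun D k σ β net C B N u x y)
    (hxD : ∀ i, x i ∈ D) {η : ℝ} (hη0 : 0 ≤ η) (hη1 : η < 1) {T : ℕ} (hNT : N ≤ T) {W : ℝ}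
    (hW : ∀ n, N ≤ n → n ≤ T → ∀ z ∈ D, |ucb k σ β x y n z| ≤ W)
    (hcont : ∀ n, 1 ≤ n → n ≤ T → ContinuousOn (surrogate V t k σ β x y n) D)
    (hstep : ∀ n, 1 ≤ n → n ≤ T →
      maxOver D (surrogate V t k σ β x y n) - surrogate V t k σ β x y n (x n) ≤
        η * (maxOver D (surrogate V t k σ β x y n) - surrogate V t k σ β x y n (x (n - 1)))) :
    ∑ n ∈ Finset.Ioc N T,
        (maxOver D (surrogate V t k σ β x y n) - surrogate V t k σ β x y n (x n)) ≤
      η / (1 - η) * (A * (Real.sqrt d * r) + 4 * W + 2 * ∑ n ∈ Finset.Ioc N T, drift D V t n +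
        (B + 3) / σ ^ 2 * ∑ n ∈ Finset.Ico N T,
          Real.sqrt (β n) * runStd k σ x (n - 1) (x n) ^ 2) := by
  have h1 : 0 < 1 - η := by linarith
  have hVc : ∀ n, 1 ≤ n → ContinuousOn (fun z => V z (t n)) D := fun n hn =>
    continuousOn_of_abs_sub_le (hV n hn)
  have hT1 : 1 ≤ T := hN1.trans hNT
  have key := sum_le_of_contraction (m := fun n => maxOver D (surrogate V t k σ β x y n))
    (a := fun n => maxOver D (surrogate V t k σ β x y n) - surrogate V t k σ β x y n (x n))
    (Δ := drift D V t)
    (J := fun n => (B + 3) / σ ^ 2 * (Real.sqrt (β n) * runStd k σ x (n - 1) (x n) ^ 2))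
    hη0 hη1 hNT (sub_nonneg.2 (le_maxOver hD (hcont T hT1 le_rfl) (hxD T))) (by
      intro n hn hnT
      have hn1 := hN1.trans hn
      refine (hstep (n + 1) (by omega) hnT).trans ?_
      rw [Nat.add_sub_cancel]
      gcongr
      have e1 := (abs_le.1 (abs_sub_le_drift hD hVc (hxD n) hn1)).1
      have e2 := h.ucb_sub_succ_le hk hk1 hσ hB hn1 hn (hxD n) (hβ n hn) (hβmono n hn1)
      simp only [surrogate] at e2 ⊢
      linarith)
  have hmax : maxOver D (surrogate V t k σ β x y T) ≤ maxOver D (surrogate V t k σ β x y N) +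
      ∑ n ∈ Finset.Ioc N T, drift D V t n + 2 * W := by
    refine maxOver_le ⟨_, hxD 0⟩ fun z hz => ?_
    have e1 := sub_le_sum_drift hD hVc hz hN1 hNT
    have e2 := le_maxOver hD (hcont N hN1 hNT) hz
    have e3 := (abs_le.1 (hW N le_rfl hNT z hz)).1
    have e4 := (abs_le.1 (hW T hNT le_rfl z hz)).2
    simp only [surrogate] at e2 ⊢
    linarith
  have hfirst : maxOver D (surrogate V t k σ β x y N) - surrogate V t k σ β x y N (x N) ≤
      A * (Real.sqrt d * r) + 2 * W := by
    rw [sub_le_iff_le_add]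
    refine maxOver_le ⟨_, hxD 0⟩ fun z hz => ?_
    have e1 := (le_abs_self _).trans (hV N hN1 z hz _ (hxD N))
    have e2 : A * ‖z - x N‖ ≤ A * (Real.sqrt d * r) := by
      gcongr
      exact norm_sub_le_of_mem_box hr hDbox hz (hxD N)
    have e3 := (abs_le.1 (hW N le_rfl hNT z hz)).2
    have e4 := (abs_le.1 (hW N le_rfl hNT _ (hxD N))).1
    simp only [surrogate]
    linarith
  refine key.trans (mul_le_mul_of_nonneg_left ?_ (by positivity))
  rw [← Finset.mul_sum]
  linarith

/-- The nondecreasing weights `c n` are replaced by the last one, and the sums extended to all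
times. -/
theorem sum_weighted_width_le {s c : ℕ → ℝ} {N T : ℕ} (hN : 1 ≤ N) (hs : ∀ n, 0 ≤ s n)
    (hc0 : ∀ n, 0 ≤ c n) (hc : ∀ n, 1 ≤ n → n ≤ T → c n ≤ c T) {K : ℝ} (hK : 0 ≤ K) :
    2 * ∑ n ∈ Finset.Ioc N T, c n * s n + K * ∑ n ∈ Finset.Ico N T, c n * s n ^ 2 ≤
      c T * ∑ n ∈ Finset.Icc 1 T, (2 * s n + K * s n ^ 2) := by
  have e1 : ∑ n ∈ Finset.Ioc N T, c n * s n ≤ ∑ n ∈ Finset.Icc 1 T, c T * s n := by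
    refine (Finset.sum_le_sum fun n hn => ?_).trans
      (Finset.sum_le_sum_of_subset_of_nonneg (fun n hn => ?_) fun n _ _ =>
        mul_nonneg (hc0 T) (hs n))
    · rw [Finset.mem_Ioc] at hn
      exact mul_le_mul_of_nonneg_right (hc n (by omega) hn.2) (hs n)
    · rw [Finset.mem_Ioc] at hn
      exact Finset.mem_Icc.2 ⟨by omega, hn.2⟩
  have e2 : ∑ n ∈ Finset.Ico N T, c n * s n ^ 2 ≤ ∑ n ∈ Finset.Icc 1 T, c T * s n ^ 2 := by
    refine (Finset.sum_le_sum fun n hn => ?_).trans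
      (Finset.sum_le_sum_of_subset_of_nonneg (fun n hn => ?_) fun n _ _ =>
        mul_nonneg (hc0 T) (sq_nonneg _))
    · rw [Finset.mem_Ico] at hn
      exact mul_le_mul_of_nonneg_right (hc n (by omega) hn.2.le) (sq_nonneg _)
    · rw [Finset.mem_Ico] at hn
      exact Finset.mem_Icc.2 ⟨by omega, hn.2.le⟩
  refine (add_le_add (mul_le_mul_of_nonneg_left e1 zero_le_two)
    (mul_le_mul_of_nonneg_left e2 hK)).trans (le_of_eq ?_)
  rw [Finset.sum_add_distrib, ← Finset.mul_sum, ← Finset.mul_sum, ← Finset.mul_sum,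
    ← Finset.mul_sum]
  ring

/-- The errors from the resolution `1 / n` of the nets add up to `O(log² T)`. -/
theorem sum_resolution_le {c : ℕ → ℝ} {M E : ℝ} (hM : 0 ≤ M) (hE : 0 ≤ E)
    (hc : ∀ n : ℕ, 1 ≤ n → c n ≤ M * (1 + Real.log n)) (N T : ℕ) :
    ∑ n ∈ Finset.Ioc N T, (2 * c n + E) * (1 / (n : ℝ)) ≤
      (2 * M + E) * (1 + Real.log T) ^ 2 := by
  have hT := Real.log_natCast_nonneg T
  have hharm : ∑ n ∈ Finset.Icc 1 T, 1 / (n : ℝ) ≤ 1 + Real.log T := by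
    have := harmonic_le_one_add_log T
    rw [harmonic_eq_sum_Icc] at this
    push_cast at this
    simpa [one_div] using this
  calc ∑ n ∈ Finset.Ioc N T, (2 * c n + E) * (1 / (n : ℝ))
      ≤ ∑ n ∈ Finset.Ioc N T, (2 * M + E) * (1 + Real.log T) * (1 / (n : ℝ)) := by
        refine Finset.sum_le_sum fun n hn => ?_
        rw [Finset.mem_Ioc] at hn
        have hn0 : (0 : ℝ) < n := by exact_mod_cast (by omega : 0 < n)
        have h1 : Real.log n ≤ Real.log T := Real.log_le_log hn0 (by exact_mod_cast hn.2)
        have h2 := hc n (by omega)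
        have h3 : M * (1 + Real.log n) ≤ M * (1 + Real.log T) := by gcongr
        have h4 : 0 ≤ E * Real.log T := by positivity
        exact mul_le_mul_of_nonneg_right (by linarith) (by positivity)
    _ ≤ ∑ n ∈ Finset.Icc 1 T, (2 * M + E) * (1 + Real.log T) * (1 / (n : ℝ)) := by
        refine Finset.sum_le_sum_of_subset_of_nonneg (fun n hn => ?_) fun n _ _ => by positivity
        rw [Finset.mem_Ioc] at hn
        exact Finset.mem_Icc.2 ⟨by omega, hn.2⟩
    _ = (2 * M + E) * (1 + Real.log T) * ∑ n ∈ Finset.Icc 1 T, 1 / (n : ℝ) := by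
        rw [Finset.mul_sum]
    _ ≤ (2 * M + E) * (1 + Real.log T) * (1 + Real.log T) :=
        mul_le_mul_of_nonneg_left hharm (by positivity)
    _ = _ := by ring

/-- On the good event the regret is at most the explicit bound. -/
theorem exists_regret_le {d : ℕ} {D : Set (Vec d)} (hD : IsCompact D) {r : ℝ} (hr : 0 < r)
    (hDbox : ∀ x ∈ D, ∀ j, 0 ≤ x j ∧ x j ≤ r) {V : Vec d → ℝ → ℝ} {t : ℕ → ℝ} {A : ℝ}
    (hA : 0 ≤ A)
    (hV : ∀ n, 1 ≤ n → ∀ z ∈ D, ∀ w ∈ D, |V z (t n) - V w (t n)| ≤ A * ‖z - w‖)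
    {Δ : ℝ} (hΔ0 : 0 ≤ Δ) (hΔ : ∀ n, 2 ≤ n → drift D V t n ≤ Δ)
    {k : Vec d → Vec d → ℝ} (hk : IsPosSemidefKernel k) (hk1 : ∀ z ∈ D, k z z ≤ 1) {Ck : ℝ}
    (hCk : 0 ≤ Ck) (hlip : ∀ z ∈ D, ∀ w ∈ D, k z z - 2 * k w z + k w w ≤ Ck ^ 2 * ‖z - w‖ ^ 2)
    {σ : ℝ} (hσ : 0 < σ) {β : ℕ → ℝ} {net : ℕ → Finset (Vec d)}
    (hnetD : ∀ n, 1 ≤ n → ∀ z ∈ net n, z ∈ D)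
    (hcover : ∀ n : ℕ, 1 ≤ n → ∀ z ∈ D, ∃ w ∈ net n, ‖z - w‖ ≤ Real.sqrt d / n)
    {C B : ℝ} (hC : 0 ≤ C) (hB : 0 ≤ B) {N : ℕ}
    (hN1 : 1 ≤ N) (hβ : ∀ n : ℕ, N ≤ n → 1 + Real.log n ≤ β n)
    (hβmono : ∀ m n, 1 ≤ m → m ≤ n → β m ≤ β n) {Cβ : ℝ} (hCβ : 0 ≤ Cβ)
    (hβC : ∀ n : ℕ, 1 ≤ n → Real.sqrt (β n) ≤ Cβ * (1 + Real.log n))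
    {η : ℝ} (hη0 : 0 ≤ η) (hη1 : η < 1) :
    ∃ M : ℝ, 0 ≤ M ∧ ∀ (u : Vec d → ℝ) (x : ℕ → Vec d) (y : ℕ → ℝ),
      IsGoodRun D k σ β net C B N u x y → (∀ i, x i ∈ D) → ∀ T : ℕ, 1 ≤ T →
      (∀ n, 1 ≤ n → n ≤ T → ContinuousOn (surrogate V t k σ β x y n) D) →
      (∀ n, 1 ≤ n → n ≤ T →
        maxOver D (surrogate V t k σ β x y n) - surrogate V t k σ β x y n (x n) ≤
          η * (maxOver D (surrogate V t k σ β x y n) - surrogate V t k σ β x y n (x (n - 1)))) →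
      regret D V t u x T ≤ Real.sqrt (C₁ σ * T * β T * infoGain k σ D T) +
        M * (1 + Real.log T) ^ 2 + driftTerm η (drift D V t) T := by
  have h1 : 0 < 1 - η := by linarith
  have hηq : 0 ≤ η / (1 - η) := by positivity
  set R := Real.sqrt d * r with hR
  have hR0 : 0 ≤ R := by positivity
  set B' := B + C * R with hB'
  set W := B' + 3 * Cβ + Ck * Real.sqrt d * (B' + B) / σ ^ 2 with hW
  have hW0 : 0 ≤ W := by positivity
  set K := η / (1 - η) * ((B + 3) / σ ^ 2) with hK
  have hK0 : 0 ≤ K := by positivity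
  obtain ⟨Q, hQ0, hQ⟩ := exists_sum_width_le hr hDbox hk hk1 hCk hlip hσ hK0
  set E := (A + C) * Real.sqrt d with hE
  have hE0 : 0 ≤ E := by positivity
  refine ⟨N * ((A + C) * R) + η / (1 - η) * (A * R + 4 * W) + 2 * Δ / (1 - η) ^ 2 + Q * Cβ +
    (2 * Cβ + E), by positivity, fun u x y h hxD T hT hcont hstep => ?_⟩
  set l := 1 + Real.log T with hl
  have hl1 : 1 ≤ l := by linarith [Real.log_natCast_nonneg T]
  have hll : l ≤ l ^ 2 := by nlinarith
  have hl2 : 1 ≤ l ^ 2 := by nlinarith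
  have hG0 : 0 ≤ driftTerm η (drift D V t) T := by
    refine mul_nonneg zero_le_two (Finset.sum_nonneg fun n _ => Finset.sum_nonneg fun z _ => ?_)
    exact mul_nonneg (pow_nonneg hη0 _) (drift_nonneg _ _ _ _)
  have hterm : ∀ n, 1 ≤ n →
      maxOver D (fun z => V z (t n) + u z) - (V (x n) (t n) + u (x n)) ≤ (A + C) * R :=
    fun n hn => regret_term_le hr hDbox hA hC (hV n hn) h.lipschitz (hxD n)
  have hearly : ∀ S : ℕ, S ≤ N → regret D V t u x S ≤ N * ((A + C) * R) := by
    intro S hS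
    have hSN : (S : ℝ) ≤ N := by exact_mod_cast hS
    calc regret D V t u x S ≤ ∑ _n ∈ Finset.Icc 1 S, (A + C) * R :=
          Finset.sum_le_sum fun n hn => hterm n (Finset.mem_Icc.1 hn).1
      _ = S * ((A + C) * R) := by
          rw [Finset.sum_const, Nat.card_Icc, nsmul_eq_mul, Nat.add_sub_cancel]
      _ ≤ _ := by gcongr
  have hN0 : 0 ≤ N * ((A + C) * R) := by positivity
  have hM1 : 0 ≤ η / (1 - η) * (A * R + 4 * W) := by positivity
  have hM2 : 0 ≤ 2 * Δ / (1 - η) ^ 2 := by positivity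
  have hM3 : 0 ≤ Q * Cβ := by positivity
  rcases le_total T N with hTN | hNT
  · have := hearly T hTN
    have := Real.sqrt_nonneg (C₁ σ * T * β T * infoGain k σ D T)
    nlinarith
  have hlogT : ∀ n : ℕ, 1 ≤ n → n ≤ T → 1 + Real.log n ≤ l := by
    intro n hn hnT
    have : Real.log n ≤ Real.log T :=
      Real.log_le_log (by exact_mod_cast hn) (by exact_mod_cast hnT)
    linarith
  have hu : ∀ z ∈ D, |u z| ≤ B' := by
    intro z hz
    have e1 := h.lipschitz z hz _ (hxD 0)
    have e2 : C * ‖z - x 0‖ ≤ C * R := by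
      gcongr
      exact norm_sub_le_of_mem_box hr hDbox hz (hxD 0)
    calc |u z| = |(u z - u (x 0)) + u (x 0)| := by rw [sub_add_cancel]
      _ ≤ |u z - u (x 0)| + |u (x 0)| := abs_add_le _ _
      _ ≤ _ := by linarith [h.start]
  have hucb : ∀ n, N ≤ n → n ≤ T → ∀ z ∈ D, |ucb k σ β x y n z| ≤ W * l := by
    intro n hn hnT z hz
    have hn1 := hN1.trans hn
    refine (h.abs_ucb_le hk hk1 hCk hlip hσ hB hu hn1 hn hxD (hnetD n hn1) (hcover n hn1)
      (hβC n hn1) hz).trans ?_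
    gcongr
    exact hlogT n hn1 hnT
  set s : ℕ → ℝ := fun n => runStd k σ x (n - 1) (x n) with hs
  have hs0 : ∀ n, 0 ≤ s n := fun n => Real.sqrt_nonneg _
  have hgap := h.sum_gap_le hD hr hDbox hA hV hk hk1 hσ hB hN1 hβ
    (fun n hn => hβmono n (n + 1) hn (Nat.le_succ n)) hxD hη0 hη1 hNT hucb hcont hstep
  have hsqrtβ : ∀ n, 1 ≤ n → n ≤ T → Real.sqrt (β n) ≤ Real.sqrt (β T) := fun n hn hnT =>
    Real.sqrt_le_sqrt (hβmono n T hn hnT)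
  -- the linear terms of the regret and the quadratic ones of the contraction are summed together
  have hwidth : 2 * ∑ n ∈ Finset.Ioc N T, Real.sqrt (β n) * s n +
      K * ∑ n ∈ Finset.Ico N T, Real.sqrt (β n) * s n ^ 2 ≤
      Real.sqrt (C₁ σ * T * β T * infoGain k σ D T) + Q * Cβ * l := by
    have hβT0 : 0 ≤ β T := by linarith [hβ T hNT, Real.log_natCast_nonneg T]
    refine (sum_weighted_width_le hN1 hs0 (fun n => Real.sqrt_nonneg (β n)) hsqrtβ hK0).trans
      ((mul_le_mul_of_nonneg_left (hQ x hxD T) (Real.sqrt_nonneg _)).trans ?_)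
    have e1 : Real.sqrt (β T) * Real.sqrt (C₁ σ * T * infoGain k σ D T) =
        Real.sqrt (C₁ σ * T * β T * infoGain k σ D T) := by
      rw [← Real.sqrt_mul hβT0]
      congr 1
      ring
    have e2 := mul_le_mul_of_nonneg_left (hβC T hT) hQ0
    rw [mul_add, e1]
    linarith
  have hres : ∑ n ∈ Finset.Ioc N T, (2 * Real.sqrt (β n) + E) * (1 / (n : ℝ)) ≤
      (2 * Cβ + E) * l ^ 2 :=
    sum_resolution_le hCβ hE0 hβC N T
  have hdrift : η / (1 - η) * (2 * ∑ n ∈ Finset.Ioc N T, drift D V t n) ≤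
      driftTerm η (drift D V t) T + 2 * Δ / (1 - η) ^ 2 := by
    refine le_trans ?_ (sum_drift_le_driftTerm hη0 hη1 hΔ0 hΔ hT)
    have : ∑ n ∈ Finset.Ioc N T, drift D V t n ≤ ∑ n ∈ Finset.Icc 2 T, drift D V t n := by
      refine Finset.sum_le_sum_of_subset_of_nonneg (fun n hn => ?_)
        fun n _ _ => drift_nonneg _ _ _ _
      rw [Finset.mem_Ioc] at hn
      exact Finset.mem_Icc.2 ⟨by omega, hn.2⟩
    calc η / (1 - η) * (2 * ∑ n ∈ Finset.Ioc N T, drift D V t n)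
        ≤ η / (1 - η) * (2 * ∑ n ∈ Finset.Icc 2 T, drift D V t n) := by gcongr
      _ = _ := by ring
  have hsplit : regret D V t u x T = regret D V t u x N + ∑ n ∈ Finset.Ioc N T,
      (maxOver D (fun z => V z (t n) + u z) - (V (x n) (t n) + u (x n))) := by
    have e : Finset.Icc 1 T = Finset.Icc 1 N ∪ Finset.Ioc N T := by
      ext n
      simp only [Finset.mem_union, Finset.mem_Icc, Finset.mem_Ioc]
      omega
    rw [regret, e, Finset.sum_union]
    · rfl
    · refine Finset.disjoint_left.2 fun n hn hn' => ?_
      rw [Finset.mem_Icc] at hn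
      rw [Finset.mem_Ioc] at hn'
      omega
  have hlate : ∑ n ∈ Finset.Ioc N T,
      (maxOver D (fun z => V z (t n) + u z) - (V (x n) (t n) + u (x n))) ≤
      ∑ n ∈ Finset.Ioc N T,
        (maxOver D (surrogate V t k σ β x y n) - surrogate V t k σ β x y n (x n)) +
      2 * ∑ n ∈ Finset.Ioc N T, Real.sqrt (β n) * s n +
      ∑ n ∈ Finset.Ioc N T, (2 * Real.sqrt (β n) + E) * (1 / (n : ℝ)) := by
    rw [Finset.mul_sum, ← Finset.sum_add_distrib, ← Finset.sum_add_distrib]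
    refine Finset.sum_le_sum fun n hn => ?_
    rw [Finset.mem_Ioc] at hn
    have hn1 : 1 ≤ n := by omega
    exact h.regret_step_le hD hC hn.1.le (hxD n) (hnetD n hn1) (hcover n hn1) hA (hV n hn1)
      (hcont n hn1 hn.2)
  have hconst : η / (1 - η) * (A * R + 4 * (W * l)) ≤ η / (1 - η) * (A * R + 4 * W) * l := by
    rw [mul_assoc]
    gcongr
    have : A * R ≤ A * R * l := le_mul_of_one_le_right (by positivity) hl1
    linarith
  have hgap' : ∑ n ∈ Finset.Ioc N T,
      (maxOver D (surrogate V t k σ β x y n) - surrogate V t k σ β x y n (x n)) ≤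
      η / (1 - η) * (A * R + 4 * (W * l)) +
        η / (1 - η) * (2 * ∑ n ∈ Finset.Ioc N T, drift D V t n) +
        K * ∑ n ∈ Finset.Ico N T, Real.sqrt (β n) * s n ^ 2 := by
    refine hgap.trans (le_of_eq ?_)
    rw [hK]
    ring
  have hx1 : N * ((A + C) * R) ≤ N * ((A + C) * R) * l ^ 2 := le_mul_of_one_le_right hN0 hl2
  have hx2 : η / (1 - η) * (A * R + 4 * W) * l ≤ η / (1 - η) * (A * R + 4 * W) * l ^ 2 := by gcongr
  have hx3 : 2 * Δ / (1 - η) ^ 2 ≤ 2 * Δ / (1 - η) ^ 2 * l ^ 2 := le_mul_of_one_le_right hM2 hl2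
  have hx4 : Q * Cβ * l ≤ Q * Cβ * l ^ 2 := by gcongr
  have hx0 := hearly N le_rfl
  rw [hsplit, add_mul, add_mul, add_mul, add_mul]
  linarith

/-! ### The regret bound -/

theorem gradient_surrogate {d : ℕ} {V : Vec d → ℝ → ℝ} {t : ℕ → ℝ} {k : Vec d → Vec d → ℝ} {σ : ℝ}
    {β : ℕ → ℝ} {x : ℕ → Vec d} {y : ℕ → ℝ} {n : ℕ} {z : Vec d}
    (hV : DifferentiableAt ℝ (fun z => V z (t n)) z)
    (hφ : DifferentiableAt ℝ (surrogate V t k σ β x y n) z) :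
    gradient (surrogate V t k σ β x y n) z =
      gradient (fun z => V z (t n)) z + gradient (ucb k σ β x y n) z := by
  have e : ucb k σ β x y n = fun z => surrogate V t k σ β x y n z - V z (t n) := by
    funext w
    simp [surrogate]
  have hucb : DifferentiableAt ℝ (ucb k σ β x y n) z := by
    rw [e]
    exact hφ.fun_sub hV
  have e2 : surrogate V t k σ β x y n = fun z => V z (t n) + ucb k σ β x y n z := rfl
  rw [e2, gradient, fderiv_fun_add hV hucb, map_add]
  rfl

theorem SmoothOn.differentiableAt_of_neg {d : ℕ} {D : Set (Vec d)} {f : Vec d → ℝ} {Θ : ℝ}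
    (hf : SmoothOn D (fun z => -f z) Θ) {x : Vec d} (hx : x ∈ D) : DifferentiableAt ℝ f x := by
  have h := (hf.1 x hx).fun_neg
  simpa only [neg_neg] using h

theorem IsRun.mem {d : ℕ} {D : Set (Vec d)} {V : Vec d → ℝ → ℝ} {t : ℕ → ℝ}
    {k : Vec d → Vec d → ℝ} {σ : ℝ} {β : ℕ → ℝ} {α : ℝ} {x₀ : Vec d} {x : ℕ → Vec d} {y : ℕ → ℝ}
    (h : IsRun D V t k σ β α x₀ x y) (hx₀ : x₀ ∈ D) (n : ℕ) : x n ∈ D := by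
  rcases Nat.eq_zero_or_pos n with rfl | hn
  · rw [h.1]
    exact hx₀
  · exact (h.2 n hn).1

/-- Each step of a run contracts the distance of the current surrogate objective to its maximum. -/
theorem IsRun.maxOver_sub_le {d : ℕ} {D : Set (Vec d)} (hD : Convex ℝ D) {V : Vec d → ℝ → ℝ}
    {t : ℕ → ℝ} {L : ℝ} (hV : ∀ n, 1 ≤ n → SmoothOn D (fun x => -V x (t n)) L)
    {k : Vec d → Vec d → ℝ} {σ : ℝ} {β : ℕ → ℝ} {α Θ κ : ℝ} (hα : 0 < α) (hΘ : 0 < Θ)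
    (hαΘ : α ≤ 1 / Θ) {x₀ : Vec d} (hx₀ : x₀ ∈ D) {x : ℕ → Vec d} {y : ℕ → ℝ}
    (h : IsRun D V t k σ β α x₀ x y) {n : ℕ} (hn : 1 ≤ n)
    (hPL : ProxPL D (surrogate V t k σ β x y n) Θ κ (1 / α)) :
    maxOver D (surrogate V t k σ β x y n) - surrogate V t k σ β x y n (x n) ≤
      (1 - α * κ) *
        (maxOver D (surrogate V t k σ β x y n) - surrogate V t k σ β x y n (x (n - 1))) := by
  have hx := h.mem hx₀ (n - 1)
  refine hPL.maxOver_sub_le hD hα hαΘ hΘ hx ?_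
  rw [gradient_surrogate ((hV n hn).differentiableAt_of_neg hx)
    (hPL.1.differentiableAt_of_neg hx)]
  exact h.2 n hn

/-- A bound on the partial derivatives of `V` makes it Lipschitz on `D`. -/
theorem abs_sub_le_of_gradient_le {d : ℕ} {D : Set (Vec d)} (hD : Convex ℝ D)
    {v : Vec d → ℝ} {L M : ℝ} (hv : SmoothOn D (fun z => -v z) L) (hM : 0 ≤ M)
    (hvM : ∀ z ∈ D, ‖(gradient (fun z => -v z) z).ofLp‖ ≤ M) {z w : Vec d} (hz : z ∈ D)
    (hw : w ∈ D) : |v z - v w| ≤ Real.sqrt d * M * ‖z - w‖ := by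
  have h := abs_sub_le_of_norm_gradient_le hD hv.1
    (fun z hz => norm_le_sqrt_mul_of_abs_le hM fun j =>
      (norm_le_pi_norm (gradient (fun z => -v z) z).ofLp j).trans (hvM z hz)) hz hw
  rwa [neg_sub_neg, abs_sub_comm] at h

theorem C₂_nonneg {d : ℕ} {a b δ L Dg : ℝ} (hδ0 : 0 < δ) (hδa : δ < 2 * d * a) (hb : 0 < b)
    (hL : 0 ≤ L) (hDg : 0 ≤ Dg) : 0 ≤ C₂ d a b δ L Dg := by
  have hlog : 0 ≤ Real.log (2 * d * a / δ) := Real.log_nonneg (by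
    rw [le_div_iff₀ hδ0]
    linarith)
  unfold C₂
  positivity

/-- For Lipschitz objectives the regret grows at most linearly, whatever the decisions. -/
theorem regret_le_of_lipschitz {d : ℕ} {D : Set (Vec d)} {r : ℝ} (hr : 0 < r)
    (hDbox : ∀ x ∈ D, ∀ j, 0 ≤ x j ∧ x j ≤ r) {V : Vec d → ℝ → ℝ} {t : ℕ → ℝ} {A C : ℝ}
    (hA : 0 ≤ A) (hC : 0 ≤ C)
    (hV : ∀ n, 1 ≤ n → ∀ z ∈ D, ∀ w ∈ D, |V z (t n) - V w (t n)| ≤ A * ‖z - w‖)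
    {u : Vec d → ℝ} (hu : ∀ z ∈ D, ∀ w ∈ D, |u z - u w| ≤ C * ‖z - w‖) {x : ℕ → Vec d}
    (hx : ∀ n, x n ∈ D) (T : ℕ) :
    regret D V t u x T ≤ (A + C) * (Real.sqrt d * r) * T := by
  calc regret D V t u x T ≤ ∑ _n ∈ Finset.Icc 1 T, (A + C) * (Real.sqrt d * r) :=
        Finset.sum_le_sum fun n hn =>
          regret_term_le hr hDbox hA hC (hV n (Finset.mem_Icc.1 hn).1) hu (hx n)
    _ = _ := by
        rw [Finset.sum_const, Nat.card_Icc, nsmul_eq_mul, Nat.add_sub_cancel, mul_comm]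

end AGPUCB

end

theorem corollary1
    {d : ℕ} {Ω : Type*} [MeasurableSpace Ω] (P : MeasureTheory.Measure Ω)
    [MeasureTheory.IsProbabilityMeasure P]
    -- the decision set
    (D : Set (AGPUCB.Vec d)) (r : ℝ) (hr : 0 < r)
    (hDcompact : IsCompact D) (hDconvex : Convex ℝ D)
    (hDbox : ∀ x ∈ D, ∀ j, 0 ≤ x j ∧ x j ≤ r)
    -- sampling times and the engineering function
    (h : ℝ) (hh : 0 < h) (t : ℕ → ℝ) (ht : ∀ n, t n = n * h)
    (V : AGPUCB.Vec d → ℝ → ℝ) (L : ℝ) (hL : 0 ≤ L)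
    (hVconc : ∀ n, 1 ≤ n → ConcaveOn ℝ D (fun x => V x (t n)))
    (hVsmooth : ∀ n, 1 ≤ n → AGPUCB.SmoothOn D (fun x => -V x (t n)) L)
    (Dg : ℝ)
    (hDg : IsLUB {s : ℝ | ∃ n, 1 ≤ n ∧ ∃ y ∈ D,
      s = ‖(gradient (fun x => -V x (t n)) y).ofLp‖} Dg)
    (Δ : ℝ) (hΔ : ∀ n, 2 ≤ n → AGPUCB.drift D V t n ≤ Δ)
    -- the user's function: a sample path of a Gaussian process
    (k : AGPUCB.Vec d → AGPUCB.Vec d → ℝ) (U : AGPUCB.Vec d → Ω → ℝ)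
    (hU : AGPUCB.IsCentredGP P U k)
    (hk : ∀ x ∈ D, k x x ≤ 1) (hknd : AGPUCB.NonDegenerate k D)
    (hUdiff : ∀ ω, ∀ x ∈ D, DifferentiableAt ℝ (fun z => U z ω) x)
    (a b : ℝ) (ha : 0 < a) (hb : 0 < b)
    (hUtail : ∀ j : Fin d, ∀ M : ℝ, 0 < M →
      P {ω | ∃ x ∈ D, M < |gradient (fun z => U z ω) x j|} ≤
        ENNReal.ofReal (a * Real.exp (-(M / b) ^ 2)))
    -- observation noise
    (σ : ℝ) (hσ : 0 < σ) (ε : ℕ → Ω → ℝ) (hε : AGPUCB.IsNoise P U ε σ)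
    -- confidence level
    (δ : ℝ) (hδ0 : 0 < δ) (hδ1 : δ < 1) (hδa : δ < 2 * d * a)
    -- stepsize, smoothness and PL constants
    (α Θ κ : ℝ) (hα : 0 < α) (hΘ : 0 < Θ) (hαΘ : α ≤ 1 / Θ) (hκ : 0 < κ) (hακ : α * κ ≤ 1)
    -- the run of the algorithm
    (x₀ : AGPUCB.Vec d) (hx₀ : x₀ ∈ D) (X : ℕ → Ω → AGPUCB.Vec d)
    (hXmeas : ∀ n, Measurable[AGPUCB.pastFeedback U ε X n] (X n))
    (hX : ∀ ω, AGPUCB.IsRun D V t k σ (AGPUCB.beta d a b r δ) α x₀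
      (fun n => X n ω) (fun n => AGPUCB.feedback U ε X n ω))
    -- the surrogate objectives met along the run
    (φ : ℕ → Ω → AGPUCB.Vec d → ℝ)
    (hφ : ∀ n ω, φ n ω = AGPUCB.surrogate V t k σ (AGPUCB.beta d a b r δ)
      (fun i => X i ω) (fun i => AGPUCB.feedback U ε X i ω) n) :
    -- linear rate `1 - ακ` of the projected gradient step
    (∀ ω, ∀ n, 1 ≤ n → AGPUCB.ProxPL D (φ n ω) Θ κ (1 / α) →
      AGPUCB.maxOver D (φ n ω) - φ n ω (X n ω) ≤
        (1 - α * κ) * (AGPUCB.maxOver D (φ n ω) - φ n ω (X (n - 1) ω))) ∧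
    -- regret of order `O^*(√(d T γ_T)) + O(T)`
    (∃ (C : ℝ) (p : ℕ), ∀ T : ℕ, 1 ≤ T →
      P {ω | ¬ ((∀ n, 1 ≤ n → n ≤ T → AGPUCB.ProxPL D (φ n ω) Θ κ (1 / α)) →
        AGPUCB.regret D V t (fun z => U z ω) (fun n => X n ω) T ≤
          C * (1 + Real.log T) ^ p * Real.sqrt (d * T * AGPUCB.infoGain k σ D T) + C * T)} ≤
        ENNReal.ofReal δ) ∧
    -- the explicit regret bound; the term `O^*(1)` is `C (1 + log T)^p`
    (∃ (C : ℝ) (p : ℕ), ∀ T : ℕ, 1 ≤ T →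
      P {ω | ¬ ((∀ n, 1 ≤ n → n ≤ T → AGPUCB.ProxPL D (φ n ω) Θ κ (1 / α)) →
        AGPUCB.regret D V t (fun z => U z ω) (fun n => X n ω) T ≤
          Real.sqrt (AGPUCB.C₁ σ * T * AGPUCB.beta d a b r δ T * AGPUCB.infoGain k σ D T) +
            AGPUCB.C₂ d a b δ L Dg + C * (1 + Real.log T) ^ p +
            AGPUCB.driftTerm (1 - α * κ) (AGPUCB.drift D V t) T)} ≤
        ENNReal.ofReal δ) ∧
    -- the drift term grows at most linearly
    (∀ T : ℕ, 1 ≤ T → AGPUCB.driftTerm (1 - α * κ) (AGPUCB.drift D V t) T ≤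
      2 * Δ * (1 - α * κ) * T / (1 - (1 - α * κ))) := by
  have hη0 : 0 ≤ 1 - α * κ := by linarith
  have hη1 : 1 - α * κ < 1 := by linarith [mul_pos hα hκ]
  have hΔ0 : 0 ≤ Δ := (AGPUCB.drift_nonneg D V t 2).trans (hΔ 2 le_rfl)
  have hDg0 : 0 ≤ Dg := (norm_nonneg _).trans (hDg.1 ⟨1, le_rfl, x₀, hx₀, rfl⟩)
  have hK := hU.isPosSemidefKernel
  have hXD : ∀ n ω, X n ω ∈ D := fun n ω => (hX ω).mem hx₀ n
  have hcontract : ∀ ω, ∀ n, 1 ≤ n → AGPUCB.ProxPL D (φ n ω) Θ κ (1 / α) →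
      AGPUCB.maxOver D (φ n ω) - φ n ω (X n ω) ≤
        (1 - α * κ) * (AGPUCB.maxOver D (φ n ω) - φ n ω (X (n - 1) ω)) := by
    intro ω n hn hPL
    rw [hφ] at hPL ⊢
    exact (hX ω).maxOver_sub_le hDconvex hVsmooth hα hΘ hαΘ hx₀ hn hPL
  have hVlip : ∀ n, 1 ≤ n → ∀ z ∈ D, ∀ w ∈ D,
      |V z (t n) - V w (t n)| ≤ Real.sqrt d * Dg * ‖z - w‖ := fun n hn z hz w hw =>
    AGPUCB.abs_sub_le_of_gradient_le hDconvex (hVsmooth n hn) hDg0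
      (fun y hy => hDg.1 ⟨n, hn, y, hy, rfl⟩) hz hw
  have hA0 : 0 ≤ Real.sqrt d * Dg := by positivity
  obtain ⟨Ck, hCk, hklip⟩ := AGPUCB.exists_kernel_lipschitz hDconvex hU hUdiff hb hUtail
  have hkc := AGPUCB.continuous_kernel hK hk hCk hklip
  have hnets : ∀ n : ℕ, ∃ S : Finset (AGPUCB.Vec d), 1 ≤ n → (∀ z ∈ S, z ∈ D) ∧
      (S.card : ℝ) ≤ (r * n + 1) ^ d ∧ ∀ x ∈ D, ∃ z ∈ S, ‖x - z‖ ≤ Real.sqrt d / n := by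
    intro n
    by_cases hn : 1 ≤ n
    · obtain ⟨S, hS⟩ := AGPUCB.exists_net hr hDbox hn
      exact ⟨S, fun _ => hS⟩
    · exact ⟨∅, fun hn' => absurd hn' hn⟩
  choose net hnet using hnets
  obtain ⟨C, B, N, hC, hB, hN1, hβ, hgood⟩ := AGPUCB.exists_isGoodRun hDcompact hDconvex hU hkc
    hUdiff hb hUtail hσ hε hδ0 hδa hr (fun n hn => (hnet n hn).1) (fun n hn => (hnet n hn).2.1)
    (fun ω => (hX ω).1) hXD hXmeas
  obtain ⟨Cβ, hCβ, hβC⟩ := AGPUCB.exists_sqrt_beta_le hδ0 hδa hb hr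
  obtain ⟨M, hM, hregret⟩ := AGPUCB.exists_regret_le hDcompact hr hDbox hA0 hVlip hΔ0 hΔ hK hk hCk
    hklip hσ (fun n hn => (hnet n hn).1) (fun n hn => (hnet n hn).2.2) hC hB hN1 hβ
    (fun m n hm hmn => AGPUCB.beta_mono hδ0 hδa hb hr hm hmn) hCβ hβC hη0 hη1
  refine ⟨hcontract, ⟨(Real.sqrt d * Dg + C) * (Real.sqrt d * r), 0, fun T hT => ?_⟩,
    ⟨M, 2, fun T hT => ?_⟩, fun T hT => AGPUCB.driftTerm_le hη0 hη1 hΔ0 hΔ T⟩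
  · -- the first summand of the bound is nonnegative, and the linear one suffices
    refine (measure_mono fun ω hω => ?_).trans hgood
    refine fun hgoodω => hω fun _ => ?_
    have h1 := AGPUCB.regret_le_of_lipschitz hr hDbox hA0 hC hVlip hgoodω.lipschitz
      (fun n => hXD n ω) T
    refine h1.trans (le_add_of_nonneg_left ?_)
    positivity
  · refine (measure_mono fun ω hω => ?_).trans hgood
    refine fun hgoodω => hω fun hPL => ?_
    have h1 := hregret _ _ _ hgoodω (fun n => hXD n ω) T hT
      (fun n hn hnT => by
        have h := (hPL n hn hnT).1.continuousOn_of_neg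
        rwa [hφ] at h)
      (fun n hn hnT => by
        have h := hcontract ω n hn (hPL n hn hnT)
        rwa [hφ] at h)
    have h2 := AGPUCB.C₂_nonneg hδ0 hδa hb hL hDg0
    linarith
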